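/- Let $\psi:\{0,1\}^n\to\{0,1\}$, $n\ge 0$, be a Boolean function with $\psi\not\equiv 0$. *Regular functions.* For $n\ge1$ let $E_n(\psi)$ and $A_n(\psi)$ be the Boolean functions in $n-1$ variables given by $\exists\xi_n\,\psi(\xi_1,\dots,\xi_n)$ and $\forall\xi_n\,\psi(\xi_1,\dots,\xi_n)$. Regularity is defined by induction on $n$. Every Boolean function of at most one variable is regular. A Boolean function of two variables is regular iff $\{\psi=1\}$ is neither $\{(1,0),(0,1)\}$ nor $\{(0,0),(1,1)\}$. For $n>2$, $\psi$ is regular iff the restriction of $\psi$ to each Boolean square, obtained by fixing the values of any $n-2$ of the variables, is regular, and both $E_n(\psi)$ and $A_n(\psi)$ are regular. *Cubes.* To $\xi\in\{0,1\}^n$ corresponds the closed unit cube $Q_\xi=I_1\times\dots\times I_n\subset[-1,1]^n$, where $I_j=[0,1]$ if $\xi_j=1$ and $I_j=[-1,0]$ if $\xi_j=0$. Let $C_\psi=\bigcup_{\psi(\xi)=1}Q_\xi$. A map on a finite union of convex polytopes is called PL if its domain is a union of finitely many convex polytopes on each of which it is affine. A set is a closed PL $n$-ball if there are mutually inverse PL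 maps between it and $[-1,1]^n$. **Theorem.** $\psi$ is regular if and only if $C_\psi$ is a closed PL $n$-ball. -/

import Mathlib

/-- The Boolean function `E_n(ψ)` obtained from `ψ` by existential quantification over the last
variable. -/
def BoolFun.existsLast {n : ℕ} (ψ : (Fin (n + 1) → Bool) → Bool) : (Fin n → Bool) → Bool :=
  fun ξ => ψ (Fin.snoc ξ false) || ψ (Fin.snoc ξ true)

/-- The Boolean function `A_n(ψ)` obtained from `ψ` by universal quantification over the last
variable. -/
def BoolFun.forallLast {n : ℕ} (ψ : (Fin (n + 1) → Bool) → Bool) : (Fin n → Bool) → Bool :=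
  fun ξ => ψ (Fin.snoc ξ false) && ψ (Fin.snoc ξ true)

/-- A Boolean function in two variables is regular if the set where it takes the value `1` is not
a pair of diagonally opposite vertices of the square. -/
def BoolFun.IsRegularSquare (χ : (Fin 2 → Bool) → Bool) : Prop :=
  {ξ | χ ξ = true} ≠ {![true, false], ![false, true]} ∧
    {ξ | χ ξ = true} ≠ {![false, false], ![true, true]}

/-- The restriction of `ψ` to the Boolean square on which the variables `i` and `j` are free and
every other variable `k` has the fixed value `c k`. -/
def BoolFun.restrictSquare {n : ℕ} (ψ : (Fin n → Bool) → Bool) (i j : Fin n) (c : Fin n → Bool) :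
    (Fin 2 → Bool) → Bool :=
  fun η => ψ (Function.update (Function.update c i (η 0)) j (η 1))

/-- Regular Boolean functions, defined by induction on the number of variables. -/
def BoolFun.IsRegular : {n : ℕ} → ((Fin n → Bool) → Bool) → Prop
  | 0, _ => True
  | 1, _ => True
  | 2, ψ => BoolFun.IsRegularSquare ψ
  | _ + 3, ψ =>
      (∀ i j, i < j → ∀ c, BoolFun.IsRegularSquare (BoolFun.restrictSquare ψ i j c)) ∧
        BoolFun.IsRegular (BoolFun.existsLast ψ) ∧ BoolFun.IsRegular (BoolFun.forallLast ψ)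

/-- The closed unit cube in `[-1,1]ⁿ` corresponding to the vertex `ξ` of `{0,1}ⁿ`: the product of
the intervals `[0,1]` for `ξ i = 1` and `[-1,0]` for `ξ i = 0`, so that its center is
`ξ - (1/2, …, 1/2)`. -/
def unitSubcube {n : ℕ} (ξ : Fin n → Bool) : Set (Fin n → ℝ) :=
  {x | ∀ i, x i ∈ if ξ i = true then Set.Icc (0 : ℝ) 1 else Set.Icc (-1 : ℝ) 0}

/-- The union of the closed unit cubes corresponding to the points of `{ψ = 1}`. -/
def cubeUnion {n : ℕ} (ψ : (Fin n → Bool) → Bool) : Set (Fin n → ℝ) :=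
  ⋃ ξ ∈ {ξ | ψ ξ = true}, unitSubcube ξ

/-- `f` is a piecewise linear map on the compact polyhedron `X`: `X` is a union of finitely many
convex polytopes (convex hulls of finite sets), and `f` agrees with an affine map on each of
them. -/
def IsPLOn {E F : Type*} [AddCommGroup E] [Module ℝ E] [AddCommGroup F] [Module ℝ F]
    (f : E → F) (X : Set E) : Prop :=
  ∃ S : Finset (Finset E), X = ⋃ s ∈ S, convexHull ℝ (s : Set E) ∧
    ∀ s ∈ S, ∃ g : E →ᵃ[ℝ] F, Set.EqOn f g (convexHull ℝ (s : Set E))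

/-- The sets `X` and `Y` are PL homeomorphic compact polyhedra: there are mutually inverse
piecewise linear maps between them. -/
def PLHomeomorphic {E F : Type*} [AddCommGroup E] [Module ℝ E] [AddCommGroup F] [Module ℝ F]
    (X : Set E) (Y : Set F) : Prop :=
  ∃ (f : E → F) (g : F → E), IsPLOn f X ∧ IsPLOn g Y ∧
    Set.MapsTo f X Y ∧ Set.MapsTo g Y X ∧ Set.InvOn g f X Y

/-- A closed PL `n`-ball: a set that is PL homeomorphic to the cube `[-1,1]ⁿ`. -/
def IsClosedPLBall (n : ℕ) {E : Type*} [AddCommGroup E] [Module ℝ E] (X : Set E) : Prop :=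
  PLHomeomorphic {x : Fin n → ℝ | ∀ i, x i ∈ Set.Icc (-1 : ℝ) 1} X

/-! Regularity is first made symmetric in the variables. `HReg ψ` says that ψ lies in some class of
functions with regular squares that is stable under both quantifiers and under substitution, in
every variable. It is also stable under negation. The equivalence `isRegular_iff_hReg` rests on
`hReg_of_quantified`: by case checks on squares and three-dimensional cubes, control of the two
quantifications over one variable and of the squares in its direction suffices.

Ball implies regular. The invariant is the Euler characteristic with compact supports of the tangent
cone at a point. It is computed by giving each relatively open convex cell the weight (-1)^dim. It
is preserved by PL homeomorphisms, because these induce bijections of tangent cones that are linear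
on cells (`chi_tanCone_eq`). In the cube it is (-1)^n at interior points and 0 at boundary points.
At a point with sign vector σ in the union of cubes it equals `eul ψ σ`, so a ball satisfies `EReg`:
the value is (-1)^n where ψ is 1 on the whole face σ, and 0 elsewhere. This condition is stable
under quantification by inclusion-exclusion (`eul_ex`), under negation by an inversion formula
(`sum_sum_wt_ov`), and under substitution, and it excludes diagonal squares. Hence the functions
satisfying `EReg` form a class of the kind required by `HReg`.

Regular implies ball. Unit cubes are replaced by closed orthants, and balls by half-spaces. All maps
are piecewise linear on cones and preserve the supremum norm, so intersecting with [-1,1]^n returns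
to cubes. By induction on the set of variables, the sector of a nonconstant ψ is a half-space whose
wall is the common part with the sector of the negation (`isBall_sector`). The hyperplane x_j = 0
cuts the sector into two products with a half-line, over the sectors of the two substitutions. By
`exists_fa_of_hReg` these meet exactly in the sector of `fa j ψ`. If that function is nonconstant, a
chart of its sector is extended to both sides and glued. The extension needs the rest of the
boundary of each side to be a ball; this is `isBall_complement`, which uses the sector of the
negation of `fa j ψ` and so avoids any general theorem on complements of balls. If `fa j ψ`
vanishes, only one side is present. -/

namespace BoolFun

open Function

/-! ### Quantifiers, substitution and hereditary regularity -/

section Operators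

variable {ι : Type*} [DecidableEq ι]

/-- Existential quantification over the variable `j`, as a function of the same variables. -/
def ex (j : ι) (ψ : (ι → Bool) → Bool) : (ι → Bool) → Bool :=
  fun ξ => ψ (update ξ j false) || ψ (update ξ j true)

/-- Universal quantification over the variable `j`, as a function of the same variables. -/
def fa (j : ι) (ψ : (ι → Bool) → Bool) : (ι → Bool) → Bool :=
  fun ξ => ψ (update ξ j false) && ψ (update ξ j true)

/-- Substitution of the constant `b` for the variable `j`. -/
def res (j : ι) (b : Bool) (ψ : (ι → Bool) → Bool) : (ι → Bool) → Bool :=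
  fun ξ => ψ (update ξ j b)

/-- Pointwise negation. -/
def neg (ψ : (ι → Bool) → Bool) : (ι → Bool) → Bool := fun ξ => !ψ ξ

/-- No square in the directions `i`, `j` meets `{ψ = 1}` in two opposite vertices only. -/
def SqAt (ψ : (ι → Bool) → Bool) (i j : ι) : Prop :=
  ∀ c a b, ψ (update (update c i a) j b) = true → ψ (update (update c i !a) j !b) = true →
    ψ (update (update c i a) j !b) = true ∨ ψ (update (update c i !a) j b) = true

/-- All two-dimensional restrictions are regular. -/
def SqReg (ψ : (ι → Bool) → Bool) : Prop := ∀ i j, i ≠ j → SqAt ψ i j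

/-- `ψ` belongs to a class of functions with regular squares that is closed under quantification
and substitution. -/
def HReg (ψ : (ι → Bool) → Bool) : Prop :=
  ∃ K : Set ((ι → Bool) → Bool), ψ ∈ K ∧ ∀ χ ∈ K, SqReg χ ∧
    ∀ j, ex j χ ∈ K ∧ fa j χ ∈ K ∧ ∀ b, res j b χ ∈ K

omit [DecidableEq ι] in
@[simp] lemma neg_neg' (ψ : (ι → Bool) → Bool) : neg (neg ψ) = ψ := by
  funext ξ; simp [neg]

lemma neg_ex (j : ι) (ψ : (ι → Bool) → Bool) : neg (ex j ψ) = fa j (neg ψ) := by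
  funext ξ; simp [neg, ex, fa]

lemma neg_fa (j : ι) (ψ : (ι → Bool) → Bool) : neg (fa j ψ) = ex j (neg ψ) := by
  funext ξ; simp [neg, ex, fa, Bool.not_and]

lemma neg_res (j : ι) (b : Bool) (ψ : (ι → Bool) → Bool) :
    neg (res j b ψ) = res j b (neg ψ) := rfl

lemma SqAt.symm {ψ : (ι → Bool) → Bool} {i j : ι} (hij : i ≠ j) (h : SqAt ψ i j) :
    SqAt ψ j i := by
  intro c a b
  rw [update_comm hij.symm, update_comm hij.symm, update_comm hij.symm, update_comm hij.symm]
  intro h1 h2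
  exact (h c b a h1 h2).symm

lemma SqAt.neg {ψ : (ι → Bool) → Bool} {i j : ι} (h : SqAt ψ i j) : SqAt (neg ψ) i j := by
  intro c a b h1 h2
  by_contra hc
  simp only [BoolFun.neg, Bool.not_eq_true', not_or, Bool.not_eq_false] at h1 h2 hc
  have := h c a (!b) hc.1 (by simpa using hc.2)
  simp_all

lemma HReg.sqReg {ψ : (ι → Bool) → Bool} (h : HReg ψ) : SqReg ψ := by
  obtain ⟨K, hK, h⟩ := h
  exact (h ψ hK).1

lemma HReg.ex {ψ : (ι → Bool) → Bool} (h : HReg ψ) (j : ι) : HReg (ex j ψ) := by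
  obtain ⟨K, hK, h⟩ := h
  exact ⟨K, ((h ψ hK).2 j).1, h⟩

lemma HReg.fa {ψ : (ι → Bool) → Bool} (h : HReg ψ) (j : ι) : HReg (fa j ψ) := by
  obtain ⟨K, hK, h⟩ := h
  exact ⟨K, ((h ψ hK).2 j).2.1, h⟩

lemma HReg.res {ψ : (ι → Bool) → Bool} (h : HReg ψ) (j : ι) (b : Bool) : HReg (res j b ψ) := by
  obtain ⟨K, hK, h⟩ := h
  exact ⟨K, ((h ψ hK).2 j).2.2 b, h⟩

/-- The complement of a diagonal pair in a square is the other diagonal pair, and negation exchanges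
the two quantifiers. Negating every member of a witnessing class therefore gives a witnessing class.
-/
lemma HReg.neg {ψ : (ι → Bool) → Bool} (h : HReg ψ) : HReg (neg ψ) := by
  obtain ⟨K, hK, h⟩ := h
  refine ⟨{χ | BoolFun.neg χ ∈ K}, by simpa using hK, fun χ hχ => ⟨fun i j hij => ?_, fun j =>
    ⟨?_, ?_, fun b => ?_⟩⟩⟩
  · simpa using ((h _ hχ).1 i j hij).neg
  · simpa [neg_ex] using ((h _ hχ).2 j).2.1
  · simpa [neg_fa] using ((h _ hχ).2 j).1
  · simpa [neg_res] using ((h _ hχ).2 j).2.2 b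

lemma ex_comm (i j : ι) (ψ : (ι → Bool) → Bool) : ex i (ex j ψ) = ex j (ex i ψ) := by
  by_cases hij : i = j
  · rw [hij]
  funext ξ
  simp only [ex, update_comm hij]
  cases ψ (update (update ξ j false) i false) <;> simp [Bool.or_left_comm]

lemma fa_comm (i j : ι) (ψ : (ι → Bool) → Bool) : fa i (fa j ψ) = fa j (fa i ψ) := by
  by_cases hij : i = j
  · rw [hij]
  funext ξ
  simp only [fa, update_comm hij]
  cases ψ (update (update ξ j false) i false) <;> simp [Bool.and_left_comm]

lemma res_ex {i j : ι} (hij : i ≠ j) (b : Bool) (ψ : (ι → Bool) → Bool) :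
    res i b (ex j ψ) = ex j (res i b ψ) := by
  funext ξ; simp only [res, ex, update_comm hij]

lemma res_fa {i j : ι} (hij : i ≠ j) (b : Bool) (ψ : (ι → Bool) → Bool) :
    res i b (fa j ψ) = fa j (res i b ψ) := by
  funext ξ; simp only [res, fa, update_comm hij]

lemma res_comm {i j : ι} (hij : i ≠ j) (a b : Bool) (ψ : (ι → Bool) → Bool) :
    res i a (res j b ψ) = res j b (res i a ψ) := by
  funext ξ; simp only [res, update_comm hij]

lemma ex_res_self (j : ι) (b : Bool) (ψ : (ι → Bool) → Bool) :
    ex j (res j b ψ) = res j b ψ := by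
  funext ξ; simp [res, ex]

lemma fa_res_self (j : ι) (b : Bool) (ψ : (ι → Bool) → Bool) :
    fa j (res j b ψ) = res j b ψ := by
  funext ξ; simp [res, fa]

lemma res_res_self (j : ι) (a b : Bool) (ψ : (ι → Bool) → Bool) :
    res j a (res j b ψ) = res j b ψ := by
  funext ξ; simp [res]

/-- Quantifiers over the directions of regular squares commute. -/
lemma fa_ex_comm {ψ : (ι → Bool) → Bool} {i j : ι} (hij : i ≠ j) (h : SqAt ψ i j) :
    fa i (ex j ψ) = ex j (fa i ψ) := by
  -- On a single square the two sides differ only when ψ is 1 exactly on a diagonal pair, which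
  -- leaves sixteen cases.
  funext ξ
  have h1 := h ξ false false
  have h2 := h ξ false true
  simp only [Bool.not_false, Bool.not_true] at h1 h2
  simp only [fa, ex, update_comm hij.symm]
  revert h1 h2
  generalize ψ (update (update ξ i false) j false) = a
  generalize ψ (update (update ξ i false) j true) = b
  generalize ψ (update (update ξ i true) j false) = c
  generalize ψ (update (update ξ i true) j true) = d
  revert a b c d
  decide

/-! ### Regularity of squares inside a three-dimensional cube -/

section Cube

variable {ψ : (ι → Bool) → Bool} {i j k : ι}

/-- The values of `ψ` on a cube in the directions `i`, `j`, `k`. -/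
def cubeVal (ψ : (ι → Bool) → Bool) (i j k : ι) (c : ι → Bool) (a b d : Bool) : Bool :=
  ψ (update (update (update c i a) j b) k d)

lemma SqAt.cubeVal_snd (h : SqAt ψ j k) (c : ι → Bool) (a b d : Bool) :
    cubeVal ψ i j k c a b d = true → cubeVal ψ i j k c a (!b) (!d) = true →
      cubeVal ψ i j k c a b (!d) = true ∨ cubeVal ψ i j k c a (!b) d = true :=
  h (update c i a) b d

lemma SqAt.cubeVal_fst (hij : i ≠ j) (h : SqAt ψ i k) (c : ι → Bool) (a b d : Bool) :
    cubeVal ψ i j k c a b d = true → cubeVal ψ i j k c (!a) b (!d) = true →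
      cubeVal ψ i j k c a b (!d) = true ∨ cubeVal ψ i j k c (!a) b d = true := by
  have := h (update c j b) a d
  simpa only [cubeVal, update_comm hij.symm] using this

/-- In a counterexample the witnesses for the middle coordinate at the two diagonal vertices differ,
by `h1`. All other values are then forced, and projecting along the last coordinate gives a diagonal
pair, contrary to `h3`. -/
lemma sqAt_ex_of_cube {t : Bool → Bool → Bool → Bool}
    (h1 : ∀ a b d, t a b d = true → t (!a) b (!d) = true → t a b (!d) = true ∨ t (!a) b d = true)
    (h3 : ∀ a b, (t a b false || t a b true) = true → (t (!a) (!b) false || t (!a) (!b) true) = true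
      → (t a (!b) false || t a (!b) true) = true ∨ (t (!a) b false || t (!a) b true) = true)
    (a d : Bool) :
    (t a false d || t a true d) = true → (t (!a) false (!d) || t (!a) true (!d)) = true →
      (t a false (!d) || t a true (!d)) = true ∨ (t (!a) false d || t (!a) true d) = true := by
  cases a <;> cases d <;> simp only [Bool.forall_bool, Bool.not_true, Bool.not_false,
    Bool.or_eq_true] at * <;> grind

/-- Suppose that the layer d is a diagonal pair. By `h3` the other layer has a 1 over one of the two
missing vertices, and then `h1` and `h2` force a 1 there over both diagonal vertices. So universal
quantification over the last coordinate gives a diagonal pair, contrary to `h4`. -/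
lemma sqAt_of_cube {t : Bool → Bool → Bool → Bool}
    (h1 : ∀ a b d, t a b d = true → t (!a) b (!d) = true → t a b (!d) = true ∨ t (!a) b d = true)
    (h2 : ∀ a b d, t a b d = true → t a (!b) (!d) = true → t a b (!d) = true ∨ t a (!b) d = true)
    (h3 : ∀ a b, (t a b false || t a b true) = true → (t (!a) (!b) false || t (!a) (!b) true) = true
      → (t a (!b) false || t a (!b) true) = true ∨ (t (!a) b false || t (!a) b true) = true)
    (h4 : ∀ a b, (t a b false && t a b true) = true → (t (!a) (!b) false && t (!a) (!b) true) = true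
      → (t a (!b) false && t a (!b) true) = true ∨ (t (!a) b false && t (!a) b true) = true)
    (a b d : Bool) :
    t a b d = true → t (!a) (!b) d = true → t a (!b) d = true ∨ t (!a) b d = true := by
  cases a <;> cases b <;> cases d <;> simp only [Bool.forall_bool, Bool.not_true, Bool.not_false,
    Bool.or_eq_true, Bool.and_eq_true] at * <;> grind

lemma SqAt.of_quantified (hij : i ≠ j) (hik : i ≠ k) (hjk : j ≠ k) (h1 : SqAt ψ i k)
    (h2 : SqAt ψ j k) (h3 : SqAt (BoolFun.ex k ψ) i j) (h4 : SqAt (BoolFun.fa k ψ) i j) :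
    SqAt ψ i j := by
  intro c a b
  -- The last coordinate is taken to be `c k`, so that the square under consideration is a layer of
  -- the cube.
  have key := sqAt_of_cube (t := cubeVal ψ i j k c) (h1.cubeVal_fst hij c) (h2.cubeVal_snd c)
    (fun a b => h3 c a b) (fun a b => h4 c a b) a b (c k)
  have e : ∀ a b, cubeVal ψ i j k c a b (c k) = ψ (update (update c i a) j b) := by
    intro a b
    unfold cubeVal
    congr 1
    rw [update_eq_self_iff, update_of_ne hjk.symm, update_of_ne hik.symm]
  simpa only [e] using key

lemma SqAt.ex_of_quantified (hij : i ≠ j) (hjk : j ≠ k) (h1 : SqAt ψ i k)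
    (h3 : SqAt (BoolFun.ex k ψ) i j) : SqAt (BoolFun.ex j ψ) i k := by
  intro c a d
  have key := sqAt_ex_of_cube (t := cubeVal ψ i j k c) (h1.cubeVal_fst hij c)
    (fun a b => h3 c a b) a d
  simpa only [cubeVal, BoolFun.ex, update_comm hjk] using key

lemma SqAt.fa_of_quantified (hij : i ≠ j) (hjk : j ≠ k) (h1 : SqAt ψ i k)
    (h4 : SqAt (BoolFun.fa k ψ) i j) : SqAt (BoolFun.fa j ψ) i k := by
  have h := (SqAt.ex_of_quantified hij hjk h1.neg (by rw [← neg_fa]; exact h4.neg)).neg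
  rwa [neg_ex, neg_neg'] at h

end Cube

lemma SqAt.res {ψ : (ι → Bool) → Bool} {i k l : ι} (hil : i ≠ l) (hkl : k ≠ l) (b : Bool)
    (h : SqAt ψ i k) : SqAt (res l b ψ) i k := by
  intro c a d
  have := h (update c l b) a d
  simpa only [BoolFun.res, update_comm hil, update_comm hkl] using this

/-- Regularity of both quantifications over one variable, and of the squares in the direction of
this variable, gives hereditary regularity. -/
lemma hReg_of_quantified {ψ : (ι → Bool) → Bool} {k : ι} (he : HReg (ex k ψ))
    (ha : HReg (fa k ψ)) (hs : ∀ i, i ≠ k → SqAt ψ i k) : HReg ψ := by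
  -- The hypotheses are turned into a predicate, which is then shown to be stable under all
  -- operations in variables other than k. Operations in k lead out of it, either into `HReg` or to
  -- functions independent of k.
  let H : ((ι → Bool) → Bool) → Prop := fun χ =>
    HReg (BoolFun.ex k χ) ∧ HReg (BoolFun.fa k χ) ∧ ∀ i, i ≠ k → SqAt χ i k
  have hsq : ∀ χ, H χ → ∀ i j, i ≠ j → i ≠ k → j ≠ k → SqAt χ i j := fun χ h i j hij hik hjk =>
    SqAt.of_quantified hij hik hjk (h.2.2 i hik) (h.2.2 j hjk) (h.1.sqReg i j hij)
      (h.2.1.sqReg i j hij)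
  have hex : ∀ χ, H χ → ∀ j, j ≠ k → H (BoolFun.ex j χ) := by
    refine fun χ h j hjk => ⟨?_, ?_, fun i hik => ?_⟩
    · rw [ex_comm]; exact h.1.ex j
    · rw [fa_ex_comm hjk.symm ((h.2.2 j hjk).symm hjk)]; exact h.2.1.ex j
    · by_cases hij : i = j
      · subst hij
        intro c a b
        simp only [BoolFun.ex, update_comm hjk, update_idem]
        tauto
      · exact SqAt.ex_of_quantified hij hjk (h.2.2 i hik) (h.1.sqReg i j hij)
  have hfa : ∀ χ, H χ → ∀ j, j ≠ k → H (BoolFun.fa j χ) := by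
    refine fun χ h j hjk => ⟨?_, ?_, fun i hik => ?_⟩
    · rw [← fa_ex_comm hjk (h.2.2 j hjk)]; exact h.1.fa j
    · rw [fa_comm]; exact h.2.1.fa j
    · by_cases hij : i = j
      · subst hij
        intro c a b
        simp only [BoolFun.fa, update_comm hjk, update_idem]
        tauto
      · exact SqAt.fa_of_quantified hij hjk (h.2.2 i hik) (h.2.1.sqReg i j hij)
  have hres : ∀ χ, H χ → ∀ j b, j ≠ k → H (BoolFun.res j b χ) := by
    refine fun χ h j b hjk => ⟨?_, ?_, fun i hik => ?_⟩
    · rw [← res_ex hjk]; exact h.1.res j b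
    · rw [← res_fa hjk]; exact h.2.1.res j b
    · by_cases hij : i = j
      · subst hij
        intro c a b
        simp only [BoolFun.res, update_comm hjk, update_idem]
        tauto
      · exact (h.2.2 i hik).res hij hjk.symm b
  -- Quantifying over k gives hereditarily regular functions. Substituting for k gives the third
  -- kind of member, on which all operations in k act trivially.
  refine ⟨{χ | HReg χ ∨ H χ ∨ ∃ χ' b, H χ' ∧ χ = BoolFun.res k b χ'}, Or.inr (Or.inl ⟨he, ha, hs⟩),
    ?_⟩
  rintro χ (h | h | ⟨χ, b, h, rfl⟩)
  · exact ⟨h.sqReg, fun j => ⟨Or.inl (h.ex j), Or.inl (h.fa j), fun b => Or.inl (h.res j b)⟩⟩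
  · refine ⟨fun i j hij => ?_, fun j => ?_⟩
    · by_cases hjk : j = k
      · subst hjk; exact h.2.2 i hij
      by_cases hik : i = k
      · subst hik; exact (h.2.2 j hjk).symm hjk
      exact hsq χ h i j hij hik hjk
    · by_cases hjk : j = k
      · subst hjk
        exact ⟨Or.inl h.1, Or.inl h.2.1, fun b => Or.inr (Or.inr ⟨χ, b, h, rfl⟩)⟩
      · exact ⟨Or.inr (Or.inl (hex χ h j hjk)), Or.inr (Or.inl (hfa χ h j hjk)),
          fun b => Or.inr (Or.inl (hres χ h j b hjk))⟩
  · refine ⟨fun i j hij => ?_, fun j => ?_⟩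
    · by_cases hjk : j = k
      · subst hjk
        intro c a b'
        simp only [BoolFun.res, update_idem]
        tauto
      by_cases hik : i = k
      · subst hik
        intro c a b'
        simp only [BoolFun.res, update_comm hij, update_idem]
        tauto
      exact (hsq χ h i j hij hik hjk).res hik hjk b
    · by_cases hjk : j = k
      · subst hjk
        simp only [ex_res_self, fa_res_self, res_res_self]
        exact ⟨Or.inr (Or.inr ⟨χ, b, h, rfl⟩), Or.inr (Or.inr ⟨χ, b, h, rfl⟩),
          fun _ => Or.inr (Or.inr ⟨χ, b, h, rfl⟩)⟩
      · refine ⟨Or.inr (Or.inr ⟨_, b, hex χ h j hjk, ?_⟩),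
          Or.inr (Or.inr ⟨_, b, hfa χ h j hjk, ?_⟩),
          fun a => Or.inr (Or.inr ⟨_, b, hres χ h j a hjk, ?_⟩)⟩
        · rw [res_ex (Ne.symm hjk)]
        · rw [res_fa (Ne.symm hjk)]
        · rw [res_comm hjk]

/-- Two points of `{ψ = 1}` on opposite sides with respect to the variable `j` can be joined
inside the face that they span by a pair of points adjacent in the direction `j`. -/
lemma exists_fa_of_hReg {j : ι} (T : Finset ι) (hj : j ∉ T) {ψ : (ι → Bool) → Bool} (h : HReg ψ)
    (ξ η : ι → Bool) (hξ : res j false ψ ξ = true) (hη : res j true ψ η = true)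
    (hT : ∀ i, i ∉ T → i ≠ j → ξ i = η i) :
    ∃ ζ, fa j ψ ζ = true ∧ ∀ i, i ∉ T → i ≠ j → ζ i = ξ i := by
  -- The set T contains all variables other than j in which the two points may differ; it is removed
  -- one variable at a time.
  induction T using Finset.induction_on generalizing ψ η with
  | empty =>
    refine ⟨ξ, ?_, fun _ _ _ => rfl⟩
    have : update η j true = update ξ j true := by
      funext i
      by_cases hi : i = j
      · subst hi; simp
      · simp [hi, hT i (by simp) hi]
    simp only [res, fa, this] at *
    simp [hξ, hη]
  | insert i T hi ih =>
    have hij : i ≠ j := fun e => hj (by simp [e])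
    have hjT : j ∉ T := fun e => hj (by simp [e])
    have mono : ∀ ζ, ψ ζ = true → ex i ψ ζ = true := by
      intro ζ hζ
      rw [← update_eq_self i ζ] at hζ
      simp only [ex, Bool.or_eq_true]
      cases h' : ζ i <;> simp_all
    -- Quantifying existentially over i allows the coordinate i of η to be reset to that of ξ, so
    -- that T suffices.
    obtain ⟨ζ, h1, h2⟩ := ih hjT (h.ex i) (update η i (ξ i)) (mono _ hξ)
      (by
        simp only [res, update_comm hij]
        have := mono _ hη
        simp only [ex, update_idem] at this ⊢
        exact this)
      (by
        intro l hl hlj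
        by_cases e : l = i
        · subst e; simp
        · rw [update_of_ne e]
          exact hT l (by simp [e, hl]) hlj)
    -- Commuting the quantifiers provides one value of the variable i that serves both sides of the
    -- direction j.
    rw [fa_ex_comm hij.symm (h.sqReg j i hij.symm)] at h1
    obtain ⟨b, hb⟩ : ∃ b, fa j ψ (update ζ i b) = true := by
      simp only [ex, Bool.or_eq_true] at h1
      exact h1.elim (fun h => ⟨_, h⟩) (fun h => ⟨_, h⟩)
    refine ⟨_, hb, fun l hl hlj => ?_⟩
    rw [Finset.mem_insert, not_or] at hl
    rw [update_of_ne hl.1, h2 l hl.2 hlj]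

end Operators

/-! ### Comparison with the recursive definition -/

section Regular

variable {n : ℕ}

/-- A function of the first `n` variables as a function of `n + 1` variables. -/
def lift (χ : (Fin n → Bool) → Bool) : (Fin (n + 1) → Bool) → Bool := fun ξ => χ (Fin.init ξ)

lemma init_update_castSucc (ξ : Fin (n + 1) → Bool) (i : Fin n) (b : Bool) :
    (Fin.init (update ξ i.castSucc b) : Fin n → Bool) = update (Fin.init ξ) i b :=
  Fin.init_update_castSucc ..

lemma init_update_last (ξ : Fin (n + 1) → Bool) (b : Bool) :
    (Fin.init (update ξ (Fin.last n) b) : Fin n → Bool) = Fin.init ξ :=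
  Fin.init_update_last ..

lemma update_last (ξ : Fin (n + 1) → Bool) (b : Bool) :
    update ξ (Fin.last n) b = Fin.snoc (α := fun _ => Bool) (Fin.init ξ) b := by
  refine Fin.lastCases ?_ (fun i => ?_) |> funext
  · simp
  · rw [update_of_ne (Fin.castSucc_lt_last i).ne, Fin.snoc_castSucc]; rfl

lemma lift_existsLast (ψ : (Fin (n + 1) → Bool) → Bool) :
    lift (existsLast ψ) = ex (Fin.last n) ψ := by
  funext ξ; simp [lift, existsLast, ex, update_last]

lemma lift_forallLast (ψ : (Fin (n + 1) → Bool) → Bool) :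
    lift (forallLast ψ) = fa (Fin.last n) ψ := by
  funext ξ; simp [lift, forallLast, fa, update_last]

lemma lift_ex (χ : (Fin n → Bool) → Bool) (i : Fin n) : lift (ex i χ) = ex i.castSucc (lift χ) := by
  funext ξ; simp only [lift, ex, init_update_castSucc]

lemma lift_fa (χ : (Fin n → Bool) → Bool) (i : Fin n) : lift (fa i χ) = fa i.castSucc (lift χ) := by
  funext ξ; simp only [lift, fa, init_update_castSucc]

lemma lift_res (χ : (Fin n → Bool) → Bool) (i : Fin n) (b : Bool) :
    lift (res i b χ) = res i.castSucc b (lift χ) := by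
  funext ξ; simp only [lift, res, init_update_castSucc]

lemma HReg.lift {χ : (Fin n → Bool) → Bool} (h : HReg χ) : HReg (lift χ) := by
  obtain ⟨K, hK, h⟩ := h
  refine ⟨BoolFun.lift '' K, ⟨_, hK, rfl⟩, ?_⟩
  rintro _ ⟨χ, hχ, rfl⟩
  refine ⟨fun i j => ?_, fun j => ?_⟩
  · refine Fin.lastCases ?_ (fun i => ?_) i
    · intro hij c a b
      simp only [BoolFun.lift, update_comm hij, init_update_last]
      tauto
    · refine Fin.lastCases ?_ (fun j => ?_) j
      · intro hij c a b
        simp only [BoolFun.lift, init_update_last]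
        tauto
      · intro hij c a b
        simp only [BoolFun.lift, init_update_castSucc]
        exact (h χ hχ).1 i j (fun e => hij (by rw [e])) (Fin.init c) a b
  · refine Fin.lastCases ?_ (fun j => ?_) j
    · have e1 : BoolFun.ex (Fin.last n) (BoolFun.lift χ) = BoolFun.lift χ := by
        funext ξ; simp [BoolFun.lift, BoolFun.ex]
      have e2 : BoolFun.fa (Fin.last n) (BoolFun.lift χ) = BoolFun.lift χ := by
        funext ξ; simp [BoolFun.lift, BoolFun.fa]
      have e3 : ∀ b, BoolFun.res (Fin.last n) b (BoolFun.lift χ) = BoolFun.lift χ := fun b => by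
        funext ξ; simp [BoolFun.lift, BoolFun.res]
      simp only [e1, e2, e3]
      exact ⟨⟨χ, hχ, rfl⟩, ⟨χ, hχ, rfl⟩, fun _ => ⟨χ, hχ, rfl⟩⟩
    · exact ⟨⟨_, ((h χ hχ).2 j).1, lift_ex χ j⟩, ⟨_, ((h χ hχ).2 j).2.1, lift_fa χ j⟩,
        fun b => ⟨_, ((h χ hχ).2 j).2.2 b, lift_res χ j b⟩⟩

lemma HReg.of_lift {χ : (Fin n → Bool) → Bool} (h : HReg (BoolFun.lift χ)) : HReg χ := by
  obtain ⟨K, hK, h⟩ := h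
  refine ⟨{χ | BoolFun.lift χ ∈ K}, hK, fun χ hχ => ⟨fun i j hij c a b => ?_, fun j => ?_⟩⟩
  · have := (h _ hχ).1 i.castSucc j.castSucc (by simpa using hij) (Fin.snoc c false) a b
    simpa only [BoolFun.lift, init_update_castSucc, Fin.init_snoc] using this
  · simp only [Set.mem_ofPred_eq, lift_ex, lift_fa, lift_res]
    exact (h _ hχ).2 j.castSucc

lemma bool_pair_eq (η : Fin 2 → Bool) : η = ![η 0, η 1] := by
  funext i; fin_cases i <;> rfl

lemma isRegularSquare_iff (χ : (Fin 2 → Bool) → Bool) :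
    IsRegularSquare χ ↔ ∀ a b, χ ![a, b] = true → χ ![!a, !b] = true →
      χ ![a, !b] = true ∨ χ ![!a, b] = true := by
  have ne : ∀ a b a' b' : Bool, ![a, b] = ![a', b'] ↔ a = a' ∧ b = b' := by
    intro a b a' b'
    constructor
    · intro h; exact ⟨congrFun h 0, congrFun h 1⟩
    · rintro ⟨rfl, rfl⟩; rfl
  have ext2 : ∀ A B : Set (Fin 2 → Bool), A = B ↔ ∀ a b, ![a, b] ∈ A ↔ ![a, b] ∈ B := by
    intro A B
    constructor
    · rintro rfl a b; rfl
    · intro h; ext η; rw [bool_pair_eq η]; exact h _ _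
  unfold IsRegularSquare
  simp only [Ne, ext2, Set.mem_ofPred_eq, Set.mem_insert_iff, Set.mem_singleton_iff, ne,
    Bool.forall_bool, Bool.not_true, Bool.not_false]
  cases χ ![false, false] <;> cases χ ![false, true] <;> cases χ ![true, false] <;>
    cases χ ![true, true] <;> simp

lemma sqReg_iff (ψ : (Fin n → Bool) → Bool) :
    SqReg ψ ↔ ∀ i j, i < j → ∀ c, IsRegularSquare (restrictSquare ψ i j c) := by
  simp only [isRegularSquare_iff, restrictSquare, Matrix.cons_val_zero, Matrix.cons_val_one]
  constructor
  · exact fun h i j hij c => h i j hij.ne c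
  · intro h i j hij
    rcases lt_or_gt_of_ne hij with h' | h'
    · exact h i j h'
    · exact SqAt.symm hij.symm (h j i h')

lemma hReg_of_subsingleton {ι : Type*} [DecidableEq ι] [Subsingleton ι]
    (ψ : (ι → Bool) → Bool) : HReg ψ :=
  ⟨Set.univ, trivial, fun _ _ => ⟨fun i j hij => (hij (Subsingleton.elim i j)).elim,
    fun _ => ⟨trivial, trivial, fun _ => trivial⟩⟩⟩

/-- The recursive definition only quantifies over the last variable; `hReg_of_quantified`, applied
with k the last variable, recovers the operations in all the others. Functions of fewer variables
are compared through `lift`, which adds a dummy variable. -/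
theorem isRegular_iff_hReg : ∀ {n : ℕ} (ψ : (Fin n → Bool) → Bool), IsRegular ψ ↔ HReg ψ
  | 0, ψ => by simp [IsRegular, hReg_of_subsingleton]
  | 1, ψ => by simp [IsRegular, hReg_of_subsingleton]
  | 2, ψ => by
    have e : SqReg ψ ↔ IsRegularSquare ψ := by
      rw [sqReg_iff]
      have : ∀ c, restrictSquare ψ 0 1 c = ψ := by
        intro c; funext η
        simp only [restrictSquare]
        congr 1
        funext i; fin_cases i <;> simp
      constructor
      · intro h; rw [← this 0]; exact h 0 1 (by simp) _
      · intro h i j hij c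
        obtain ⟨rfl, rfl⟩ : i = 0 ∧ j = 1 := by omega
        rwa [this]
    rw [IsRegular, ← e]
    refine ⟨fun h => hReg_of_quantified (k := Fin.last 1) ?_ ?_ (fun i hi => h i _ hi),
      fun h => h.sqReg⟩
    · rw [← lift_existsLast]; exact (hReg_of_subsingleton _).lift
    · rw [← lift_forallLast]; exact (hReg_of_subsingleton _).lift
  | n + 3, ψ => by
    rw [IsRegular, ← sqReg_iff, isRegular_iff_hReg, isRegular_iff_hReg]
    constructor
    · rintro ⟨h1, h2, h3⟩
      refine hReg_of_quantified (k := Fin.last (n + 2)) ?_ ?_ (fun i hi => h1 i _ hi)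
      · rw [← lift_existsLast]; exact h2.lift
      · rw [← lift_forallLast]; exact h3.lift
    · refine fun h => ⟨h.sqReg, HReg.of_lift ?_, HReg.of_lift ?_⟩
      · rw [lift_existsLast]; exact h.ex _
      · rw [lift_forallLast]; exact h.fa _

end Regular

end BoolFun


namespace BoolFun

open Function

/-! ### Combinatorial local Euler characteristics -/

section Euler

variable {ι : Type*}

/-- The face `σ` of the cube, refined by the values of `τ` in its free directions. -/
def ov (σ τ : ι → SignType) : ι → SignType := fun i => if σ i = 0 then τ i else σ i

/-- The vertex `ξ` lies on the face of the cube described by the sign vector `σ`. -/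
def Compat (σ : ι → SignType) (ξ : ι → Bool) : Prop :=
  ∀ i, (σ i = 1 → ξ i = true) ∧ (σ i = -1 → ξ i = false)

/-- `ψ` takes the value `1` on the face `σ`. -/
def Occ (ψ : (ι → Bool) → Bool) (σ : ι → SignType) : Prop := ∃ ξ, Compat σ ξ ∧ ψ ξ = true

/-- `ψ` is identically `1` on the face `σ`. -/
def Full (ψ : (ι → Bool) → Bool) (σ : ι → SignType) : Prop := ∀ ξ, Compat σ ξ → ψ ξ = true

/-- The sign of a vertex coordinate. -/
def bsgn (b : Bool) : SignType := if b then 1 else -1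

lemma bsgn_ne_zero (b : Bool) : bsgn b ≠ 0 := by cases b <;> decide

/-- The Euler characteristic of a point, or of an open half-line. -/
def cw (s : SignType) : ℤ := if s = 0 then 1 else -1

open Classical in
/-- The indicator of a proposition. -/
noncomputable def ind (P : Prop) : ℤ := if P then 1 else 0

lemma ind_true {P : Prop} (h : P) : ind P = 1 := by simp [ind, h]

lemma ind_false {P : Prop} (h : ¬P) : ind P = 0 := by simp [ind, h]

lemma ind_not (P : Prop) : ind (¬P) = 1 - ind P := by
  by_cases h : P <;> simp [ind, h]

lemma ov_assoc (ρ σ τ : ι → SignType) : ov (ov ρ σ) τ = ov ρ (ov σ τ) := by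
  funext i; unfold ov; by_cases h : ρ i = 0 <;> simp [h]

lemma ov_zero (ρ : ι → SignType) : ov ρ 0 = ρ := by
  funext i; unfold ov; by_cases h : ρ i = 0 <;> simp [h]

lemma Compat.of_ov {σ τ : ι → SignType} {ξ : ι → Bool} (h : Compat (ov σ τ) ξ) : Compat σ ξ := by
  intro i
  have := h i
  unfold ov at this
  by_cases h0 : σ i = 0
  · simp [h0]
  · simpa [h0] using this

lemma exists_compat (σ : ι → SignType) : ∃ ξ, Compat σ ξ :=
  ⟨fun i => decide (σ i = 1), fun i => ⟨fun h => by simp [h], fun h => by simp [h]⟩⟩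

lemma occ_neg (ψ : (ι → Bool) → Bool) (σ : ι → SignType) : Occ (neg ψ) σ ↔ ¬Full ψ σ := by
  simp [Occ, Full, neg]

variable [DecidableEq ι]

lemma ov_update_left {s : SignType} (hs : s ≠ 0) (σ τ : ι → SignType) (j : ι) :
    ov (update σ j s) τ = update (ov σ τ) j s := by
  funext i
  by_cases h : i = j
  · subst h; simp [ov, hs]
  · simp [ov, h]

lemma ov_update_right {σ : ι → SignType} {j : ι} (hσ : σ j = 0) (τ : ι → SignType) (s : SignType) :
    ov σ (update τ j s) = update (ov σ τ) j s := by
  funext i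
  by_cases h : i = j
  · subst h; simp [ov, hσ]
  · simp [ov, h]

lemma compat_update_zero {σ : ι → SignType} {j : ι} {ξ : ι → Bool} :
    Compat (update σ j 0) ξ ↔ ∃ b, Compat σ (update ξ j b) := by
  constructor
  · intro h
    refine ⟨decide (σ j = 1), fun i => ?_⟩
    by_cases hi : i = j
    · subst hi; simp +contextual
    · simpa [hi] using h i
  · rintro ⟨b, h⟩ i
    by_cases hi : i = j
    · subst hi; simp
    · simpa [hi] using h i

lemma compat_update_bsgn {σ : ι → SignType} {j : ι} {b : Bool} {ξ : ι → Bool} :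
    Compat (update σ j (bsgn b)) ξ ↔ ξ j = b ∧ Compat (update σ j 0) ξ := by
  constructor
  · intro h
    refine ⟨?_, fun i => ?_⟩
    · have := h j
      cases b <;> simp_all [bsgn]
    · by_cases hi : i = j
      · subst hi; simp
      · simpa [hi] using h i
  · rintro ⟨hb, h⟩ i
    by_cases hi : i = j
    · subst hi; subst hb
      cases h' : ξ i <;> simp [bsgn]
    · simpa [hi] using h i

lemma compat_update_update {σ : ι → SignType} {j : ι} {b : Bool} {ξ : ι → Bool} :
    Compat (update σ j (bsgn b)) (update ξ j b) ↔ Compat (update σ j 0) ξ := by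
  rw [compat_update_bsgn]
  simp only [update_self, true_and]
  constructor <;> intro h i
  · by_cases hi : i = j
    · subst hi; simp
    · simpa [hi] using h i
  · by_cases hi : i = j
    · subst hi; simp
    · simpa [hi] using h i

lemma occ_ex (j : ι) (ψ : (ι → Bool) → Bool) (σ : ι → SignType) :
    Occ (ex j ψ) σ ↔ Occ ψ (update σ j 0) := by
  constructor
  · rintro ⟨ξ, h1, h2⟩
    have key : ∀ b, Compat (update σ j 0) (update ξ j b) := fun b => by
      rw [compat_update_zero]
      exact ⟨ξ j, by simpa using h1⟩
    rw [ex, Bool.or_eq_true] at h2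
    exact h2.elim (fun h => ⟨_, key _, h⟩) (fun h => ⟨_, key _, h⟩)
  · rintro ⟨ξ, h1, h2⟩
    obtain ⟨b, hb⟩ := compat_update_zero.1 h1
    refine ⟨_, hb, ?_⟩
    rw [← update_eq_self j ξ] at h2
    simp only [ex, update_idem, Bool.or_eq_true]
    cases h : ξ j <;> simp_all

lemma occ_res (j : ι) (b : Bool) (ψ : (ι → Bool) → Bool) {σ : ι → SignType} :
    Occ (res j b ψ) σ → Occ ψ (update σ j (bsgn b)) := by
  rintro ⟨ξ, h1, h2⟩
  refine ⟨update ξ j b, compat_update_update.2 (compat_update_zero.2 ⟨ξ j, by simpa using h1⟩), h2⟩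

lemma occ_res_iff (j : ι) (b : Bool) (ψ : (ι → Bool) → Bool) (σ : ι → SignType) :
    Occ (res j b ψ) σ ↔ Occ ψ (update σ j (bsgn b)) := by
  refine ⟨occ_res j b ψ, ?_⟩
  rintro ⟨ξ, h1, h2⟩
  rw [compat_update_bsgn] at h1
  obtain ⟨b', hb'⟩ := compat_update_zero.1 h1.2
  refine ⟨_, hb', ?_⟩
  rw [res, update_idem, ← h1.1, update_eq_self]
  exact h2

lemma full_res_iff (j : ι) (b : Bool) (ψ : (ι → Bool) → Bool) (σ : ι → SignType) :
    Full (res j b ψ) σ ↔ Full ψ (update σ j (bsgn b)) := by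
  rw [← not_iff_not, ← occ_neg, ← occ_neg, neg_res, occ_res_iff]

lemma full_update_zero_iff (j : ι) (ψ : (ι → Bool) → Bool) (σ : ι → SignType) :
    Full ψ (update σ j 0) ↔ Full ψ (update σ j 1) ∧ Full ψ (update σ j (-1)) := by
  change Full ψ (update σ j 0) ↔ Full ψ (update σ j (bsgn true)) ∧ Full ψ (update σ j (bsgn false))
  simp only [Full, compat_update_bsgn]
  constructor
  · exact fun h => ⟨fun ξ hξ => h ξ hξ.2, fun ξ hξ => h ξ hξ.2⟩
  · rintro ⟨h1, h2⟩ ξ hξ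
    cases h : ξ j
    · exact h2 ξ ⟨h, hξ⟩
    · exact h1 ξ ⟨h, hξ⟩

lemma full_ex_of_full {j : ι} {b : Bool} {ψ : (ι → Bool) → Bool} {σ : ι → SignType}
    (h : Full ψ (update σ j (bsgn b))) : Full (ex j ψ) σ := by
  intro ξ hξ
  have := h (update ξ j b) (compat_update_update.2 (compat_update_zero.2 ⟨ξ j, by simpa using hξ⟩))
  rw [ex, Bool.or_eq_true]
  cases b <;> simp [this]

variable [Fintype ι]

/-- The Euler characteristic (with compact support) of the open cell with sign vector `τ`. -/
def wt (τ : ι → SignType) : ℤ := ∏ i, cw (τ i)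

/-- The local Euler characteristic of `cubeUnion ψ` at the points with sign vector `σ`. -/
noncomputable def eul (ψ : (ι → Bool) → Bool) (σ : ι → SignType) : ℤ :=
  ∑ τ : ι → SignType, wt τ * ind (Occ ψ (ov σ τ))

/-- All local Euler characteristics are those of a ball. -/
def EReg (ψ : (ι → Bool) → Bool) : Prop :=
  ∀ σ, eul ψ σ = (-1) ^ Fintype.card ι * ind (Full ψ σ)

lemma sum_signType (f : SignType → ℤ) : ∑ s, f s = f 0 + f 1 + f (-1) := by
  have : (Finset.univ : Finset SignType) = {0, 1, -1} := by decide
  rw [this, Finset.sum_insert (by decide), Finset.sum_insert (by decide), Finset.sum_singleton]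
  ring

lemma sum_wt : ∑ τ : ι → SignType, wt τ = (-1) ^ Fintype.card ι := by
  have := Finset.prod_univ_sum (fun _ : ι => (Finset.univ : Finset SignType)) (fun _ => cw)
  rw [Fintype.piFinset_univ] at this
  simp only [wt, ← this, sum_signType]
  simp [cw]

lemma wt_update {τ : ι → SignType} {j : ι} (h : τ j = 0) (s : SignType) :
    wt (update τ j s) = cw s * wt τ := by
  unfold wt
  rw [← Finset.mul_prod_erase _ _ (Finset.mem_univ j),
    ← Finset.mul_prod_erase _ (fun i => cw (τ i)) (Finset.mem_univ j)]
  have : ∏ x ∈ Finset.univ.erase j, cw (update τ j s x) = ∏ x ∈ Finset.univ.erase j, cw (τ x) :=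
    Finset.prod_congr rfl fun x hx => by rw [update_of_ne (Finset.ne_of_mem_erase hx)]
  rw [this, update_self, h]
  simp [cw]

lemma sum_split (j : ι) (G : (ι → SignType) → ℤ) :
    ∑ τ, G τ = ∑ τ ∈ Finset.univ.filter (fun τ : ι → SignType => τ j = 0),
      (G τ + G (update τ j 1) + G (update τ j (-1))) := by
  rw [← Finset.sum_fiberwise Finset.univ (fun τ : ι → SignType => τ j) G, sum_signType]
  rw [Finset.sum_add_distrib, Finset.sum_add_distrib]
  have key : ∀ s : SignType, ∑ τ ∈ Finset.univ.filter (fun τ : ι → SignType => τ j = s), G τ =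
      ∑ τ ∈ Finset.univ.filter (fun τ : ι → SignType => τ j = 0), G (update τ j s) := by
    intro s
    refine Finset.sum_bij' (fun τ _ => update τ j 0) (fun τ _ => update τ j s) ?_ ?_ ?_ ?_ ?_
    · simp
    · simp
    · intro τ hτ
      simp only [Finset.mem_filter, Finset.mem_univ, true_and] at hτ
      simp [← hτ]
    · intro τ hτ
      simp only [Finset.mem_filter, Finset.mem_univ, true_and] at hτ
      simp [← hτ]
    · intro τ hτ
      simp only [Finset.mem_filter, Finset.mem_univ, true_and] at hτ
      simp [← hτ]
  rw [key 1, key (-1)]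

/-- Inclusion-exclusion in the direction j. Directions are grouped by their other coordinates; each
group consists of a point and two half-lines, with relative weights 1, -1, -1. -/
lemma eul_ex (j : ι) (ψ : (ι → Bool) → Bool) (σ : ι → SignType) :
    eul (ex j ψ) σ = eul ψ (update σ j 1) + eul ψ (update σ j (-1)) - eul ψ (update σ j 0) := by
  -- S records occurrences on faces with the coordinate j left free, and `P s` those with this
  -- coordinate fixed to the sign s. All four Euler characteristics are combinations of these sums.
  let S : ℤ := ∑ τ ∈ Finset.univ.filter (fun τ : ι → SignType => τ j = 0),
    wt τ * ind (Occ ψ (update (ov σ τ) j 0))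
  let P : SignType → ℤ := fun s => ∑ τ ∈ Finset.univ.filter (fun τ : ι → SignType => τ j = 0),
    wt τ * ind (Occ ψ (update (ov σ τ) j s))
  have h0 : eul ψ (update σ j 0) = S - P 1 - P (-1) := by
    simp only [eul, S, P, ← Finset.sum_sub_distrib]
    rw [sum_split j]
    refine Finset.sum_congr rfl fun τ hτ => ?_
    simp only [Finset.mem_filter, Finset.mem_univ, true_and] at hτ
    have e : ∀ s, ov (update σ j 0) (update τ j s) = update (ov σ τ) j s := by
      intro s
      rw [ov_update_right (update_self j 0 σ)]
      funext i
      by_cases h : i = j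
      · subst h; simp
      · simp [ov, h]
    have e0 := e 0
    rw [← hτ, update_eq_self, hτ] at e0
    rw [e, e, e0, wt_update hτ, wt_update hτ]
    simp only [cw, one_ne_zero, if_false]
    simp
    ring
  have hs : ∀ s, s ≠ 0 → eul ψ (update σ j s) = - P s := by
    intro s hs
    simp only [eul, P]
    rw [sum_split j, ← Finset.sum_neg_distrib]
    refine Finset.sum_congr rfl fun τ hτ => ?_
    simp only [Finset.mem_filter, Finset.mem_univ, true_and] at hτ
    have e : ∀ t, ov (update σ j s) (update τ j t) = update (ov σ τ) j s := by
      intro t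
      rw [ov_update_left hs]
      funext i
      by_cases h : i = j
      · subst h; simp
      · simp [ov, h]
    rw [e, e, ov_update_left hs, wt_update hτ, wt_update hτ]
    simp [cw]
  have he : eul (ex j ψ) σ = - S := by
    simp only [eul, S, occ_ex]
    rw [sum_split j, ← Finset.sum_neg_distrib]
    refine Finset.sum_congr rfl fun τ hτ => ?_
    simp only [Finset.mem_filter, Finset.mem_univ, true_and] at hτ
    have e : ∀ t, update (ov σ (update τ j t)) j 0 = update (ov σ τ) j 0 := by
      intro t
      funext i
      by_cases h : i = j
      · subst h; simp
      · simp [ov, h]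
    rw [e, e, wt_update hτ, wt_update hτ]
    simp [cw]
  rw [h0, hs 1 (by decide), hs (-1) (by decide), he]
  ring

lemma eul_of_full {ψ : (ι → Bool) → Bool} {σ : ι → SignType} (h : Full ψ σ) :
    eul ψ σ = (-1) ^ Fintype.card ι := by
  rw [← sum_wt, eul]
  refine Finset.sum_congr rfl fun τ _ => ?_
  rw [ind_true, mul_one]
  obtain ⟨ξ, hξ⟩ := exists_compat (ov σ τ)
  exact ⟨ξ, hξ, h ξ hξ.of_ov⟩

/-- The identity factors over the coordinates. In one coordinate, a nonzero sign s arises from (0,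
s) with weight -1 and from (s, u) with total weight 1, which cancel; zero arises only from (0, 0).
This inversion formula makes the Euler condition invariant under negation. -/
lemma sum_sum_wt_ov (G : (ι → SignType) → ℤ) :
    ∑ τ : ι → SignType, ∑ υ : ι → SignType, wt τ * (wt υ * G (ov τ υ)) = G 0 := by
  -- G is expanded in delta functions, each a product over coordinates, so that the double sum
  -- becomes a product of sums over pairs of signs.
  have e1 : ∀ τ υ : ι → SignType, wt τ * (wt υ * G (ov τ υ)) =
      ∑ ω : ι → SignType, G ω * ∏ i, (cw (τ i) * cw (υ i) *
        if (if τ i = 0 then υ i else τ i) = ω i then 1 else 0) := by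
    intro τ υ
    rw [Finset.sum_eq_single (ov τ υ)]
    · simp only [ov, if_true, mul_one, Finset.prod_mul_distrib, wt]
      ring
    · intro ω _ hω
      obtain ⟨i, hi⟩ : ∃ i, ov τ υ i ≠ ω i := by
        by_contra hc
        push Not at hc
        exact hω (funext hc).symm
      rw [Finset.prod_eq_zero (Finset.mem_univ i), mul_zero]
      rw [if_neg (by exact hi), mul_zero]
    · simp
  simp only [e1]
  have e2 : ∀ ω : ι → SignType, ∑ τ : ι → SignType, ∑ υ : ι → SignType,
      G ω * ∏ i, (cw (τ i) * cw (υ i) * if (if τ i = 0 then υ i else τ i) = ω i then 1 else 0) =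
      G ω * ∏ i, if ω i = 0 then 1 else 0 := by
    intro ω
    simp only [← Finset.mul_sum]
    congr 1
    have h1 : ∀ τ : ι → SignType, ∑ υ : ι → SignType, ∏ i, (cw (τ i) * cw (υ i) *
        if (if τ i = 0 then υ i else τ i) = ω i then 1 else 0) = ∏ i, ∑ u, (cw (τ i) * cw u *
        if (if τ i = 0 then u else τ i) = ω i then 1 else 0) := by
      intro τ
      rw [Finset.prod_univ_sum, Fintype.piFinset_univ]
    simp only [h1]
    have h2 := Finset.prod_univ_sum (fun _ : ι => (Finset.univ : Finset SignType))
      (fun i t => ∑ u, (cw t * cw u * if (if t = 0 then u else t) = ω i then (1 : ℤ) else 0))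
    rw [Fintype.piFinset_univ] at h2
    rw [← h2]
    refine Finset.prod_congr rfl fun i _ => ?_
    simp only [sum_signType]
    generalize ω i = s
    revert s
    decide
  calc _ = ∑ ω : ι → SignType, ∑ τ : ι → SignType, ∑ υ : ι → SignType,
      G ω * ∏ i, (cw (τ i) * cw (υ i) *
        if (if τ i = 0 then υ i else τ i) = ω i then 1 else 0) := by
        refine Eq.trans (Finset.sum_congr rfl fun τ _ => Finset.sum_comm) Finset.sum_comm
    _ = _ := by
        simp only [e2]
        rw [Finset.sum_eq_single 0]
        · simp
        · intro ω _ hω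
          obtain ⟨i, hi⟩ : ∃ i, ω i ≠ 0 := by
            by_contra hc
            push Not at hc
            exact hω (funext hc)
          rw [Finset.prod_eq_zero (Finset.mem_univ i), mul_zero]
          rw [if_neg hi]
        · simp

/-- Where `ex j ψ` is not identically 1, none of the three faces occurring in `eul_ex` is full, so
all three terms vanish. -/
lemma EReg.ex {ψ : (ι → Bool) → Bool} (h : EReg ψ) (j : ι) : EReg (ex j ψ) := by
  intro σ
  by_cases hf : Full (BoolFun.ex j ψ) σ
  · rw [eul_of_full hf, ind_true hf, mul_one]
  · have h1 : ¬Full ψ (update σ j 1) := fun h' => hf (full_ex_of_full (b := true) h')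
    have h2 : ¬Full ψ (update σ j (-1)) := fun h' => hf (full_ex_of_full (b := false) h')
    have h3 : ¬Full ψ (update σ j 0) := fun h' => h1 ((full_update_zero_iff j ψ σ).1 h').1
    rw [eul_ex, h, h, h, ind_false h1, ind_false h2, ind_false h3, ind_false hf]
    ring

/-- The hypothesis expresses fullness as a weighted sum of occurrences. Inserted into the Euler
characteristic of the negation, it gives the double sum evaluated by `sum_sum_wt_ov`. -/
lemma EReg.neg {ψ : (ι → Bool) → Bool} (h : EReg ψ) : EReg (neg ψ) := by
  intro ρ
  have hs : ((-1 : ℤ) ^ Fintype.card ι) * (-1) ^ Fintype.card ι = 1 := by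
    rw [← mul_pow]; simp
  have e1 : ∀ σ, ind (Full ψ σ) = (-1) ^ Fintype.card ι * eul ψ σ := by
    intro σ
    rw [h, ← mul_assoc, hs, one_mul]
  have e2 : eul (BoolFun.neg ψ) ρ = ∑ τ : ι → SignType, wt τ - (-1) ^ Fintype.card ι *
      ∑ τ : ι → SignType, ∑ υ : ι → SignType, wt τ * (wt υ * ind (Occ ψ (ov ρ (ov τ υ)))) := by
    rw [Finset.mul_sum, ← Finset.sum_sub_distrib]
    refine Finset.sum_congr rfl fun τ _ => ?_
    rw [occ_neg, ind_not, e1, eul, ← Finset.mul_sum]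
    simp only [ov_assoc]
    ring
  rw [e2, sum_sum_wt_ov (fun ω => ind (Occ ψ (ov ρ ω))), ov_zero, sum_wt]
  have : Full (BoolFun.neg ψ) ρ ↔ ¬ Occ ψ ρ := by
    rw [← neg_neg' ψ, occ_neg, neg_neg', not_not]
  rw [this, ind_not]
  ring

lemma EReg.fa {ψ : (ι → Bool) → Bool} (h : EReg ψ) (j : ι) : EReg (fa j ψ) := by
  have := (h.neg.ex j).neg
  rwa [neg_ex, neg_neg'] at this

lemma EReg.res {ψ : (ι → Bool) → Bool} (h : EReg ψ) (j : ι) (b : Bool) : EReg (res j b ψ) := by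
  intro σ
  rw [full_res_iff, ← h]
  unfold eul
  refine Finset.sum_congr rfl fun τ _ => ?_
  rw [occ_res_iff, ov_update_left (bsgn_ne_zero b)]

/-- On a square with a diagonal pair, quantification over j gives a full face although neither edge
of fixed j is full. Then `eul_ex` would equate (-1)^n with 0. -/
lemma EReg.sqReg {ψ : (ι → Bool) → Bool} (h : EReg ψ) : SqReg ψ := by
  intro i j hij c a b h1 h2
  by_contra hc
  push Not at hc
  obtain ⟨h3, h4⟩ := hc
  let σ : ι → SignType := fun l => if l = i ∨ l = j then 0 else bsgn (c l)
  have hσ : ∀ ξ, Compat σ ξ ↔ ∃ x y, ξ = update (update c i x) j y := by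
    intro ξ
    constructor
    · intro hξ
      refine ⟨ξ i, ξ j, funext fun l => ?_⟩
      by_cases hl : l = j
      · subst hl; simp
      by_cases hl' : l = i
      · subst hl'; simp [hl]
      · have := hξ l
        simp only [σ, hl, hl', or_self, if_false] at this
        simp only [update_of_ne hl, update_of_ne hl']
        cases hcl : c l <;> simp_all [bsgn]
    · rintro ⟨x, y, rfl⟩ l
      by_cases hl : l = j
      · subst hl; simp [σ]
      by_cases hl' : l = i
      · subst hl'; simp [σ]
      · simp only [σ, hl, hl', or_self, if_false, update_of_ne hl, update_of_ne hl']
        cases hcl : c l <;> simp [bsgn]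
  have hσj : ∀ b, ∀ x, Compat (update σ j (bsgn b)) (update (update c i x) j b) := by
    intro b x
    rw [compat_update_update, compat_update_zero]
    refine ⟨b, ?_⟩
    rw [hσ]
    exact ⟨x, b, rfl⟩
  have hf : Full (BoolFun.ex j ψ) σ := by
    intro ξ hξ
    obtain ⟨x, y, rfl⟩ := (hσ ξ).1 hξ
    simp only [BoolFun.ex, update_idem, Bool.or_eq_true]
    cases a <;> cases b <;> cases x <;> simp_all
  have hn : ∀ b', ¬Full ψ (update σ j (bsgn b')) := by
    intro b' hf
    have := fun x => hf _ (hσj b' x)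
    by_cases hb : b' = b
    · subst hb; exact h4 (this _)
    · have hb : b' = !b := by cases b <;> cases b' <;> simp_all
      subst hb; exact h3 (this _)
  have h0 : ¬Full ψ (update σ j 0) := fun h' => hn true ((full_update_zero_iff j ψ σ).1 h').1
  have key := eul_ex j ψ σ
  have hn1 : ¬Full ψ (update σ j 1) := hn true
  have hn2 : ¬Full ψ (update σ j (-1)) := hn false
  rw [h.ex j, h, h, h, ind_true hf, ind_false h0, ind_false hn1, ind_false hn2] at key
  simp at key

lemma EReg.hReg {ψ : (ι → Bool) → Bool} (h : EReg ψ) : HReg ψ :=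
  ⟨{χ | EReg χ}, h, fun _ hχ => ⟨hχ.sqReg, fun j => ⟨hχ.ex j, hχ.fa j, hχ.res j⟩⟩⟩

end Euler

end BoolFun


open Filter Topology

/-! ### The Euler characteristic as a valuation on polyhedral cells -/

section Valuation

variable {E F : Type*} [AddCommGroup E] [Module ℝ E] [AddCommGroup F] [Module ℝ F]

/-- Convex sets in which every segment can be prolonged. -/
def RelOpenConvex (P : Set E) : Prop :=
  Convex ℝ P ∧ ∀ x ∈ P, ∀ y ∈ P, ∃ ε : ℝ, 0 < ε ∧ x + ε • (x - y) ∈ P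

open Classical in
/-- The Euler characteristic with compact support of a relatively open convex set. -/
noncomputable def ev (P : Set E) : ℤ :=
  if P.Nonempty then (-1) ^ Module.finrank ℝ (vectorSpan ℝ P) else 0

lemma ev_empty : ev (∅ : Set E) = 0 := by simp [ev]

lemma Convex.add_smul_sub_mem_of_le {P : Set E} (hP : Convex ℝ P) {x v : E} (hx : x ∈ P) {ε t : ℝ}
    (hε : 0 < ε) (h : x + ε • v ∈ P) (ht : 0 ≤ t) (hte : t ≤ ε) : x + t • v ∈ P := by
  have := hP.add_smul_mem hx h (t := t / ε) ⟨by positivity, by rw [div_le_one hε]; exact hte⟩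
  rwa [smul_smul, div_mul_cancel₀ _ hε.ne'] at this

lemma RelOpenConvex.inter {P Q : Set E} (hP : RelOpenConvex P) (hQ : RelOpenConvex Q) :
    RelOpenConvex (P ∩ Q) := by
  refine ⟨hP.1.inter hQ.1, fun x hx y hy => ?_⟩
  obtain ⟨ε, h1, h2⟩ := hP.2 x hx.1 y hy.1
  obtain ⟨δ, h3, h4⟩ := hQ.2 x hx.2 y hy.2
  have h5 : 0 < min ε δ := lt_min h1 h3
  exact ⟨min ε δ, h5, hP.1.add_smul_sub_mem_of_le hx.1 h1 h2 h5.le (min_le_left _ _),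
    hQ.1.add_smul_sub_mem_of_le hx.2 h3 h4 h5.le (min_le_right _ _)⟩

lemma RelOpenConvex.univ : RelOpenConvex (Set.univ : Set E) :=
  ⟨convex_univ, fun _ _ _ _ => ⟨1, one_pos, trivial⟩⟩

lemma relOpenConvex_sign (l : E →ₗ[ℝ] ℝ) (s : SignType) :
    RelOpenConvex {x | SignType.sign (l x) = s} := by
  rcases s.trichotomy with rfl | rfl | rfl
  · simp only [sign_eq_neg_one_iff]
    refine ⟨(convex_Iio 0).linear_preimage l, fun x hx y hy => ⟨l x / l y, ?_, ?_⟩⟩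
    · exact div_pos_of_neg_of_neg hx hy
    · have hx' : l x < 0 := hx
      have hy' : l y < 0 := hy
      have : 0 < l x / l y := div_pos_of_neg_of_neg hx hy
      simp only [Set.mem_ofPred_eq, map_add, map_smul, map_sub, smul_eq_mul, mul_sub,
        div_mul_cancel₀ _ hy'.ne]
      nlinarith
  · simp only [sign_eq_zero_iff]
    refine ⟨(convex_singleton (0 : ℝ)).linear_preimage l, fun x hx y hy => ⟨1, one_pos, ?_⟩⟩
    simp_all
  · simp only [sign_eq_one_iff]
    refine ⟨(convex_Ioi 0).linear_preimage l, fun x hx y hy => ⟨l x / l y, ?_, ?_⟩⟩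
    · exact div_pos hx hy
    · have hx' : 0 < l x := hx
      have hy' : 0 < l y := hy
      have : 0 < l x / l y := div_pos hx hy
      simp only [Set.mem_ofPred_eq, map_add, map_smul, map_sub, smul_eq_mul, mul_sub,
        div_mul_cancel₀ _ hy'.ne']
      nlinarith

/-- Prolonging segments makes negatives of admissible directions admissible, and convexity takes
care of sums. Thus directions may be tested in the linear span, and dimensions of slices become
dimensions of subspaces. -/
lemma RelOpenConvex.exists_add_smul_mem {P : Set E} (hP : RelOpenConvex P) {x w : E} (hx : x ∈ P)
    (hw : w ∈ vectorSpan ℝ P) : ∃ ε : ℝ, 0 < ε ∧ x + ε • w ∈ P := by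
  rw [vectorSpan_eq_span_vsub_set_right ℝ hx] at hw
  induction hw using Submodule.span_induction with
  | mem w hw =>
    obtain ⟨y, hy, rfl⟩ := hw
    exact ⟨1, one_pos, by simpa using hy⟩
  | zero => exact ⟨1, one_pos, by simpa using hx⟩
  | add v w _ _ hv hw =>
    obtain ⟨ε, h1, h2⟩ := hv
    obtain ⟨δ, h3, h4⟩ := hw
    have h5 : 0 < min ε δ := lt_min h1 h3
    have h6 := hP.1.add_smul_sub_mem_of_le hx h1 h2 h5.le (min_le_left _ _)
    have h7 := hP.1.add_smul_sub_mem_of_le hx h3 h4 h5.le (min_le_right _ _)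
    refine ⟨min ε δ / 2, by positivity, ?_⟩
    have := convex_iff_forall_pos.1 hP.1 h6 h7 (show (0 : ℝ) < 1 / 2 by norm_num)
      (show (0 : ℝ) < 1 / 2 by norm_num) (by norm_num)
    convert this using 1
    module
  | smul c w _ hw =>
    obtain ⟨ε, h1, h2⟩ := hw
    rcases lt_trichotomy c 0 with hc | rfl | hc
    · obtain ⟨δ, h3, h4⟩ := hP.2 x hx _ h2
      refine ⟨δ * ε / (-c), div_pos (by positivity) (by linarith), ?_⟩
      convert h4 using 2
      rw [smul_smul, div_mul_eq_mul_div, mul_div_assoc, div_neg, div_self hc.ne]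
      module
    · exact ⟨1, one_pos, by simpa using hx⟩
    · refine ⟨ε / c, by positivity, ?_⟩
      rwa [smul_smul, div_mul_cancel₀ _ hc.ne']

lemma vectorSpan_eq_of_absorbing {P Q : Set E} (hQP : Q ⊆ P) {x : E} (hx : x ∈ Q)
    (h : ∀ y ∈ P, ∃ ε : ℝ, 0 < ε ∧ x + ε • (y - x) ∈ Q) : vectorSpan ℝ Q = vectorSpan ℝ P := by
  refine le_antisymm (vectorSpan_mono ℝ hQP) ?_
  rw [vectorSpan_eq_span_vsub_set_right ℝ (hQP hx), Submodule.span_le]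
  rintro _ ⟨y, hy, rfl⟩
  obtain ⟨ε, h1, h2⟩ := h y hy
  have := vsub_mem_vectorSpan ℝ h2 hx
  simp only [vsub_eq_sub, add_sub_cancel_left] at this
  exact (Submodule.smul_mem_iff _ h1.ne').1 this

lemma vectorSpan_inter_sign {P : Set E} (hP : RelOpenConvex P) (l : E →ₗ[ℝ] ℝ) {s : SignType}
    (hs : s ≠ 0) (hne : (P ∩ {x | SignType.sign (l x) = s}).Nonempty) :
    vectorSpan ℝ (P ∩ {x | SignType.sign (l x) = s}) = vectorSpan ℝ P := by
  obtain ⟨x, hx, hxs⟩ := hne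
  refine vectorSpan_eq_of_absorbing Set.inter_subset_left ⟨hx, hxs⟩ fun y hy => ?_
  have hd : 0 < 2 * (|l x| + |l y|) + 1 := by positivity
  have hlx : 0 < |l x| := abs_pos.2 fun h => hs (by rw [← hxs, h, sign_zero])
  -- The denominator makes the change of l along the step smaller than |l x|, so the sign is kept;
  -- it also makes ε less than 1.
  set ε : ℝ := |l x| / (2 * (|l x| + |l y|) + 1) with hε
  have hε0 : 0 < ε := by positivity
  have hε1 : ε * (2 * (|l x| + |l y|) + 1) = |l x| := div_mul_cancel₀ _ hd.ne'
  have hε2 : ε < 1 := by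
    rw [hε, div_lt_one hd]
    have := abs_nonneg (l y)
    linarith
  refine ⟨ε, hε0, hP.1.add_smul_sub_mem hx hy ⟨hε0.le, hε2.le⟩, ?_⟩
  have hv : l (x + ε • (y - x)) = l x + ε * (l y - l x) := by simp
  have hb : |ε * (l y - l x)| < |l x| := by
    rw [abs_mul, abs_of_pos hε0]
    have := abs_sub (l y) (l x)
    nlinarith [abs_nonneg (l y)]
  rw [Set.mem_ofPred_eq, hv, ← hxs]
  rw [Set.mem_ofPred_eq] at hxs
  rcases lt_trichotomy (l x) 0 with h | h | h
  · rw [sign_neg h, sign_neg]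
    rw [abs_of_neg h] at hb
    linarith [(abs_lt.1 hb).2]
  · simp [h] at hlx
  · rw [sign_pos h, sign_pos]
    rw [abs_of_pos h] at hb
    linarith [(abs_lt.1 hb).1]

lemma vectorSpan_inter_sign_zero {P : Set E} (hP : RelOpenConvex P) (l : E →ₗ[ℝ] ℝ)
    (hne : (P ∩ {x | SignType.sign (l x) = 0}).Nonempty) :
    vectorSpan ℝ (P ∩ {x | SignType.sign (l x) = 0}) = vectorSpan ℝ P ⊓ LinearMap.ker l := by
  obtain ⟨x, hx, hxs⟩ := hne
  simp only [sign_eq_zero_iff, Set.mem_ofPred_eq] at hxs ⊢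
  have hx0 : x ∈ P ∩ {x | l x = 0} := ⟨hx, hxs⟩
  refine le_antisymm (le_inf (vectorSpan_mono ℝ Set.inter_subset_left) ?_) ?_
  · rw [vectorSpan_eq_span_vsub_set_right ℝ hx0, Submodule.span_le]
    rintro _ ⟨y, hy, rfl⟩
    have hy2 : l y = 0 := hy.2
    simp [hy2, hxs]
  · rintro w ⟨h1, h2⟩
    obtain ⟨ε, h3, h4⟩ := hP.exists_add_smul_mem hx h1
    have h5 : x + ε • w ∈ P ∩ {x | l x = 0} := ⟨h4, by simp_all⟩
    have := vsub_mem_vectorSpan ℝ h5 hx0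
    simp only [vsub_eq_sub, add_sub_cancel_left] at this
    exact (Submodule.smul_mem_iff _ h3.ne').1 this

lemma finrank_inf_ker_add_one [FiniteDimensional ℝ E] (V : Submodule ℝ E) (l : E →ₗ[ℝ] ℝ)
    (h : ∃ w ∈ V, l w ≠ 0) :
    Module.finrank ℝ (V ⊓ LinearMap.ker l : Submodule ℝ E) + 1 = Module.finrank ℝ V := by
  obtain ⟨w, hw, hlw⟩ := h
  have h1 := (l.domRestrict V).finrank_range_add_finrank_ker
  have h2 : LinearMap.range (l.domRestrict V) = ⊤ :=
    LinearMap.range_eq_top.2 (LinearMap.surjective fun h => hlw (by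
      simpa using LinearMap.congr_fun h ⟨w, hw⟩))
  have h3 : Submodule.map V.subtype (LinearMap.ker (l.domRestrict V)) = V ⊓ LinearMap.ker l := by
    ext x
    simp only [Submodule.mem_map, LinearMap.mem_ker, LinearMap.domRestrict_apply,
      Submodule.subtype_apply, Submodule.mem_inf]
    constructor
    · rintro ⟨y, hy, rfl⟩; exact ⟨y.2, hy⟩
    · rintro ⟨h1, h2⟩; exact ⟨⟨x, h1⟩, h2, rfl⟩
  have h4 : Module.finrank ℝ (Submodule.map V.subtype (LinearMap.ker (l.domRestrict V))) =
      Module.finrank ℝ (LinearMap.ker (l.domRestrict V)) :=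
    Submodule.finrank_map_subtype_eq V _
  rw [h3] at h4
  rw [h2, finrank_top, Module.finrank_self] at h1
  rw [h4, ← h1, add_comm]

/-- A hyperplane that properly cuts a relatively open convex set of dimension d leaves two pieces of
dimension d and one of dimension d - 1, and twice (-1)^d plus (-1)^(d-1) is (-1)^d. Otherwise one
sign occurs throughout and there is nothing to cut. -/
lemma ev_split [FiniteDimensional ℝ E] {P : Set E} (hP : RelOpenConvex P) (l : E →ₗ[ℝ] ℝ) :
    ∑ s, ev (P ∩ {x | SignType.sign (l x) = s}) = ev P := by
  by_cases hc : ∃ s, ∀ x ∈ P, SignType.sign (l x) = s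
  · obtain ⟨s, hs⟩ := hc
    rw [Finset.sum_eq_single s]
    · congr 1
      exact Set.inter_eq_left.2 hs
    · intro t _ ht
      rw [← ev_empty (E := E)]
      congr 1
      ext x
      simp only [Set.mem_inter_iff, Set.mem_ofPred_eq, Set.mem_empty_iff_false, iff_false, not_and]
      exact fun hx h => ht (by rw [← h, hs x hx])
    · simp
  · have key : ∀ x ∈ P, ∀ y ∈ P, l x < l y → l x ≤ 0 → 0 ≤ l y →
        ∃ z ∈ P, l z = 0 := by
      intro x hx y hy hxy hx0 hy0
      refine ⟨x + (-l x / (l y - l x)) • (y - x), hP.1.add_smul_sub_mem hx hy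
        ⟨div_nonneg (by linarith) (by linarith), ?_⟩, ?_⟩
      · rw [div_le_one (by linarith)]; linarith
      · have : l y - l x ≠ 0 := by linarith
        simp only [map_add, map_smul, map_sub, smul_eq_mul]
        field_simp
        ring
    have hzero : ∃ z ∈ P, l z = 0 := by
      by_contra hno
      push Not at hno
      refine hc ?_
      by_cases hpos : ∃ x ∈ P, 0 < l x
      · obtain ⟨x, hx, hlx⟩ := hpos
        refine ⟨1, fun y hy => ?_⟩
        rw [sign_eq_one_iff]
        by_contra hle
        push Not at hle
        obtain ⟨z, hz, hz'⟩ := key y hy x hx (by linarith) hle hlx.le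
        exact hno z hz hz'
      · push Not at hpos
        refine ⟨-1, fun y hy => ?_⟩
        rw [sign_eq_neg_one_iff]
        exact lt_of_le_of_ne (hpos y hy) (hno y hy)
    obtain ⟨z, hz, hz0⟩ := hzero
    obtain ⟨y, hy, hy0⟩ : ∃ y ∈ P, l y ≠ 0 := by
      by_contra hno
      push Not at hno
      exact hc ⟨0, fun x hx => by rw [hno x hx, sign_zero]⟩
    obtain ⟨ε, hε, hy'⟩ := hP.2 z hz y hy
    have hly' : l (z + ε • (z - y)) = - (ε * l y) := by simp [hz0]
    have hne0 : (P ∩ {x | SignType.sign (l x) = 0}).Nonempty := ⟨z, hz, by simp [hz0]⟩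
    have hne1 : (P ∩ {x | SignType.sign (l x) = 1}).Nonempty ∧
        (P ∩ {x | SignType.sign (l x) = -1}).Nonempty := by
      rcases lt_or_gt_of_ne hy0 with h | h
      · exact ⟨⟨_, hy', by rw [Set.mem_ofPred_eq, hly', sign_eq_one_iff]; nlinarith⟩,
          ⟨y, hy, by rw [Set.mem_ofPred_eq, sign_eq_neg_one_iff]; exact h⟩⟩
      · exact ⟨⟨y, hy, by rw [Set.mem_ofPred_eq, sign_eq_one_iff]; exact h⟩,
          ⟨_, hy', by rw [Set.mem_ofPred_eq, hly', sign_eq_neg_one_iff]; nlinarith⟩⟩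
    have hne : P.Nonempty := ⟨z, hz⟩
    rw [BoolFun.sum_signType]
    simp only [ev, if_pos hne0, if_pos hne1.1, if_pos hne1.2, if_pos hne]
    rw [vectorSpan_inter_sign hP l one_ne_zero hne1.1,
      vectorSpan_inter_sign hP l (by decide) hne1.2, vectorSpan_inter_sign_zero hP l hne0,
      ← finrank_inf_ker_add_one (vectorSpan ℝ P) l
        ⟨y - z, vsub_mem_vectorSpan ℝ hy hz, by simpa [hz0] using hy0⟩, pow_succ]
    ring

/-- The cell of the arrangement `A` of linear hyperplanes with sign vector `a`. -/
def cell {k : ℕ} (A : Fin k → E →ₗ[ℝ] ℝ) (a : Fin k → SignType) : Set E :=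
  {x | ∀ i, SignType.sign (A i x) = a i}

lemma cell_succ {k : ℕ} (A : Fin (k + 1) → E →ₗ[ℝ] ℝ) (s : SignType) (a : Fin k → SignType) :
    cell A (Fin.cons s a) = {x | SignType.sign (A 0 x) = s} ∩ cell (fun i => A i.succ) a := by
  ext x
  simp [cell, Fin.forall_fin_succ]

lemma relOpenConvex_cell {k : ℕ} (A : Fin k → E →ₗ[ℝ] ℝ) (a : Fin k → SignType) :
    RelOpenConvex (cell A a) := by
  induction k with
  | zero =>
    have : cell A a = Set.univ := by ext; simp [cell]
    rw [this]; exact RelOpenConvex.univ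
  | succ k ih =>
    rw [← Fin.cons_self_tail a, cell_succ]
    exact (relOpenConvex_sign _ _).inter (ih _ _)

lemma sum_ev_cell [FiniteDimensional ℝ E] {k : ℕ} (A : Fin k → E →ₗ[ℝ] ℝ) {P : Set E}
    (hP : RelOpenConvex P) : ∑ a, ev (P ∩ cell A a) = ev P := by
  induction k generalizing P with
  | zero =>
    have : ∀ a, cell A a = Set.univ := fun a => by ext; simp [cell]
    simp [this]
  | succ k ih =>
    rw [← (Fin.consEquiv (fun _ => SignType)).sum_comp, Fintype.sum_prod_type]
    rw [← ev_split hP (A 0)]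
    refine Finset.sum_congr rfl fun s _ => ?_
    rw [← ih (fun i => A i.succ) (hP.inter (relOpenConvex_sign (A 0) s))]
    refine Finset.sum_congr rfl fun a _ => ?_
    change ev (P ∩ cell A (Fin.cons s a)) = _
    rw [cell_succ, Set.inter_assoc]

/-- Injectivity on P passes to its direction space, since short vectors of that space are
differences of points of P. Hence the dimension is unchanged. -/
lemma ev_image {P : Set E} (hP : RelOpenConvex P) (g : E →ₗ[ℝ] F) (hg : Set.InjOn g P) :
    ev (g '' P) = ev P := by
  rcases P.eq_empty_or_nonempty with rfl | ⟨x, hx⟩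
  · simp [ev]
  have h1 : (g '' P).Nonempty := ⟨_, x, hx, rfl⟩
  have h2 : P.Nonempty := ⟨x, hx⟩
  simp only [ev, if_pos h1, if_pos h2]
  have h3 : vectorSpan ℝ (g '' P) = (vectorSpan ℝ P).map g :=
    (AffineMap.map_vectorSpan g.toAffineMap (s := P)).symm
  have h4 : Function.Injective (g.domRestrict (vectorSpan ℝ P)) := by
    rw [← LinearMap.ker_eq_bot, LinearMap.ker_eq_bot']
    rintro ⟨w, hw⟩ hgw
    rw [LinearMap.domRestrict_apply] at hgw
    obtain ⟨ε, hε, hm⟩ := hP.exists_add_smul_mem hx hw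
    have := hg hm hx (by simp [hgw])
    simpa [hε.ne'] using this
  have h5 : LinearMap.range (g.domRestrict (vectorSpan ℝ P)) = (vectorSpan ℝ P).map g := by
    ext y; simp [Submodule.mem_map]
  rw [h3, ← h5, LinearMap.finrank_range_of_inj h4]

/-- The Euler characteristic of a union of cells of the arrangement `A`. -/
noncomputable def chi {k : ℕ} (A : Fin k → E →ₗ[ℝ] ℝ) (X : Set E) : ℤ := ∑ a, ev (X ∩ cell A a)

/-- On each cell of `A` that meets `X`, the map `φ` is linear, and the cell lies in `X`. -/
def LinearOnCells {k : ℕ} (A : Fin k → E →ₗ[ℝ] ℝ) (X : Set E) (φ : E → F) : Prop :=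
  ∀ a, (X ∩ cell A a).Nonempty → cell A a ⊆ X ∧ ∃ g : E →ₗ[ℝ] F, Set.EqOn φ g (cell A a)

lemma LinearOnCells.ev_eq_sum [FiniteDimensional ℝ E] {k m : ℕ} {A : Fin k → E →ₗ[ℝ] ℝ}
    {X : Set E} {φ : E → F} (hA : LinearOnCells A X φ) (B : Fin m → F →ₗ[ℝ] ℝ)
    (a : Fin k → SignType) :
    ev (X ∩ cell A a) = ∑ b, ev (X ∩ cell A a ∩ φ ⁻¹' cell B b) := by
  rcases (X ∩ cell A a).eq_empty_or_nonempty with h | h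
  · simp [h, ev_empty]
  · obtain ⟨h4, g, h5⟩ := hA a h
    rw [Set.inter_eq_right.2 h4,
      ← sum_ev_cell (fun i => (B i).comp g) (relOpenConvex_cell A a)]
    refine Finset.sum_congr rfl fun b _ => ?_
    congr 1
    ext x
    simp only [Set.mem_inter_iff, Set.mem_preimage, and_congr_right_iff]
    intro hx
    rw [h5 hx]
    rfl

/-- Both sides are refined by cutting cells of one arrangement by preimages of cells of the other.
The resulting pieces correspond under φ, which is linear and injective on each. Continuity plays no
role. -/
lemma chi_eq_of_invOn [FiniteDimensional ℝ E] [FiniteDimensional ℝ F] {k m : ℕ}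
    {A : Fin k → E →ₗ[ℝ] ℝ} {B : Fin m → F →ₗ[ℝ] ℝ} {X : Set E} {Y : Set F} {φ : E → F}
    {γ : F → E} (hA : LinearOnCells A X φ) (hB : LinearOnCells B Y γ) (h1 : Set.MapsTo φ X Y)
    (h2 : Set.MapsTo γ Y X) (h3 : Set.InvOn γ φ X Y) : chi A X = chi B Y := by
  unfold chi
  rw [Finset.sum_congr rfl fun a _ => hA.ev_eq_sum B a,
    Finset.sum_congr rfl fun b _ => hB.ev_eq_sum A b, Finset.sum_comm]
  refine Finset.sum_congr rfl fun b _ => Finset.sum_congr rfl fun a _ => ?_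
  -- The pieces of Y are exactly the images of the pieces of X, because the maps are mutually
  -- inverse.
  have e : Y ∩ cell B b ∩ γ ⁻¹' cell A a = φ '' (X ∩ cell A a ∩ φ ⁻¹' cell B b) := by
    ext y
    constructor
    · rintro ⟨⟨hy, hb⟩, ha⟩
      refine ⟨γ y, ⟨⟨h2 hy, ha⟩, ?_⟩, h3.2 hy⟩
      rw [Set.mem_preimage, h3.2 hy]
      exact hb
    · rintro ⟨x, ⟨⟨hx, ha⟩, hb⟩, rfl⟩
      refine ⟨⟨h1 hx, hb⟩, ?_⟩
      rw [Set.mem_preimage, h3.1 hx]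
      exact ha
  rw [e]
  rcases (X ∩ cell A a).eq_empty_or_nonempty with h | h
  · simp [h, ev_empty]
  · obtain ⟨h4, g, h5⟩ := hA a h
    rw [Set.inter_eq_right.2 h4]
    have h6 : cell A a ∩ φ ⁻¹' cell B b = cell A a ∩ cell (fun i => (B i).comp g) b := by
      ext x
      simp only [Set.mem_inter_iff, Set.mem_preimage, and_congr_right_iff]
      intro hx
      rw [h5 hx]
      rfl
    have h7 : φ '' (cell A a ∩ φ ⁻¹' cell B b) = g '' (cell A a ∩ φ ⁻¹' cell B b) :=
      Set.image_congr fun x hx => h5 hx.1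
    rw [h7, ev_image]
    · rw [h6]; exact (relOpenConvex_cell _ _).inter (relOpenConvex_cell _ _)
    · intro x hx y hy hxy
      rw [← h5 hx.1, ← h5 hy.1] at hxy
      rw [← h3.1 (h4 hx.1), ← h3.1 (h4 hy.1), hxy]

end Valuation


open Filter Topology

/-! ### Tangent cones and derivatives of PL maps -/

section Polyhedra

variable {E F : Type*} [AddCommGroup E] [Module ℝ E] [AddCommGroup F] [Module ℝ F]

/-- The polyhedron defined by a finite set of affine inequalities. -/
def hPoly (A : Finset (E →ᵃ[ℝ] ℝ)) : Set E := {x | ∀ l ∈ A, 0 ≤ l x}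

/-- A variant of `IsPLOn` with pieces defined by affine inequalities. -/
def IsHPLOn (f : E → F) (X : Set E) : Prop :=
  ∃ S : Finset (Finset (E →ᵃ[ℝ] ℝ)), X = ⋃ A ∈ S, hPoly A ∧
    ∀ A ∈ S, ∃ g : E →ᵃ[ℝ] F, Set.EqOn f g (hPoly A)

/-- The vertices are completed to an affine basis. The simplex is cut out by nonnegativity of all
barycentric coordinates together with vanishing of those of the added vertices. -/
lemma exists_hPoly_eq_convexHull [FiniteDimensional ℝ E] (t : Finset E)
    (ht : AffineIndependent ℝ ((↑) : t → E)) :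
    ∃ A : Finset (E →ᵃ[ℝ] ℝ), convexHull ℝ (t : Set E) = hPoly A := by
  classical
  obtain ⟨s, hts, hs, htop⟩ := exists_subset_affineIndependent_affineSpan_eq_top
    (k := ℝ) (V := E) (s := (t : Set E)) ht
  have hfin : Finite s := finite_of_fin_dim_affineIndependent ℝ hs
  have : Fintype s := Fintype.ofFinite s
  let b : AffineBasis s ℝ E := ⟨((↑) : s → E), hs, by rw [Subtype.range_coe]; exact htop⟩
  have hb : ∀ i, b i = i := fun i => rfl
  refine ⟨Finset.univ.image b.coord ∪
    (Finset.univ.filter fun i : s => (i : E) ∉ t).image fun i => -b.coord i, ?_⟩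
  have hmem : ∀ x, x ∈ hPoly (Finset.univ.image b.coord ∪
      (Finset.univ.filter fun i : s => (i : E) ∉ t).image fun i => -b.coord i) ↔
      (∀ i, 0 ≤ b.coord i x) ∧ ∀ i : s, (i : E) ∉ t → b.coord i x ≤ 0 := by
    intro x
    simp only [hPoly, Set.mem_ofPred_eq, Finset.mem_union, Finset.mem_image, Finset.mem_univ,
      true_and, Finset.mem_filter]
    constructor
    · intro h
      refine ⟨fun i => h _ (Or.inl ⟨i, rfl⟩), fun i hi => ?_⟩
      have := h _ (Or.inr ⟨i, hi, rfl⟩)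
      rw [AffineMap.coe_neg, Pi.neg_apply] at this
      linarith
    · rintro ⟨h1, h2⟩ l (⟨i, rfl⟩ | ⟨i, hi, rfl⟩)
      · exact h1 i
      · have := h2 i hi
        rw [AffineMap.coe_neg, Pi.neg_apply]
        linarith
  ext x
  rw [hmem]
  constructor
  · have hc : Convex ℝ {x : E | (∀ i, 0 ≤ b.coord i x) ∧
        ∀ i : s, (i : E) ∉ t → b.coord i x ≤ 0} := by
      rintro x ⟨h1, h2⟩ y ⟨h3, h4⟩ a c ha hc hac
      have e : ∀ i, b.coord i (a • x + c • y) = a • b.coord i x + c • b.coord i y :=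
        fun i => Convex.combo_affine_apply hac
      simp only [Set.mem_ofPred_eq, e, smul_eq_mul]
      refine ⟨fun i => ?_, fun i hi => ?_⟩
      · have := h1 i; have := h3 i; positivity
      · have := h2 i hi; have := h4 i hi; nlinarith
    intro hx
    refine convexHull_min ?_ hc hx
    intro y hy
    refine ⟨fun i => ?_, fun i hi => ?_⟩
    · have := b.coord_apply i ⟨y, hts hy⟩
      rw [hb] at this
      change b.coord i y = _ at this
      rw [this]
      split_ifs <;> norm_num
    · have := b.coord_apply_ne (i := i) (j := ⟨y, hts hy⟩) (by rintro rfl; exact hi hy)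
      exact this.le
  · rintro ⟨h1, h2⟩
    have h0 : ∀ i : s, (i : E) ∉ t → b.coord i x = 0 := fun i hi => le_antisymm (h2 i hi) (h1 i)
    have e1 := b.linear_combination_coord_eq_self x
    have e2 := b.sum_coord_apply_eq_one x
    rw [← Finset.sum_filter_add_sum_filter_not _ (fun i : s => (i : E) ∈ t)] at e1 e2
    rw [Finset.sum_eq_zero (s := Finset.univ.filter fun i : s => ¬(i : E) ∈ t)
      (fun i hi => by rw [h0 i (by simpa using hi), zero_smul]), add_zero] at e1
    rw [Finset.sum_eq_zero (s := Finset.univ.filter fun i : s => ¬(i : E) ∈ t)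
      (fun i hi => by rw [h0 i (by simpa using hi)]), add_zero] at e2
    rw [← e1]
    refine (convex_convexHull ℝ _).sum_mem (fun i _ => h1 i) e2 fun i hi => ?_
    rw [hb]
    exact subset_convexHull ℝ _ (by simpa using hi)

/-- By Carathéodory's theorem each polytope is the union of the simplices spanned by affinely
independent subsets of its generators. This gives inequalities without facet theory. -/
lemma IsPLOn.isHPLOn [FiniteDimensional ℝ E] {f : E → F} {X : Set E} (h : IsPLOn f X) :
    IsHPLOn f X := by
  classical
  obtain ⟨S, hX, hf⟩ := h
  have hex : ∀ t : Finset E, ∃ A : Finset (E →ᵃ[ℝ] ℝ), AffineIndependent ℝ ((↑) : t → E) →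
      convexHull ℝ (t : Set E) = hPoly A := by
    intro t
    by_cases ht : AffineIndependent ℝ ((↑) : t → E)
    · obtain ⟨A, hA⟩ := exists_hPoly_eq_convexHull t ht
      exact ⟨A, fun _ => hA⟩
    · exact ⟨∅, fun h => (ht h).elim⟩
  choose A hA using hex
  refine ⟨S.biUnion fun s => (s.powerset.filter fun t : Finset E =>
    AffineIndependent ℝ ((↑) : t → E)).image A, ?_, ?_⟩
  · rw [hX]
    ext x
    simp only [Set.mem_iUnion, Finset.mem_biUnion, Finset.mem_image, Finset.mem_filter,
      Finset.mem_powerset, exists_prop]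
    constructor
    · rintro ⟨s, hs, hx⟩
      rw [convexHull_eq_union] at hx
      simp only [Set.mem_iUnion, exists_prop] at hx
      obtain ⟨t, hts, ht, hx⟩ := hx
      exact ⟨A t, ⟨s, hs, t, ⟨by exact_mod_cast hts, ht⟩, rfl⟩, hA t ht ▸ hx⟩
    · rintro ⟨_, ⟨s, hs, t, ⟨hts, ht⟩, rfl⟩, hx⟩
      rw [← hA t ht] at hx
      exact ⟨s, hs, convexHull_mono (by exact_mod_cast hts) hx⟩
  · simp only [Finset.mem_biUnion, Finset.mem_image, Finset.mem_filter, Finset.mem_powerset]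
    rintro _ ⟨s, hs, t, ⟨hts, ht⟩, rfl⟩
    obtain ⟨g, hg⟩ := hf s hs
    refine ⟨g, fun x hx => hg ?_⟩
    rw [← hA t ht] at hx
    exact convexHull_mono (by exact_mod_cast hts) hx

/-- The sign of `a + t * b` for small positive `t`. -/
noncomputable def lexSign (a b : ℝ) : SignType :=
  if SignType.sign a = 0 then SignType.sign b else SignType.sign a

lemma eventually_sign_eq (a b : ℝ) :
    ∀ᶠ t in 𝓝[>] (0 : ℝ), SignType.sign (a + t * b) = lexSign a b := by
  by_cases ha : a = 0
  · subst ha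
    filter_upwards [self_mem_nhdsWithin] with t ht
    have ht' : (0 : ℝ) < t := ht
    simp [lexSign, sign_mul, sign_pos ht']
  · have hc : Tendsto (fun t : ℝ => a + t * b) (𝓝[>] 0) (𝓝 a) := by
      have : ContinuousAt (fun t : ℝ => a + t * b) 0 := by fun_prop
      have h2 := this.tendsto
      simp only [zero_mul, add_zero] at h2
      exact h2.mono_left nhdsWithin_le_nhds
    have hs : lexSign a b = SignType.sign a := by simp [lexSign, ha]
    rw [hs]
    rcases lt_or_gt_of_ne ha with h | h
    · filter_upwards [hc.eventually (eventually_lt_nhds h)] with t ht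
      rw [sign_neg ht, sign_neg h]
    · filter_upwards [hc.eventually (eventually_gt_nhds h)] with t ht
      rw [sign_pos ht, sign_pos h]

/-- The tangent cone of a polyhedron at a point. -/
def tanCone (X : Set E) (p : E) : Set E := {v | ∀ᶠ t in 𝓝[>] (0 : ℝ), p + t • v ∈ X}

open Classical in
/-- The derivative of a PL map along tangent directions. -/
noncomputable def tanMap (f : E → F) (p v : E) : F :=
  -- On tangent directions of the domain of a PL map such a vector exists, so the value 0 is
  -- irrelevant there.
  if h : ∃ w, ∀ᶠ t in 𝓝[>] (0 : ℝ), f (p + t • v) = f p + t • w then h.choose else 0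

lemma tanMap_eq {f : E → F} {p v : E} {w : F}
    (h : ∀ᶠ t in 𝓝[>] (0 : ℝ), f (p + t • v) = f p + t • w) : tanMap f p v = w := by
  have hex : ∃ w, ∀ᶠ t in 𝓝[>] (0 : ℝ), f (p + t • v) = f p + t • w := ⟨w, h⟩
  rw [tanMap, dif_pos hex]
  obtain ⟨t, ⟨h1, h2⟩, ht⟩ := ((h.and hex.choose_spec).and self_mem_nhdsWithin).exists
  have ht' : (0 : ℝ) < t := ht
  rw [h1, add_right_inj] at h2
  exact (smul_right_injective F ht'.ne' h2).symm

lemma eventually_mem_hPoly_iff (A : Finset (E →ᵃ[ℝ] ℝ)) (p v : E) :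
    ∀ᶠ t in 𝓝[>] (0 : ℝ), p + t • v ∈ hPoly A ↔ ∀ l ∈ A, 0 ≤ lexSign (l p) (l.linear v) := by
  have : ∀ᶠ t in 𝓝[>] (0 : ℝ), ∀ l ∈ A,
      SignType.sign (l p + t * l.linear v) = lexSign (l p) (l.linear v) := by
    rw [Filter.eventually_all_finset]
    exact fun l _ => eventually_sign_eq _ _
  filter_upwards [this] with t ht
  refine forall₂_congr fun l hl => ?_
  have e : l (p + t • v) = l p + t * l.linear v := by
    rw [add_comm p, ← vadd_eq_add, l.map_vadd, vadd_eq_add, map_smul, smul_eq_mul, add_comm]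
  rw [e, ← ht l hl, sign_nonneg_iff]

/-- There are finitely many inequalities, so for all small positive t membership of p + t v in every
piece is decided by lexicographic signs and no longer depends on t. -/
lemma mem_tanCone_iff {X : Set E} {S : Finset (Finset (E →ᵃ[ℝ] ℝ))} (hX : X = ⋃ A ∈ S, hPoly A)
    (p v : E) :
    v ∈ tanCone X p ↔ ∃ A ∈ S, ∀ l ∈ A, 0 ≤ lexSign (l p) (l.linear v) := by
  have h1 : ∀ᶠ t in 𝓝[>] (0 : ℝ), ∀ A ∈ S, (p + t • v ∈ hPoly A ↔
      ∀ l ∈ A, 0 ≤ lexSign (l p) (l.linear v)) := by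
    rw [Filter.eventually_all_finset]
    exact fun A _ => eventually_mem_hPoly_iff A p v
  have h2 : ∀ᶠ t in 𝓝[>] (0 : ℝ), (p + t • v ∈ X ↔
      ∃ A ∈ S, ∀ l ∈ A, 0 ≤ lexSign (l p) (l.linear v)) := by
    filter_upwards [h1] with t ht
    rw [hX]
    simp only [Set.mem_iUnion, exists_prop]
    exact exists_congr fun A => and_congr_right fun hA => ht A hA
  constructor
  · intro hv
    obtain ⟨t, h3, h4⟩ := (h2.and hv).exists
    exact h3.1 h4
  · intro h
    filter_upwards [h2] with t ht
    exact ht.2 h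

lemma nonneg_of_lexSign {a b : ℝ} (h : 0 ≤ lexSign a b) : 0 ≤ a := by
  unfold lexSign at h
  split_ifs at h with h0
  · exact (sign_eq_zero_iff.1 h0).ge
  · exact sign_nonneg_iff.1 h

lemma eventually_eq_of_lexSign {f : E → F} {A : Finset (E →ᵃ[ℝ] ℝ)} {g : E →ᵃ[ℝ] F}
    (hg : Set.EqOn f g (hPoly A)) {p v : E} (hv : ∀ l ∈ A, 0 ≤ lexSign (l p) (l.linear v)) :
    ∀ᶠ t in 𝓝[>] (0 : ℝ), f (p + t • v) = f p + t • g.linear v := by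
  have hp : p ∈ hPoly A := fun l hl => nonneg_of_lexSign (hv l hl)
  filter_upwards [eventually_mem_hPoly_iff A p v] with t ht
  rw [hg (ht.2 hv), hg hp, add_comm p, ← vadd_eq_add, g.map_vadd, vadd_eq_add, map_smul, add_comm]

lemma IsHPLOn.eventually_eq {f : E → F} {X : Set E} (h : IsHPLOn f X) {p v : E}
    (hv : v ∈ tanCone X p) :
    ∀ᶠ t in 𝓝[>] (0 : ℝ), f (p + t • v) = f p + t • tanMap f p v := by
  obtain ⟨S, hX, hf⟩ := h
  obtain ⟨A, hA, hv⟩ := (mem_tanCone_iff hX p v).1 hv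
  obtain ⟨g, hg⟩ := hf A hA
  have := eventually_eq_of_lexSign hg hv
  rwa [tanMap_eq this]

/-- The arrangement consists of the linear parts of all inequalities of all pieces. Lexicographic
signs at p depend only on the signs of these parts, so a whole cell stays in the same piece. -/
lemma IsHPLOn.exists_linearOnCells {f : E → F} {X : Set E} (h : IsHPLOn f X) (p : E) :
    ∃ (k : ℕ) (A : Fin k → E →ₗ[ℝ] ℝ), LinearOnCells A (tanCone X p) (tanMap f p) := by
  classical
  obtain ⟨S, hX, hf⟩ := h
  let U : Finset (E →ᵃ[ℝ] ℝ) := S.biUnion id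
  refine ⟨U.card, fun i => ((U.equivFin.symm i : U) : E →ᵃ[ℝ] ℝ).linear, fun a ha => ?_⟩
  obtain ⟨v, hv, hva⟩ := ha
  obtain ⟨A, hA, hv⟩ := (mem_tanCone_iff hX p v).1 hv
  have hall : ∀ w ∈ cell (fun i => ((U.equivFin.symm i : U) : E →ᵃ[ℝ] ℝ).linear) a,
      ∀ l ∈ A, 0 ≤ lexSign (l p) (l.linear w) := by
    intro w hw l hl
    have hlU : l ∈ U := Finset.mem_biUnion.2 ⟨A, hA, hl⟩
    have h1 := hva (U.equivFin ⟨l, hlU⟩)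
    have h2 := hw (U.equivFin ⟨l, hlU⟩)
    simp only [Equiv.symm_apply_apply] at h1 h2
    have h3 := hv l hl
    unfold lexSign at h3 ⊢
    rwa [h2, ← h1]
  obtain ⟨g, hg⟩ := hf A hA
  exact ⟨fun w hw => (mem_tanCone_iff hX p w).2 ⟨A, hA, hall w hw⟩, g.linear,
    fun w hw => tanMap_eq (eventually_eq_of_lexSign hg (hall w hw))⟩

lemma mapsTo_tanMap {f : E → F} {X : Set E} {Y : Set F} (h : IsHPLOn f X)
    (hf : Set.MapsTo f X Y) (p : E) :
    Set.MapsTo (tanMap f p) (tanCone X p) (tanCone Y (f p)) := by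
  intro v hv
  have hv' : ∀ᶠ t in 𝓝[>] (0 : ℝ), p + t • v ∈ X := hv
  change ∀ᶠ t in 𝓝[>] (0 : ℝ), _
  filter_upwards [h.eventually_eq hv, hv'] with t h1 h2
  rw [← h1]
  exact hf h2

lemma leftInvOn_tanMap {f : E → F} {g : F → E} {X : Set E} (h : IsHPLOn f X)
    (hg : Set.LeftInvOn g f X) {p : E} (hp : p ∈ X) :
    Set.LeftInvOn (tanMap g (f p)) (tanMap f p) (tanCone X p) := by
  intro v hv
  have hv' : ∀ᶠ t in 𝓝[>] (0 : ℝ), p + t • v ∈ X := hv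
  refine tanMap_eq ?_
  filter_upwards [h.eventually_eq hv, hv'] with t h1 h2
  rw [← h1, hg h2, hg hp]

/-- PL homeomorphisms preserve local Euler characteristics. -/
theorem chi_tanCone_eq [FiniteDimensional ℝ E] [FiniteDimensional ℝ F] {f : E → F} {g : F → E}
    {X : Set E} {Y : Set F} (hf : IsHPLOn f X) (hg : IsHPLOn g Y) (h1 : Set.MapsTo f X Y)
    (h2 : Set.MapsTo g Y X) (h3 : Set.InvOn g f X Y) {p : E} (hp : p ∈ X) {k m : ℕ}
    {A : Fin k → E →ₗ[ℝ] ℝ} {B : Fin m → F →ₗ[ℝ] ℝ} (hA : LinearOnCells A (tanCone X p) id)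
    (hB : LinearOnCells B (tanCone Y (f p)) id) :
    chi A (tanCone X p) = chi B (tanCone Y (f p)) := by
  obtain ⟨k', A', hA'⟩ := hf.exists_linearOnCells p
  obtain ⟨m', B', hB'⟩ := hg.exists_linearOnCells (f p)
  have hgf : g (f p) = p := h3.1 hp
  -- The Euler characteristic does not depend on the arrangement: the invariance lemma is applied to
  -- the identity map.
  have e1 : chi A (tanCone X p) = chi A' (tanCone X p) := by
    refine chi_eq_of_invOn hA (fun a ha => ⟨(hA' a ha).1, LinearMap.id, fun _ _ => rfl⟩)
      (Set.mapsTo_id _) (Set.mapsTo_id _) ⟨fun _ _ => rfl, fun _ _ => rfl⟩ (γ := id)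
  have e2 : chi B (tanCone Y (f p)) = chi B' (tanCone Y (f p)) := by
    refine chi_eq_of_invOn hB (fun a ha => ⟨(hB' a ha).1, LinearMap.id, fun _ _ => rfl⟩)
      (Set.mapsTo_id _) (Set.mapsTo_id _) ⟨fun _ _ => rfl, fun _ _ => rfl⟩ (γ := id)
  rw [e1, e2]
  refine chi_eq_of_invOn hA' hB' (mapsTo_tanMap hf h1 p) ?_ ⟨leftInvOn_tanMap hf h3.1 hp, ?_⟩
  · have := mapsTo_tanMap hg h2 (f p)
    rwa [hgf] at this
  · have := leftInvOn_tanMap hg h3.2 (h1 hp)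
    rwa [hgf] at this

end Polyhedra


open Filter Topology Function

lemma BoolFun.ind_forall {ι : Type*} [Fintype ι] (Q : ι → Prop) :
    ind (∀ i, Q i) = ∏ i, ind (Q i) := by
  by_cases h : ∀ i, Q i
  · rw [ind_true h, Finset.prod_eq_one fun i _ => ind_true (h i)]
  · obtain ⟨i, hi⟩ := not_forall.1 h
    rw [ind_false h, Finset.prod_eq_zero (Finset.mem_univ i) (ind_false hi)]

/-! ### Tangent cones of the cube and of unions of unit cubes -/

section Coordinates

variable {n : ℕ}

/-- The arrangement of coordinate hyperplanes. -/
def coordForms (n : ℕ) : Fin n → (Fin n → ℝ) →ₗ[ℝ] ℝ := fun i => LinearMap.proj i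

/-- The vector with entries `-1`, `0`, `1` with a given sign vector. -/
def signVec (τ : Fin n → SignType) : Fin n → ℝ := fun i => (τ i : ℝ)

/-- The sign vector of a point. -/
noncomputable def sgnv (x : Fin n → ℝ) : Fin n → SignType := fun i => SignType.sign (x i)

lemma sgnv_signVec (τ : Fin n → SignType) : sgnv (signVec τ) = τ := by
  funext i
  simp only [sgnv, signVec]
  cases τ i <;> simp

lemma mem_cell_coordForms {τ : Fin n → SignType} {x : Fin n → ℝ} :
    x ∈ cell (coordForms n) τ ↔ sgnv x = τ := by
  simp [cell, coordForms, sgnv, funext_iff]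

lemma vectorSpan_cell_coordForms (τ : Fin n → SignType) :
    vectorSpan ℝ (cell (coordForms n) τ) =
      Submodule.span ℝ (Set.range fun i : {i // τ i ≠ 0} => Pi.single (M := fun _ => ℝ) (i : Fin n) 1) := by
  have h0 : signVec τ ∈ cell (coordForms n) τ := mem_cell_coordForms.2 (sgnv_signVec τ)
  apply le_antisymm
  · rw [vectorSpan_eq_span_vsub_set_right ℝ h0, Submodule.span_le]
    rintro _ ⟨y, hy, rfl⟩
    have key : ∀ z : Fin n → ℝ, (∀ i, τ i = 0 → z i = 0) → z ∈ Submodule.span ℝ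
        (Set.range fun i : {i // τ i ≠ 0} => Pi.single (M := fun _ => ℝ) (i : Fin n) 1) := by
      intro z hz
      rw [pi_eq_sum_univ' z]
      refine Submodule.sum_mem _ fun i _ => ?_
      by_cases hi : τ i = 0
      · rw [hz i hi, zero_smul]; exact Submodule.zero_mem _
      · refine Submodule.smul_mem _ _ (Submodule.subset_span ⟨⟨i, hi⟩, ?_⟩)
        funext j
        simp [Pi.single_apply, eq_comm]
    refine key _ fun i hi => ?_
    have h1 := congrFun (mem_cell_coordForms.1 hy) i
    simp only [sgnv, hi, sign_eq_zero_iff] at h1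
    simp [signVec, hi, h1]
  · rw [Submodule.span_le]
    rintro _ ⟨⟨i, hi⟩, rfl⟩
    -- Doubling the nonzero coordinate i keeps its sign, so the difference is a multiple of the
    -- basis vector.
    have h1 : signVec τ + (τ i : ℝ) • Pi.single i 1 ∈ cell (coordForms n) τ := by
      rw [mem_cell_coordForms]
      funext j
      by_cases hj : j = i
      · subst hj
        rcases (τ j).trichotomy with h | h | h
        · simp [sgnv, signVec, h, sign_neg (show (-1 : ℝ) + -1 < 0 by norm_num)]
        · exact (hi h).elim
        · simp [sgnv, signVec, h, sign_pos (show (0 : ℝ) < 1 + 1 by norm_num)]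
      · rw [← congrFun (sgnv_signVec τ) j]
        simp [sgnv, hj]
    have h2 := vsub_mem_vectorSpan ℝ h1 h0
    simp only [vsub_eq_sub, add_sub_cancel_left] at h2
    refine (Submodule.smul_mem_iff _ (s := (τ i : ℝ)) ?_).1 h2
    rcases (τ i).trichotomy with h | h | h <;> simp_all

lemma ev_cell_coordForms (τ : Fin n → SignType) :
    ev (cell (coordForms n) τ) = BoolFun.wt τ := by
  have h0 : signVec τ ∈ cell (coordForms n) τ := mem_cell_coordForms.2 (sgnv_signVec τ)
  have hne : (cell (coordForms n) τ).Nonempty := ⟨_, h0⟩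
  rw [ev, if_pos hne, vectorSpan_cell_coordForms, finrank_span_eq_card]
  · unfold BoolFun.wt BoolFun.cw
    rw [Finset.prod_ite, Finset.prod_const_one, one_mul, Finset.prod_const, Fintype.card_subtype]
  · have := (Pi.basisFun ℝ (Fin n)).linearIndependent.comp (Subtype.val : {i // τ i ≠ 0} → Fin n)
      Subtype.val_injective
    convert this using 1
    funext i
    simp

lemma linearOnCells_coordForms {X : Set (Fin n → ℝ)} {Q : (Fin n → SignType) → Prop}
    (hX : ∀ v, v ∈ X ↔ Q (sgnv v)) : LinearOnCells (coordForms n) X id := by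
  rintro τ ⟨v, hv, hvτ⟩
  refine ⟨fun w hw => ?_, LinearMap.id, fun _ _ => rfl⟩
  rw [hX, mem_cell_coordForms.1 hw, ← mem_cell_coordForms.1 hvτ, ← hX]
  exact hv

lemma chi_coordForms {X : Set (Fin n → ℝ)} {Q : (Fin n → SignType) → Prop}
    (hX : ∀ v, v ∈ X ↔ Q (sgnv v)) :
    chi (coordForms n) X = ∑ τ, BoolFun.wt τ * BoolFun.ind (Q τ) := by
  unfold chi
  refine Finset.sum_congr rfl fun τ _ => ?_
  by_cases hQ : Q τ
  · rw [BoolFun.ind_true hQ, mul_one, ← ev_cell_coordForms]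
    congr 1
    refine Set.inter_eq_right.2 fun v hv => ?_
    rw [hX, mem_cell_coordForms.1 hv]
    exact hQ
  · rw [BoolFun.ind_false hQ, mul_zero, ← ev_empty (E := Fin n → ℝ)]
    congr 1
    ext v
    simp only [Set.mem_inter_iff, Set.mem_empty_iff_false, iff_false, not_and]
    intro hv hvτ
    rw [hX, mem_cell_coordForms.1 hvτ] at hv
    exact hQ hv

/-- The cube `[-1, 1]ⁿ`. -/
def stdCube (n : ℕ) : Set (Fin n → ℝ) := {x | ∀ i, x i ∈ Set.Icc (-1 : ℝ) 1}

lemma eventually_nonneg_iff (a b : ℝ) :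
    ∀ᶠ t in 𝓝[>] (0 : ℝ), (0 ≤ a + t * b ↔ 0 ≤ lexSign a b) := by
  filter_upwards [eventually_sign_eq a b] with t ht
  rw [← ht, sign_nonneg_iff]

lemma eventually_abs_lt_one {p v : Fin n → ℝ} (hp : ∀ i, |p i| < 1) :
    ∀ᶠ t in 𝓝[>] (0 : ℝ), ∀ i, |(p + t • v) i| < 1 := by
  rw [Filter.eventually_all]
  intro i
  have hc : ContinuousAt (fun t : ℝ => |(p + t • v) i|) 0 := by
    simp only [Pi.add_apply, Pi.smul_apply]
    fun_prop
  have h2 := hc.tendsto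
  simp only [zero_smul, add_zero] at h2
  exact (h2.mono_left nhdsWithin_le_nhds).eventually (eventually_lt_nhds (hp i))

lemma eventually_sgnv (p v : Fin n → ℝ) :
    ∀ᶠ t in 𝓝[>] (0 : ℝ), sgnv (p + t • v) = BoolFun.ov (sgnv p) (sgnv v) := by
  have : ∀ᶠ t in 𝓝[>] (0 : ℝ), ∀ i, SignType.sign (p i + t * v i) = lexSign (p i) (v i) := by
    rw [Filter.eventually_all]
    exact fun i => eventually_sign_eq _ _
  filter_upwards [this] with t ht
  funext i
  exact ht i

/-- Inside [-1,1]^n, the unit cubes containing x are those whose vertices are compatible with the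
nonzero signs of x. This is the dictionary between geometry and faces. -/
lemma mem_cubeUnion_iff {ψ : (Fin n → Bool) → Bool} {x : Fin n → ℝ} :
    x ∈ cubeUnion ψ ↔ BoolFun.Occ ψ (sgnv x) ∧ x ∈ stdCube n := by
  simp only [cubeUnion, Set.mem_iUnion, exists_prop, unitSubcube, BoolFun.Occ, BoolFun.Compat,
    stdCube, sgnv, sign_eq_one_iff, sign_eq_neg_one_iff, Set.mem_ofPred_eq, Set.mem_Icc]
  constructor
  · rintro ⟨ξ, h1, h2⟩
    refine ⟨⟨ξ, fun i => ?_, h1⟩, fun i => ?_⟩ <;>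
    · have := h2 i
      split_ifs at this with h
      · rw [Set.mem_Icc] at this
        first
          | exact ⟨fun _ => h, fun h' => by linarith⟩
          | exact ⟨by linarith, by linarith⟩
      · rw [Set.mem_Icc] at this
        first
          | exact ⟨fun h' => by linarith, fun _ => by simpa using h⟩
          | exact ⟨by linarith, by linarith⟩
  · rintro ⟨⟨ξ, h1, h2⟩, h3⟩
    refine ⟨ξ, h2, fun i => ?_⟩
    have ha := h1 i
    have hb := h3 i
    cases hξ : ξ i
    · simp only [hξ, Bool.false_eq_true, imp_false, not_lt, if_false, Set.mem_Icc] at ha ⊢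
      exact ⟨hb.1, ha.1⟩
    · simp only [hξ, Bool.true_eq_false, imp_false, not_lt, if_true, Set.mem_Icc] at ha ⊢
      exact ⟨ha.2, hb.2⟩

lemma mem_tanCone_cubeUnion {ψ : (Fin n → Bool) → Bool} {q : Fin n → ℝ} (hq : ∀ i, |q i| < 1)
    (v : Fin n → ℝ) :
    v ∈ tanCone (cubeUnion ψ) q ↔ BoolFun.Occ ψ (BoolFun.ov (sgnv q) (sgnv v)) := by
  have h : ∀ᶠ t in 𝓝[>] (0 : ℝ), (q + t • v ∈ cubeUnion ψ ↔
      BoolFun.Occ ψ (BoolFun.ov (sgnv q) (sgnv v))) := by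
    filter_upwards [eventually_sgnv q v, eventually_abs_lt_one (v := v) hq] with t h1 h2
    rw [mem_cubeUnion_iff, h1, and_iff_left]
    exact fun i => abs_le.1 (h2 i).le
  constructor
  · intro hv
    obtain ⟨t, h1, h2⟩ := (h.and hv).exists
    exact h1.1 h2
  · intro hv
    filter_upwards [h] with t ht
    exact ht.2 hv

lemma chi_tanCone_cubeUnion {ψ : (Fin n → Bool) → Bool} {q : Fin n → ℝ} (hq : ∀ i, |q i| < 1) :
    chi (coordForms n) (tanCone (cubeUnion ψ) q) = BoolFun.eul ψ (sgnv q) :=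
  chi_coordForms (Q := fun τ => BoolFun.Occ ψ (BoolFun.ov (sgnv q) τ)) (mem_tanCone_cubeUnion hq)

lemma mem_tanCone_stdCube {p : Fin n → ℝ} (hp : p ∈ stdCube n) (v : Fin n → ℝ) :
    v ∈ tanCone (stdCube n) p ↔
      ∀ i, (p i = 1 → sgnv v i ≠ 1) ∧ (p i = -1 → sgnv v i ≠ -1) := by
  have h : ∀ᶠ t in 𝓝[>] (0 : ℝ), (p + t • v ∈ stdCube n ↔
      ∀ i, (p i = 1 → sgnv v i ≠ 1) ∧ (p i = -1 → sgnv v i ≠ -1)) := by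
    have : ∀ᶠ t in 𝓝[>] (0 : ℝ), ∀ i, (0 ≤ (1 - p i) + t * (- v i) ↔ 0 ≤ lexSign (1 - p i) (-v i)) ∧
        (0 ≤ (1 + p i) + t * v i ↔ 0 ≤ lexSign (1 + p i) (v i)) := by
      rw [Filter.eventually_all]
      exact fun i => (eventually_nonneg_iff _ _).and (eventually_nonneg_iff _ _)
    filter_upwards [this] with t ht
    refine forall_congr' fun i => ?_
    have hi := hp i
    have e1 : (p + t • v) i ∈ Set.Icc (-1 : ℝ) 1 ↔
        0 ≤ (1 - p i) + t * (- v i) ∧ 0 ≤ (1 + p i) + t * v i := by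
      simp only [Pi.add_apply, Pi.smul_apply, smul_eq_mul, Set.mem_Icc]
      constructor
      · rintro ⟨h1, h2⟩; constructor <;> linarith
      · rintro ⟨h1, h2⟩; constructor <;> linarith
    have e2 : 0 ≤ lexSign (1 - p i) (-v i) ↔ (p i = 1 → sgnv v i ≠ 1) := by
      unfold lexSign
      by_cases h1 : p i = 1
      · rw [if_pos (by simp [h1])]
        simp only [h1, true_imp_iff, sgnv, sign_nonneg_iff, Ne, sign_eq_one_iff]
        constructor <;> intro <;> linarith
      · have h2 : 0 < 1 - p i := sub_pos.2 (lt_of_le_of_ne hi.2 h1)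
        rw [if_neg (by rw [sign_pos h2]; decide), sign_pos h2]
        simp [h1]
    have e3 : 0 ≤ lexSign (1 + p i) (v i) ↔ (p i = -1 → sgnv v i ≠ -1) := by
      unfold lexSign
      by_cases h1 : p i = -1
      · rw [if_pos (by simp [h1])]
        simp only [h1, true_imp_iff, sgnv, sign_nonneg_iff, Ne, sign_eq_neg_one_iff]
        constructor <;> intro <;> linarith
      · have h2 : 0 < 1 + p i := by
          have := lt_of_le_of_ne hi.1 (Ne.symm h1)
          linarith
        rw [if_neg (by rw [sign_pos h2]; decide), sign_pos h2]
        simp [h1]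
    rw [e1, (ht i).1, (ht i).2, e2, e3]
  constructor
  · intro hv
    obtain ⟨t, h1, h2⟩ := (h.and hv).exists
    exact h1.1 h2
  · intro hv
    filter_upwards [h] with t ht
    exact ht.2 hv

open Classical in
lemma chi_tanCone_stdCube {p : Fin n → ℝ} (hp : p ∈ stdCube n) :
    chi (coordForms n) (tanCone (stdCube n) p) = ∏ i, if |p i| = 1 then (0 : ℤ) else -1 := by
  have h1 := chi_coordForms (Q := fun τ : Fin n → SignType =>
    ∀ i, (p i = 1 → τ i ≠ 1) ∧ (p i = -1 → τ i ≠ -1)) (mem_tanCone_stdCube hp)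
  rw [h1]
  have h2 := Finset.prod_univ_sum (fun _ : Fin n => (Finset.univ : Finset SignType))
    (fun i s => BoolFun.cw s * BoolFun.ind ((p i = 1 → s ≠ 1) ∧ (p i = -1 → s ≠ -1)))
  rw [Fintype.piFinset_univ] at h2
  have h3 : ∀ τ : Fin n → SignType, BoolFun.wt τ *
      BoolFun.ind (∀ i, (p i = 1 → τ i ≠ 1) ∧ (p i = -1 → τ i ≠ -1)) =
      ∏ i, BoolFun.cw (τ i) * BoolFun.ind ((p i = 1 → τ i ≠ 1) ∧ (p i = -1 → τ i ≠ -1)) := by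
    intro τ
    rw [Finset.prod_mul_distrib, BoolFun.wt]
    congr 1
    exact BoolFun.ind_forall _
  rw [Finset.sum_congr rfl fun τ _ => h3 τ, ← h2]
  refine Finset.prod_congr rfl fun i _ => ?_
  rw [BoolFun.sum_signType]
  by_cases ha : p i = 1
  · have e1 : ¬ (1 : ℝ) = -1 := by norm_num
    simp [ha, BoolFun.ind, BoolFun.cw, e1]
  · by_cases hb : p i = -1
    · have e1 : ¬ (-1 : ℝ) = 1 := by norm_num
      simp [hb, BoolFun.ind, BoolFun.cw, e1]
    · have : ¬ |p i| = 1 := fun h => by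
        rcases (abs_eq zero_le_one).1 h with h | h
        · exact ha h
        · exact hb h
      simp [ha, hb, this, BoolFun.ind, BoolFun.cw]

end Coordinates

namespace BoolFun

variable {ι : Type*} [DecidableEq ι]

/-- A function with nonzero Euler characteristic on an edge takes the same values at its ends. -/
lemma eul_eq_zero_of_edge [Fintype ι] {ψ : (ι → Bool) → Bool} {σ : ι → SignType} {j : ι} {b : Bool}
    (hj : σ j = 0) (h1 : Occ ψ (update σ j (bsgn b))) (h2 : ¬Occ ψ (update σ j (bsgn !b)))
    (hσ : ∀ i, i ≠ j → σ i ≠ 0) : eul ψ σ = 0 := by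
  have hov : ∀ τ, ov σ τ = update σ j (τ j) := by
    intro τ; funext i
    by_cases hi : i = j
    · subst hi; simp [ov, hj]
    · simp [ov, hi, hσ i hi]
  have h0 : Occ ψ (update σ j 0) := by
    obtain ⟨ξ, h3, h4⟩ := h1
    exact ⟨ξ, (compat_update_bsgn.1 h3).2, h4⟩
  unfold eul
  simp only [hov]
  rw [sum_split j]
  refine Finset.sum_eq_zero fun τ hτ => ?_
  simp only [Finset.mem_filter, Finset.mem_univ, true_and] at hτ
  -- Exactly one of the two half-lines is present beside the point, so their relative contributions
  -- 1 and -1 cancel.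
  rw [wt_update hτ, wt_update hτ, hτ, update_self, update_self, ind_true h0]
  cases b
  · have h1' : Occ ψ (update σ j (-1)) := h1
    have h2' : ¬Occ ψ (update σ j 1) := h2
    rw [ind_true h1', ind_false h2']
    simp [cw]
  · have h1' : Occ ψ (update σ j 1) := h1
    have h2' : ¬Occ ψ (update σ j (-1)) := h2
    rw [ind_true h1', ind_false h2']
    simp [cw]

/-- Any two vertices of a face are joined by flipping its free coordinates one at a time. -/
lemma full_of_flip {ψ : (ι → Bool) → Bool} {σ : ι → SignType} [Fintype ι] (h : Occ ψ σ)
    (hf : ∀ ξ j, Compat σ ξ → ψ ξ = true → σ j = 0 → ψ (update ξ j (!ξ j)) = true) :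
    Full ψ σ := by
  obtain ⟨ξ, h1, h2⟩ := h
  intro η hη
  have key : ∀ T : Finset ι, Compat σ (fun i => if i ∈ T then η i else ξ i) ∧
      ψ (fun i => if i ∈ T then η i else ξ i) = true := by
    intro T
    refine ⟨fun i => ?_, ?_⟩
    · by_cases hi : i ∈ T
      · simpa [hi] using hη i
      · simpa [hi] using h1 i
    induction T using Finset.induction_on with
    | empty => simpa using h2
    | insert j T hj ih =>
      have e : (fun i => if i ∈ insert j T then η i else ξ i) =
          update (fun i => if i ∈ T then η i else ξ i) j (η j) := by
        funext i
        by_cases hi : i = j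
        · subst hi; simp
        · simp [hi]
      rw [e]
      by_cases hjj : η j = ξ j
      · have : update (fun i => if i ∈ T then η i else ξ i) j (η j) =
            fun i => if i ∈ T then η i else ξ i := by
          rw [update_eq_self_iff]; simp [hj, hjj]
        rwa [this]
      · have hσ : σ j = 0 := by
          have ha := h1 j
          have hb := hη j
          rcases (σ j).trichotomy with h | h | h
          · exact (hjj (by rw [ha.2 h, hb.2 h])).elim
          · exact h
          · exact (hjj (by rw [ha.1 h, hb.1 h])).elim
        have hc : Compat σ (fun i => if i ∈ T then η i else ξ i) := by
          intro i
          by_cases hi : i ∈ T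
          · simpa [hi] using hη i
          · simpa [hi] using h1 i
        have := hf _ j hc ih hσ
        convert this using 2
        simp only [hj, if_false]
        revert hjj
        cases η j <;> cases ξ j <;> simp
  simpa using (key Finset.univ).2

end BoolFun

open BoolFun in
/-- The local Euler characteristics of a union of cubes that is a PL ball. -/
theorem eReg_of_isClosedPLBall {n : ℕ} {ψ : (Fin n → Bool) → Bool}
    (h : IsClosedPLBall n (cubeUnion ψ)) : EReg ψ := by
  obtain ⟨f, g, hf, hg, h1, h2, h3⟩ := h
  change IsPLOn f (stdCube n) at hf
  change Set.MapsTo f (stdCube n) _ at h1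
  change Set.MapsTo g _ (stdCube n) at h2
  change Set.InvOn g f (stdCube n) _ at h3
  have hf' := hf.isHPLOn
  have hg' := hg.isHPLOn
  -- At points of the union interior to the big cube, the Euler characteristic is (-1)^n or 0
  -- according to whether the preimage in the ball is interior or on the boundary.
  have hloc : ∀ q ∈ cubeUnion ψ, (∀ i, |q i| < 1) →
      eul ψ (sgnv q) = ∏ i, if |g q i| = 1 then (0 : ℤ) else -1 := by
    intro q hq hq1
    rw [← chi_tanCone_cubeUnion hq1, ← chi_tanCone_stdCube (h2 hq)]
    exact chi_tanCone_eq hg' hf' h2 h1 h3.symm hq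
      (linearOnCells_coordForms (Q := fun τ => Occ ψ (ov (sgnv q) τ)) (mem_tanCone_cubeUnion hq1))
      (linearOnCells_coordForms (Q := fun τ => ∀ i, (g q i = 1 → τ i ≠ 1) ∧ (g q i = -1 → τ i ≠ -1))
        (mem_tanCone_stdCube (h2 hq)))
  intro σ
  by_cases hocc : Occ ψ σ
  swap
  · rw [ind_false, mul_zero]
    · refine Finset.sum_eq_zero fun τ _ => ?_
      rw [ind_false, mul_zero]
      rintro ⟨ξ, h4, h5⟩
      exact hocc ⟨ξ, h4.of_ov, h5⟩
    · intro hfull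
      obtain ⟨ξ, hξ⟩ := exists_compat σ
      exact hocc ⟨ξ, hξ, hfull ξ hξ⟩
  -- The factor 1/2 keeps the sample point of the cell σ away from the boundary of [-1,1]^n.
  let q : Fin n → ℝ := (1 / 2 : ℝ) • signVec σ
  have hqs : sgnv q = σ := by
    rw [← sgnv_signVec σ]
    funext i
    simp [sgnv, q, sign_mul]
  have hq1 : ∀ i, |q i| < 1 := by
    intro i
    simp only [q, signVec, Pi.smul_apply, smul_eq_mul]
    cases σ i <;> norm_num
  have hq : q ∈ cubeUnion ψ :=
    mem_cubeUnion_iff.2 ⟨hqs ▸ hocc, fun i => abs_le.1 (hq1 i).le⟩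
  have hval := hloc q hq hq1
  rw [hqs] at hval
  by_cases hint : ∀ i, |g q i| < 1
  swap
  · push Not at hint
    obtain ⟨i, hi⟩ := hint
    have hi1 : |g q i| = 1 := le_antisymm (abs_le.2 (h2 hq i)) hi
    rw [Finset.prod_eq_zero (Finset.mem_univ i) (by rw [if_pos hi1])] at hval
    rw [hval, ind_false, mul_zero]
    intro hfull
    rw [eul_of_full hfull] at hval
    exact pow_ne_zero _ (by norm_num) hval
  -- If the image under g is interior, nearby points must also have interior images. A change of ψ
  -- across some free direction would give a nearby point with Euler characteristic 0. This replaces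
  -- an appeal to invariance of domain.
  have hfull : Full ψ σ := by
    refine full_of_flip hocc fun ξ j hξ hψ hσj => ?_
    by_contra hno
    -- This direction leads from q into the common facet of the cubes of ξ and of its flip in j,
    -- away from all other coordinate hyperplanes.
    let v : Fin n → ℝ := fun i => if i = j then 0 else ((bsgn (ξ i) : SignType) : ℝ)
    have hv : sgnv v = update (fun i => bsgn (ξ i)) j 0 := by
      funext i
      by_cases hi : i = j
      · subst hi; simp [sgnv, v]
      · simp only [sgnv, v, hi, if_false, update_of_ne, Ne, not_false_eq_true]
        cases ξ i <;> simp [bsgn]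
    have hov : ov σ (sgnv v) = update (fun i => bsgn (ξ i)) j 0 := by
      funext i
      rw [hv]
      by_cases hi : σ i = 0
      · simp [ov, hi]
      · have hij : i ≠ j := by rintro rfl; exact hi hσj
        have := hξ i
        simp only [ov, hi, if_false, update_of_ne hij]
        rcases (σ i).trichotomy with h | h | h
        · rw [h, this.2 h]; rfl
        · exact (hi h).elim
        · rw [h, this.1 h]; rfl
    have hc : ∀ b, ∀ η, Compat (update (update (fun i => bsgn (ξ i)) j 0) j (bsgn b)) η ↔
        η = update ξ j b := by
      intro b η
      rw [compat_update_bsgn, update_idem]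
      constructor
      · rintro ⟨h4, h5⟩
        funext i
        by_cases hi : i = j
        · subst hi; simpa using h4
        · have := h5 i
          rw [update_of_ne hi] at this ⊢
          cases h6 : ξ i <;> simp_all [bsgn]
      · rintro rfl
        refine ⟨by simp, fun i => ?_⟩
        by_cases hi : i = j
        · subst hi; simp
        · rw [update_of_ne hi, update_of_ne hi]
          cases ξ i <;> simp [bsgn]
    have hocc1 : Occ ψ (update (update (fun i => bsgn (ξ i)) j 0) j (bsgn (ξ j))) :=
      ⟨ξ, (hc _ _).2 (by simp), hψ⟩
    have hocc2 : ¬Occ ψ (update (update (fun i => bsgn (ξ i)) j 0) j (bsgn (!ξ j))) := by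
      rintro ⟨η, h4, h5⟩
      rw [hc] at h4
      exact hno (h4 ▸ h5)
    have hvt : v ∈ tanCone (cubeUnion ψ) q := by
      rw [mem_tanCone_cubeUnion hq1, hqs, hov]
      obtain ⟨ξ', h3, h4⟩ := hocc1
      refine ⟨ξ', ?_, h4⟩
      have := (compat_update_bsgn.1 h3).2
      rwa [update_idem] at this
    have hzero : eul ψ (ov σ (sgnv v)) = 0 := by
      rw [hov]
      refine eul_eq_zero_of_edge (b := ξ j) (by simp) hocc1 hocc2 fun i hi => ?_
      rw [update_of_ne hi]
      exact bsgn_ne_zero _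
    have hvt' : ∀ᶠ t in 𝓝[>] (0 : ℝ), q + t • v ∈ cubeUnion ψ := hvt
    obtain ⟨t, ⟨⟨⟨h4, h5⟩, h6⟩, h7⟩, h8⟩ := ((((hg'.eventually_eq hvt).and hvt').and
      (eventually_sgnv q v)).and (eventually_abs_lt_one (v := v) hq1)).and
      (eventually_abs_lt_one (v := tanMap g q v) hint) |>.exists
    have := hloc _ h5 h7
    rw [h6, hqs, hzero, h4] at this
    refine Finset.prod_ne_zero_iff.2 (fun i _ => ?_) this.symm
    rw [if_neg (h8 i).ne]
    norm_num
  rw [ind_true hfull, mul_one, eul_of_full hfull]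

theorem isRegular_of_isClosedPLBall {n : ℕ} {ψ : (Fin n → Bool) → Bool}
    (h : IsClosedPLBall n (cubeUnion ψ)) : BoolFun.IsRegular ψ :=
  (BoolFun.isRegular_iff_hReg ψ).2 (eReg_of_isClosedPLBall h).hReg


open Function

/-! ### Maps that are linear on polyhedral cones -/

section ConicalPL

variable {E F G : Type*} [AddCommGroup E] [Module ℝ E] [AddCommGroup F] [Module ℝ F]
  [AddCommGroup G] [Module ℝ G]

/-- The polyhedral cone defined by a finite set of linear inequalities. -/
def hCone (A : Finset (E →ₗ[ℝ] ℝ)) : Set E := {x | ∀ l ∈ A, 0 ≤ l x}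

/-- `f` is linear on each of finitely many polyhedral cones with union `X`. -/
def IsCPLOn (f : E → F) (X : Set E) : Prop :=
  ∃ S : Set (Finset (E →ₗ[ℝ] ℝ)), S.Finite ∧ X = ⋃ A ∈ S, hCone A ∧
    ∀ A ∈ S, ∃ g : E →ₗ[ℝ] F, Set.EqOn f g (hCone A)

/-- A finite union of polyhedral cones. -/
def IsPCone (X : Set E) : Prop := IsCPLOn (id : E → E) X

lemma IsCPLOn.congr {f g : E → F} {X : Set E} (h : IsCPLOn f X) (hfg : Set.EqOn g f X) :
    IsCPLOn g X := by
  obtain ⟨S, hS, hX, hf⟩ := h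
  refine ⟨S, hS, hX, fun A hA => ?_⟩
  obtain ⟨l, hl⟩ := hf A hA
  refine ⟨l, fun x hx => ?_⟩
  rw [hfg (hX ▸ Set.mem_biUnion hA hx), hl hx]

lemma IsCPLOn.isPCone {f : E → F} {X : Set E} (h : IsCPLOn f X) : IsPCone X := by
  obtain ⟨S, hS, hX, hf⟩ := h
  exact ⟨S, hS, hX, fun A _ => ⟨LinearMap.id, fun _ _ => rfl⟩⟩

lemma IsPCone.isCPLOn {X : Set E} (h : IsPCone X) (g : E →ₗ[ℝ] F) : IsCPLOn g X := by
  obtain ⟨S, hS, hX, hf⟩ := h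
  exact ⟨S, hS, hX, fun A _ => ⟨g, fun _ _ => rfl⟩⟩

lemma IsCPLOn.union {f : E → F} {X Y : Set E} (hX : IsCPLOn f X) (hY : IsCPLOn f Y) :
    IsCPLOn f (X ∪ Y) := by
  obtain ⟨S, hS, hX, hf⟩ := hX
  obtain ⟨T, hT, hY, hg⟩ := hY
  refine ⟨S ∪ T, hS.union hT, ?_, ?_⟩
  · rw [hX, hY, Set.biUnion_union]
  · rintro A (hA | hA)
    · exact hf A hA
    · exact hg A hA

lemma hCone_union [DecidableEq (E →ₗ[ℝ] ℝ)] (A B : Finset (E →ₗ[ℝ] ℝ)) :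
    hCone (A ∪ B) = hCone A ∩ hCone B := by
  ext x
  simp only [hCone, Finset.mem_union, Set.mem_ofPred_eq, Set.mem_inter_iff]
  exact ⟨fun h => ⟨fun l hl => h l (Or.inl hl), fun l hl => h l (Or.inr hl)⟩,
    fun h l hl => hl.elim (h.1 l) (h.2 l)⟩

lemma IsCPLOn.comp {f : E → F} {h : F → G} {X : Set E} {Y : Set F} (hh : IsCPLOn h Y)
    (hf : IsCPLOn f X) (hm : Set.MapsTo f X Y) : IsCPLOn (h ∘ f) X := by
  classical
  obtain ⟨S, hS, hX, hf⟩ := hf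
  obtain ⟨T, hT, hY, hh⟩ := hh
  choose! g hg using hf
  choose! k hk using hh
  have hmem : ∀ A B x, x ∈ hCone (A ∪ B.image fun l => l.comp (g A)) ↔
      x ∈ hCone A ∧ g A x ∈ hCone B := by
    intro A B x
    rw [hCone_union]
    simp [hCone]
  refine ⟨Set.image2 (fun A B => A ∪ B.image fun l => l.comp (g A)) S T, hS.image2 _ hT, ?_, ?_⟩
  · ext x
    simp only [Set.mem_iUnion, exists_prop]
    constructor
    · intro hx
      have hfx := hm hx
      rw [hX] at hx
      rw [hY] at hfx
      simp only [Set.mem_iUnion, exists_prop] at hx hfx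
      obtain ⟨A, hA, hx⟩ := hx
      obtain ⟨B, hB, hfx⟩ := hfx
      exact ⟨_, Set.mem_image2_of_mem hA hB, (hmem A B x).2 ⟨hx, hg A hA hx ▸ hfx⟩⟩
    · rintro ⟨_, ⟨A, hA, B, hB, rfl⟩, hx⟩
      rw [hX]
      exact Set.mem_biUnion hA ((hmem A B x).1 hx).1
  · rintro _ ⟨A, hA, B, hB, rfl⟩
    refine ⟨(k B).comp (g A), fun x hx => ?_⟩
    obtain ⟨h1, h2⟩ := (hmem A B x).1 hx
    rw [comp_apply, hg A hA h1, hk B hB h2, LinearMap.comp_apply]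

lemma IsCPLOn.inter {f : E → F} {X Y : Set E} (hX : IsCPLOn f X) (hY : IsPCone Y) :
    IsCPLOn f (X ∩ Y) := by
  classical
  obtain ⟨S, hS, hX, hf⟩ := hX
  obtain ⟨T, hT, hY, -⟩ := hY
  refine ⟨Set.image2 (· ∪ ·) S T, hS.image2 _ hT, ?_, ?_⟩
  · ext x
    simp only [hX, hY, Set.mem_inter_iff, Set.mem_iUnion, exists_prop]
    constructor
    · rintro ⟨⟨A, hA, h1⟩, B, hB, h2⟩
      exact ⟨_, Set.mem_image2_of_mem hA hB, by rw [hCone_union]; exact ⟨h1, h2⟩⟩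
    · rintro ⟨_, ⟨A, hA, B, hB, rfl⟩, hx⟩
      rw [hCone_union] at hx
      exact ⟨⟨A, hA, hx.1⟩, B, hB, hx.2⟩
  · rintro _ ⟨A, hA, B, hB, rfl⟩
    obtain ⟨g, hg⟩ := hf A hA
    refine ⟨g, fun x hx => hg ?_⟩
    rw [hCone_union] at hx
    exact hx.1

lemma IsCPLOn.mono {f : E → F} {X Y : Set E} (hX : IsCPLOn f X) (hY : IsPCone Y) (h : Y ⊆ X) :
    IsCPLOn f Y := by
  have := hX.inter hY
  rwa [Set.inter_eq_right.2 h] at this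

lemma IsPCone.inter {X Y : Set E} (hX : IsPCone X) (hY : IsPCone Y) : IsPCone (X ∩ Y) :=
  IsCPLOn.inter hX hY

lemma IsPCone.union {X Y : Set E} (hX : IsPCone X) (hY : IsPCone Y) : IsPCone (X ∪ Y) :=
  IsCPLOn.union hX hY

lemma isPCone_univ : IsPCone (Set.univ : Set E) :=
  ⟨{∅}, Set.finite_singleton _, by simp [hCone], fun _ _ => ⟨LinearMap.id, fun _ _ => rfl⟩⟩

lemma isPCone_empty : IsPCone (∅ : Set E) :=
  ⟨∅, Set.finite_empty, by simp, by simp⟩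

lemma isPCone_nonneg (l : E →ₗ[ℝ] ℝ) : IsPCone {x | 0 ≤ l x} :=
  ⟨{{l}}, Set.finite_singleton _, by simp [hCone], fun _ _ => ⟨LinearMap.id, fun _ _ => rfl⟩⟩

lemma isPCone_nonpos (l : E →ₗ[ℝ] ℝ) : IsPCone {x | l x ≤ 0} := by
  have := isPCone_nonneg (-l)
  simpa using this

lemma isPCone_eq_zero (l : E →ₗ[ℝ] ℝ) : IsPCone {x | l x = 0} := by
  have := (isPCone_nonneg l).inter (isPCone_nonpos l)
  convert this using 1
  ext x
  exact ⟨fun h => ⟨h.ge, h.le⟩, fun h => le_antisymm h.2 h.1⟩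

lemma IsPCone.biInter {κ : Type*} (s : Finset κ) {X : κ → Set E} (h : ∀ i ∈ s, IsPCone (X i)) :
    IsPCone (⋂ i ∈ s, X i) := by
  classical
  induction s using Finset.induction_on with
  | empty => simpa using isPCone_univ
  | insert i s _ ih =>
    rw [Finset.set_biInter_insert]
    exact (h i (by simp)).inter (ih fun k hk => h k (by simp [hk]))

lemma IsPCone.biUnion {κ : Type*} (s : Finset κ) {X : κ → Set E} (h : ∀ i ∈ s, IsPCone (X i)) :
    IsPCone (⋃ i ∈ s, X i) := by
  classical
  induction s using Finset.induction_on with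
  | empty => simpa using isPCone_empty
  | insert i s _ ih =>
    rw [Finset.set_biUnion_insert]
    exact (h i (by simp)).union (ih fun k hk => h k (by simp [hk]))

lemma IsPCone.preimage {Y : Set F} (hY : IsPCone Y) (g : E →ₗ[ℝ] F) : IsPCone (g ⁻¹' Y) := by
  classical
  obtain ⟨T, hT, hY, -⟩ := hY
  refine ⟨(fun B => B.image fun l => l.comp g) '' T, hT.image _, ?_,
    fun _ _ => ⟨LinearMap.id, fun _ _ => rfl⟩⟩
  ext x
  simp [hY, hCone]

lemma IsCPLOn.add {f g : E → F} {X : Set E} (hf : IsCPLOn f X) (hg : IsCPLOn g X) :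
    IsCPLOn (fun x => f x + g x) X := by
  classical
  obtain ⟨S, hS, hX, hf⟩ := hf
  obtain ⟨T, hT, hX', hg⟩ := hg
  refine ⟨Set.image2 (· ∪ ·) S T, hS.image2 _ hT, ?_, ?_⟩
  · ext x
    simp only [Set.mem_iUnion, exists_prop]
    constructor
    · intro hx
      have hx' := hx
      rw [hX] at hx
      rw [hX'] at hx'
      simp only [Set.mem_iUnion, exists_prop] at hx hx'
      obtain ⟨A, hA, h1⟩ := hx
      obtain ⟨B, hB, h2⟩ := hx'
      exact ⟨_, Set.mem_image2_of_mem hA hB, by rw [hCone_union]; exact ⟨h1, h2⟩⟩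
    · rintro ⟨_, ⟨A, hA, B, hB, rfl⟩, hx⟩
      rw [hCone_union] at hx
      rw [hX]
      exact Set.mem_biUnion hA hx.1
  · rintro _ ⟨A, hA, B, hB, rfl⟩
    obtain ⟨k, hk⟩ := hf A hA
    obtain ⟨l, hl⟩ := hg B hB
    refine ⟨k + l, fun x hx => ?_⟩
    rw [hCone_union] at hx
    simp only [hk hx.1, hl hx.2, LinearMap.add_apply]

end ConicalPL

/-! ### Norm-preserving conical isomorphisms, gluing and products with a half-line -/

section ConicalIso

variable {ι : Type*} [Fintype ι]

/-- A norm-preserving conical PL homeomorphism, for the supremum norm. -/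
structure CIso (X Y : Set (ι → ℝ)) where
  f : (ι → ℝ) → ι → ℝ
  g : (ι → ℝ) → ι → ℝ
  cplf : IsCPLOn f X
  cplg : IsCPLOn g Y
  mapsf : Set.MapsTo f X Y
  mapsg : Set.MapsTo g Y X
  left : Set.LeftInvOn g f X
  right : Set.LeftInvOn f g Y
  norm : ∀ x ∈ X, ‖f x‖ = ‖x‖

namespace CIso

variable {X Y Z W C D : Set (ι → ℝ)}

/-- The isomorphism `e` restricts to an isomorphism from `C` to `D`. -/
structure Carries (e : CIso X Y) (C D : Set (ι → ℝ)) : Prop where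
  subf : C ⊆ X
  subg : D ⊆ Y
  mapsf : Set.MapsTo e.f C D
  mapsg : Set.MapsTo e.g D C

/-- The identity. -/
def refl (hX : IsPCone X) : CIso X X where
  f := id
  g := id
  cplf := hX
  cplg := hX
  mapsf := Set.mapsTo_id _
  mapsg := Set.mapsTo_id _
  left _ _ := rfl
  right _ _ := rfl
  norm _ _ := rfl

/-- The inverse isomorphism. -/
def symm (e : CIso X Y) : CIso Y X where
  f := e.g
  g := e.f
  cplf := e.cplg
  cplg := e.cplf
  mapsf := e.mapsg
  mapsg := e.mapsf
  left := e.right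
  right := e.left
  norm y hy := by rw [← e.norm _ (e.mapsg hy), e.right hy]

/-- Composition of isomorphisms. -/
def trans (e : CIso X Y) (e' : CIso Y Z) : CIso X Z where
  f := e'.f ∘ e.f
  g := e.g ∘ e'.g
  cplf := e'.cplf.comp e.cplf e.mapsf
  cplg := e.cplg.comp e'.cplg e'.mapsg
  mapsf := e'.mapsf.comp e.mapsf
  mapsg := e.mapsg.comp e'.mapsg
  left x hx := by simp only [comp_apply]; rw [e'.left (e.mapsf hx), e.left hx]
  right x hx := by simp only [comp_apply]; rw [e.right (e'.mapsg hx), e'.right hx]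
  norm x hx := by rw [comp_apply, e'.norm _ (e.mapsf hx), e.norm x hx]

/-- Restriction of an isomorphism. -/
def restrict (e : CIso X Y) (h : e.Carries C D) (hC : IsPCone C) (hD : IsPCone D) : CIso C D where
  f := e.f
  g := e.g
  cplf := e.cplf.mono hC h.subf
  cplg := e.cplg.mono hD h.subg
  mapsf := h.mapsf
  mapsg := h.mapsg
  left _ hx := e.left (h.subf hx)
  right _ hx := e.right (h.subg hx)
  norm x hx := e.norm x (h.subf hx)

/-- A pair of mutually inverse linear maps. -/
def ofLinear (L M : (ι → ℝ) →ₗ[ℝ] (ι → ℝ)) (hX : IsPCone X) (hY : IsPCone Y)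
    (h1 : Set.MapsTo L X Y) (h2 : Set.MapsTo M Y X) (h3 : ∀ x, M (L x) = x) (h4 : ∀ x, L (M x) = x)
    (h5 : ∀ x, ‖L x‖ = ‖x‖) : CIso X Y where
  f := L
  g := M
  cplf := hX.isCPLOn L
  cplg := hY.isCPLOn M
  mapsf := h1
  mapsg := h2
  left _ _ := h3 _
  right _ _ := h4 _
  norm x _ := h5 x

open Classical in
/-- Two isomorphisms that agree on the common part of their domains, and whose inverses agree,
have a common extension. -/
noncomputable def glue (e : CIso X Y) (e' : CIso Z W) (h1 : Set.EqOn e.f e'.f (X ∩ Z))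
    (h2 : Set.EqOn e.g e'.g (Y ∩ W)) : CIso (X ∪ Z) (Y ∪ W) :=
  have hf : Set.EqOn (X.piecewise e.f e'.f) e'.f Z := fun x hx => by
    by_cases h : x ∈ X
    · rw [Set.piecewise_eq_of_mem _ _ _ h, h1 ⟨h, hx⟩]
    · rw [Set.piecewise_eq_of_notMem _ _ _ h]
  have hg : Set.EqOn (Y.piecewise e.g e'.g) e'.g W := fun x hx => by
    by_cases h : x ∈ Y
    · rw [Set.piecewise_eq_of_mem _ _ _ h, h2 ⟨h, hx⟩]
    · rw [Set.piecewise_eq_of_notMem _ _ _ h]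
  have hf' : Set.EqOn (X.piecewise e.f e'.f) e.f X := Set.piecewise_eqOn _ _ _
  have hg' : Set.EqOn (Y.piecewise e.g e'.g) e.g Y := Set.piecewise_eqOn _ _ _
  { f := X.piecewise e.f e'.f
    g := Y.piecewise e.g e'.g
    cplf := (e.cplf.congr hf').union (e'.cplf.congr hf)
    cplg := (e.cplg.congr hg').union (e'.cplg.congr hg)
    mapsf := by
      rintro x (hx | hx)
      · rw [hf' hx]; exact Or.inl (e.mapsf hx)
      · rw [hf hx]; exact Or.inr (e'.mapsf hx)
    mapsg := by
      rintro x (hx | hx)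
      · rw [hg' hx]; exact Or.inl (e.mapsg hx)
      · rw [hg hx]; exact Or.inr (e'.mapsg hx)
    left := by
      rintro x (hx | hx)
      · rw [hf' hx, hg' (e.mapsf hx), e.left hx]
      · rw [hf hx, hg (e'.mapsf hx), e'.left hx]
    right := by
      rintro x (hx | hx)
      · rw [hg' hx, hf' (e.mapsg hx), e.right hx]
      · rw [hg hx, hf (e'.mapsg hx), e'.right hx]
    norm := by
      rintro x (hx | hx)
      · rw [hf' hx, e.norm x hx]
      · rw [hf hx, e'.norm x hx] }

section Glue

variable {e : CIso X Y} {e' : CIso Z W} {h1 : Set.EqOn e.f e'.f (X ∩ Z)}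
  {h2 : Set.EqOn e.g e'.g (Y ∩ W)}

lemma glue_f_left : Set.EqOn (e.glue e' h1 h2).f e.f X := by
  classical exact Set.piecewise_eqOn _ _ _

lemma glue_g_left : Set.EqOn (e.glue e' h1 h2).g e.g Y := by
  classical exact Set.piecewise_eqOn _ _ _

lemma glue_f_right : Set.EqOn (e.glue e' h1 h2).f e'.f Z := fun x hx => by
  by_cases h : x ∈ X
  · rw [glue_f_left h, h1 ⟨h, hx⟩]
  · classical exact Set.piecewise_eq_of_notMem _ _ _ h

lemma glue_g_right : Set.EqOn (e.glue e' h1 h2).g e'.g W := fun x hx => by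
  by_cases h : x ∈ Y
  · rw [glue_g_left h, h2 ⟨h, hx⟩]
  · classical exact Set.piecewise_eq_of_notMem _ _ _ h

end Glue

lemma Carries.trans {e : CIso X Y} {e' : CIso Y Z} {C' : Set (ι → ℝ)} (h : e.Carries C D)
    (h' : e'.Carries D C') : (e.trans e').Carries C C' :=
  ⟨h.subf, h'.subg, h'.mapsf.comp h.mapsf, h.mapsg.comp h'.mapsg⟩

lemma Carries.of_eqOn {e : CIso X Y} (u : CIso C D) (hC : C ⊆ X) (hD : D ⊆ Y)
    (h1 : Set.EqOn e.f u.f C) (h2 : Set.EqOn e.g u.g D) : e.Carries C D :=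
  ⟨hC, hD, fun x hx => by rw [h1 hx]; exact u.mapsf hx, fun x hx => by rw [h2 hx]; exact u.mapsg hx⟩

lemma Carries.union {e : CIso X Y} {C' D' : Set (ι → ℝ)} (h : e.Carries C D)
    (h' : e.Carries C' D') : e.Carries (C ∪ C') (D ∪ D') :=
  ⟨Set.union_subset h.subf h'.subf, Set.union_subset h.subg h'.subg,
    h.mapsf.union_union h'.mapsf, h.mapsg.union_union h'.mapsg⟩

end CIso

variable [DecidableEq ι]

/-- The projection along the `j`-th coordinate. -/
def drop (j : ι) : (ι → ℝ) →ₗ[ℝ] (ι → ℝ) :=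
  LinearMap.id - (LinearMap.single ℝ (fun _ : ι => ℝ) j).comp (LinearMap.proj j)

omit [Fintype ι] in
lemma drop_self (j : ι) (x : ι → ℝ) : drop j x j = 0 := by simp [drop]

omit [Fintype ι] in
lemma drop_of_ne {i j : ι} (h : i ≠ j) (x : ι → ℝ) : drop j x i = x i := by
  simp [drop, h]

omit [Fintype ι] in
lemma drop_eq_self {j : ι} {x : ι → ℝ} (h : x j = 0) : drop j x = x := by
  simp [drop, h]

omit [Fintype ι] in
lemma single_add_drop (j : ι) (x : ι → ℝ) : Pi.single j (x j) + drop j x = x := by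
  simp [drop]

omit [Fintype ι] in
lemma drop_single_add {j : ι} {x : ι → ℝ} (h : x j = 0) (a : ℝ) :
    drop j (Pi.single j a + x) = x := by
  funext i
  by_cases hi : i = j
  · subst hi; rw [drop_self, h]
  · rw [drop_of_ne hi]; simp [hi]

lemma norm_single_add {j : ι} {x : ι → ℝ} (h : x j = 0) (a : ℝ) :
    ‖(Pi.single j a + x : ι → ℝ)‖ = max |a| ‖x‖ := by
  apply le_antisymm
  · refine (pi_norm_le_iff_of_nonneg (by positivity)).2 fun i => ?_
    by_cases hi : i = j
    · subst hi; simp [h]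
    · simp only [Pi.add_apply, Pi.single_eq_of_ne hi, zero_add]
      exact (norm_le_pi_norm x i).trans (le_max_right _ _)
  · refine max_le ?_ ((pi_norm_le_iff_of_nonneg (norm_nonneg _)).2 fun i => ?_)
    · have := norm_le_pi_norm (Pi.single j a + x : ι → ℝ) j
      simpa [h] using this
    · by_cases hi : i = j
      · subst hi; simp [h]
      · have := norm_le_pi_norm (Pi.single j a + x : ι → ℝ) i
        simpa [hi] using this

/-- The product of `Z` with a half-line in the direction `j`. -/
def plusSet (j : ι) (Z : Set (ι → ℝ)) : Set (ι → ℝ) := {x | 0 ≤ x j ∧ drop j x ∈ Z}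

omit [Fintype ι] in
lemma IsPCone.plusSet {Z : Set (ι → ℝ)} (hZ : IsPCone Z) (j : ι) : IsPCone (plusSet j Z) :=
  (isPCone_nonneg (LinearMap.proj (R := ℝ) (φ := fun _ : ι => ℝ) j)).inter (hZ.preimage (drop j))

omit [Fintype ι] in
lemma plusSet_mono {j : ι} {C Z : Set (ι → ℝ)} (h : C ⊆ Z) : plusSet j C ⊆ plusSet j Z :=
  fun _ hx => ⟨hx.1, h hx.2⟩

omit [Fintype ι] in
lemma subset_plusSet {j : ι} {Z : Set (ι → ℝ)} (hZ : ∀ x ∈ Z, x j = 0) : Z ⊆ plusSet j Z :=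
  fun x hx => ⟨(hZ x hx).ge, by rwa [drop_eq_self (hZ x hx)]⟩

namespace CIso

variable {X Y Z W C D : Set (ι → ℝ)}

lemma cpl_plus (e : CIso X Y) (j : ι) :
    IsCPLOn (fun x => Pi.single j (x j) + e.f (drop j x)) (plusSet j X) := by
  have hP := e.cplf.isPCone.plusSet j
  refine (hP.isCPLOn ((LinearMap.single ℝ (fun _ : ι => ℝ) j).comp (LinearMap.proj j))).add ?_
  exact e.cplf.comp (hP.isCPLOn (drop j)) fun x hx => hx.2

/-- The product of an isomorphism with the identity of a half-line in the direction `j`. -/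
def plus (e : CIso X Y) (j : ι) (hX : ∀ x ∈ X, x j = 0) (hY : ∀ x ∈ Y, x j = 0) :
    CIso (plusSet j X) (plusSet j Y) where
  f x := Pi.single j (x j) + e.f (drop j x)
  g x := Pi.single j (x j) + e.g (drop j x)
  cplf := e.cpl_plus j
  cplg := e.symm.cpl_plus j
  mapsf x hx := by
    have h := e.mapsf hx.2
    refine ⟨?_, ?_⟩
    · simp only [Pi.add_apply, Pi.single_eq_same, hY _ h, add_zero]; exact hx.1
    · rw [drop_single_add (hY _ h)]; exact h
  mapsg x hx := by
    have h := e.mapsg hx.2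
    refine ⟨?_, ?_⟩
    · simp only [Pi.add_apply, Pi.single_eq_same, hX _ h, add_zero]; exact hx.1
    · rw [drop_single_add (hX _ h)]; exact h
  left x hx := by
    have h := hY _ (e.mapsf hx.2)
    simp only [drop_single_add h, Pi.add_apply, Pi.single_eq_same, h, add_zero]
    rw [e.left hx.2, single_add_drop]
  right x hx := by
    have h := hX _ (e.mapsg hx.2)
    simp only [drop_single_add h, Pi.add_apply, Pi.single_eq_same, h, add_zero]
    rw [e.right hx.2, single_add_drop]
  norm x hx := by
    rw [norm_single_add (hY _ (e.mapsf hx.2)), e.norm _ hx.2, ← norm_single_add (drop_self j x),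
      single_add_drop]

section Plus

variable {e : CIso X Y} {j : ι} {hX : ∀ x ∈ X, x j = 0} {hY : ∀ x ∈ Y, x j = 0}

lemma plus_f_eqOn : Set.EqOn (e.plus j hX hY).f e.f X := fun x hx => by
  change Pi.single j (x j) + e.f (drop j x) = e.f x
  rw [drop_eq_self (hX x hx), hX x hx, Pi.single_zero, zero_add]

lemma plus_g_eqOn : Set.EqOn (e.plus j hX hY).g e.g Y := fun x hx => by
  change Pi.single j (x j) + e.g (drop j x) = e.g x
  rw [drop_eq_self (hY x hx), hY x hx, Pi.single_zero, zero_add]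

lemma Carries.plus (h : e.Carries C D) : (e.plus j hX hY).Carries (plusSet j C) (plusSet j D) := by
  refine ⟨plusSet_mono h.subf, plusSet_mono h.subg, fun x hx => ?_, fun x hx => ?_⟩
  · have h' := h.mapsf hx.2
    refine ⟨?_, ?_⟩
    · change 0 ≤ (Pi.single j (x j) + e.f (drop j x) : ι → ℝ) j
      simp only [Pi.add_apply, Pi.single_eq_same, hY _ (h.subg h'), add_zero]; exact hx.1
    · change drop j (Pi.single j (x j) + e.f (drop j x)) ∈ D
      rw [drop_single_add (hY _ (h.subg h'))]; exact h'
  · have h' := h.mapsg hx.2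
    refine ⟨?_, ?_⟩
    · change 0 ≤ (Pi.single j (x j) + e.g (drop j x) : ι → ℝ) j
      simp only [Pi.add_apply, Pi.single_eq_same, hX _ (h.subf h'), add_zero]; exact hx.1
    · change drop j (Pi.single j (x j) + e.g (drop j x)) ∈ C
      rw [drop_single_add (hX _ (h.subf h'))]; exact h'

end Plus

end CIso

end ConicalIso


open Function

/-! ### Half-spaces as models of balls -/

section Models

variable {ι : Type*}

/-- The coordinate subspace spanned by the directions in `S`. -/
def coordSpace (S : Finset ι) : Set (ι → ℝ) := {x | ∀ i, i ∉ S → x i = 0}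

/-- The half-space of a coordinate subspace where the coordinate `z` is nonnegative. -/
def halfSpace (S : Finset ι) (z : ι) : Set (ι → ℝ) := {x | x ∈ coordSpace S ∧ 0 ≤ x z}

/-- The boundary hyperplane of `halfSpace S z`. -/
def wall (S : Finset ι) (z : ι) : Set (ι → ℝ) := {x | x ∈ coordSpace S ∧ x z = 0}

variable [Fintype ι]

lemma isPCone_coordSpace (S : Finset ι) : IsPCone (coordSpace S) := by
  classical
  have : coordSpace S = ⋂ i ∈ Sᶜ, {x : ι → ℝ | LinearMap.proj (R := ℝ) (φ := fun _ : ι => ℝ) i x = 0} := by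
    ext x
    simp [coordSpace]
  rw [this]
  exact IsPCone.biInter _ fun i _ => isPCone_eq_zero _

lemma isPCone_halfSpace (S : Finset ι) (z : ι) : IsPCone (halfSpace S z) :=
  (isPCone_coordSpace S).inter
    (isPCone_nonneg (LinearMap.proj (R := ℝ) (φ := fun _ : ι => ℝ) z))

lemma isPCone_wall (S : Finset ι) (z : ι) : IsPCone (wall S z) :=
  (isPCone_coordSpace S).inter
    (isPCone_eq_zero (LinearMap.proj (R := ℝ) (φ := fun _ : ι => ℝ) z))

/-- The pair `(B, C)` is isomorphic to a half-space and its boundary. -/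
def IsBall (S : Finset ι) (z : ι) (B C : Set (ι → ℝ)) : Prop :=
  ∃ e : CIso B (halfSpace S z), e.Carries C (wall S z)

lemma IsBall.of_iso {S : Finset ι} {z : ι} {B C B' C' : Set (ι → ℝ)} (h : IsBall S z B C)
    (e : CIso B' B) (he : e.Carries C' C) : IsBall S z B' C' := by
  obtain ⟨u, hu⟩ := h
  exact ⟨e.trans u, he.trans hu⟩

lemma isBall_halfSpace (S : Finset ι) (z : ι) : IsBall S z (halfSpace S z) (wall S z) :=
  ⟨CIso.refl (isPCone_halfSpace S z), fun _ hx => ⟨hx.1, hx.2.ge⟩, fun _ hx => ⟨hx.1, hx.2.ge⟩,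
    Set.mapsTo_id _, Set.mapsTo_id _⟩

variable [DecidableEq ι]

omit [Fintype ι] in
lemma plusSet_wall {S : Finset ι} {z : ι} (hz : z ∈ S) : plusSet z (wall S z) = halfSpace S z := by
  ext x
  simp only [plusSet, wall, halfSpace, coordSpace, Set.mem_ofPred_eq]
  constructor
  · rintro ⟨h1, h2, -⟩
    refine ⟨fun i hi => ?_, h1⟩
    have hiz : i ≠ z := by rintro rfl; exact hi hz
    rw [← h2 i hi, drop_of_ne hiz]
  · rintro ⟨h1, h2⟩
    refine ⟨h2, fun i hi => ?_, drop_self _ _⟩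
    have hiz : i ≠ z := by rintro rfl; exact hi hz
    rw [drop_of_ne hiz, h1 i hi]

/-- Isomorphisms between the boundaries of two balls extend to the balls. -/
theorem IsBall.extend {S : Finset ι} {z : ι} (hz : z ∈ S) {B C B' C' : Set (ι → ℝ)}
    (h : IsBall S z B C) (h' : IsBall S z B' C') (u : CIso C C') :
    ∃ U : CIso B B', Set.EqOn U.f u.f C ∧ Set.EqOn U.g u.g C' := by
  obtain ⟨e, he⟩ := h
  obtain ⟨e', he'⟩ := h'
  have hw := isPCone_wall S z
  -- Read in the two charts, the boundary isomorphism becomes an automorphism of the wall, and the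
  -- half-space is the product of the wall with a half-line.
  let v : CIso (wall S z) (wall S z) :=
    ((e.restrict he u.cplf.isPCone hw).symm.trans u).trans (e'.restrict he' u.cplg.isPCone hw)
  have hext : ∃ W : CIso (halfSpace S z) (halfSpace S z),
      Set.EqOn W.f v.f (wall S z) ∧ Set.EqOn W.g v.g (wall S z) := by
    rw [← plusSet_wall hz]
    exact ⟨v.plus z (fun x hx => hx.2) (fun x hx => hx.2), CIso.plus_f_eqOn, CIso.plus_g_eqOn⟩
  obtain ⟨W, hW1, hW2⟩ := hext
  refine ⟨(e.trans W).trans e'.symm, fun x hx => ?_, fun x hx => ?_⟩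
  · change e'.g (W.f (e.f x)) = u.f x
    rw [hW1 (he.mapsf hx)]
    change e'.g (e'.f (u.f (e.g (e.f x)))) = u.f x
    rw [e.left (he.subf hx), e'.left (he'.subf (u.mapsf hx))]
  · change e.g (W.g (e'.f x)) = u.g x
    rw [hW2 (he'.mapsf hx)]
    change e.g (e.f (u.g (e'.g (e'.f x)))) = u.g x
    rw [e'.left (he'.subf hx), e.left (he.subf (u.mapsg hx))]

omit [DecidableEq ι] in
lemma norm_comp_perm (σ : Equiv.Perm ι) (x : ι → ℝ) : ‖x ∘ σ‖ = ‖x‖ := by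
  apply le_antisymm
  · exact (pi_norm_le_iff_of_nonneg (norm_nonneg _)).2 fun i => norm_le_pi_norm x (σ i)
  · refine (pi_norm_le_iff_of_nonneg (norm_nonneg _)).2 fun i => ?_
    have := norm_le_pi_norm (x ∘ σ) (σ.symm i)
    simpa using this

/-- The isomorphism that exchanges two coordinates. -/
def CIso.swap (i j : ι) {X Y : Set (ι → ℝ)} (hX : IsPCone X) (hY : IsPCone Y)
    (h1 : ∀ x ∈ X, x ∘ Equiv.swap i j ∈ Y) (h2 : ∀ y ∈ Y, y ∘ Equiv.swap i j ∈ X) : CIso X Y :=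
  CIso.ofLinear (LinearMap.funLeft ℝ ℝ (Equiv.swap i j)) (LinearMap.funLeft ℝ ℝ (Equiv.swap i j))
    hX hY h1 h2 (fun x => by ext k; simp [LinearMap.funLeft_apply])
    (fun x => by ext k; simp [LinearMap.funLeft_apply]) (norm_comp_perm _)

lemma isBall_swap {S T : Finset ι} {z j : ι} (hST : ∀ i, i ∈ T ↔ Equiv.swap z j i ∈ S) :
    IsBall S z (halfSpace T j) (wall T j) := by
  have hTS : ∀ i, Equiv.swap z j i ∈ T ↔ i ∈ S := fun i => by rw [hST, Equiv.swap_apply_self]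
  refine ⟨CIso.swap z j (isPCone_halfSpace _ _) (isPCone_halfSpace _ _) ?_ ?_,
    fun _ hx => ⟨hx.1, hx.2.ge⟩, fun _ hx => ⟨hx.1, hx.2.ge⟩, ?_, ?_⟩
  · rintro x ⟨h1, h2⟩
    exact ⟨fun i hi => h1 _ (by rwa [hTS]), by simpa using h2⟩
  · rintro x ⟨h1, h2⟩
    exact ⟨fun i hi => h1 _ (by rwa [← hST]), by simpa using h2⟩
  · rintro x ⟨h1, h2⟩
    refine ⟨fun i hi => h1 _ (by rwa [hTS]), ?_⟩
    change x (Equiv.swap z j z) = 0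
    simpa using h2
  · rintro x ⟨h1, h2⟩
    refine ⟨fun i hi => h1 _ (by rwa [← hST]), ?_⟩
    change x (Equiv.swap z j j) = 0
    simpa using h2

/-- The linear reflection in the `j`-th coordinate. -/
def reflect (j : ι) : (ι → ℝ) →ₗ[ℝ] (ι → ℝ) :=
  drop j - (LinearMap.single ℝ (fun _ : ι => ℝ) j).comp (LinearMap.proj j)

omit [Fintype ι] in
lemma reflect_self (j : ι) (x : ι → ℝ) : reflect j x j = - x j := by simp [reflect, drop_self]

omit [Fintype ι] in
lemma reflect_of_ne {i j : ι} (h : i ≠ j) (x : ι → ℝ) : reflect j x i = x i := by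
  simp [reflect, drop_of_ne h, h]

omit [Fintype ι] in
lemma reflect_reflect (j : ι) (x : ι → ℝ) : reflect j (reflect j x) = x := by
  funext i
  by_cases h : i = j
  · subst h; simp [reflect_self]
  · simp [reflect_of_ne h]

omit [Fintype ι] in
lemma reflect_eq_self {j : ι} {x : ι → ℝ} (h : x j = 0) : reflect j x = x := by
  funext i
  by_cases hi : i = j
  · subst hi; simp [reflect_self, h]
  · simp [reflect_of_ne hi]

omit [Fintype ι] in
lemma drop_reflect (j : ι) (x : ι → ℝ) : drop j (reflect j x) = drop j x := by
  funext i
  by_cases hi : i = j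
  · subst hi; simp [drop_self]
  · simp [drop_of_ne hi, reflect_of_ne hi]

lemma norm_reflect (j : ι) (x : ι → ℝ) : ‖reflect j x‖ = ‖x‖ := by
  simp only [Pi.norm_def]
  congr 1
  refine Finset.sup_congr rfl fun i _ => ?_
  by_cases hi : i = j
  · subst hi; simp [reflect_self]
  · simp [reflect_of_ne hi]

/-- The isomorphism given by the reflection in a coordinate. -/
def CIso.reflection (j : ι) {X Y : Set (ι → ℝ)} (hX : IsPCone X) (hY : IsPCone Y)
    (h1 : Set.MapsTo (reflect j) X Y) (h2 : Set.MapsTo (reflect j) Y X) : CIso X Y :=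
  CIso.ofLinear (reflect j) (reflect j) hX hY h1 h2 (reflect_reflect j) (reflect_reflect j)
    (norm_reflect j)

/-! ### Opening a quadrant to a half-plane -/

section Quarter

/-- The first coordinate of a PL map from the quadrant to the upper half-plane. -/
noncomputable def quadFst (s t : ℝ) : ℝ :=
  if 2 * t ≤ s then s else if t ≤ 2 * s then 2 * (s - t) else -t

/-- The second coordinate of a PL map from the quadrant to the upper half-plane. -/
noncomputable def quadSnd (s t : ℝ) : ℝ :=
  if 2 * t ≤ s then 2 * t else if t ≤ s then s else if t ≤ 2 * s then t else 2 * s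

/-- The first coordinate of a PL map from the upper half-plane to the quadrant. -/
noncomputable def halfFst (a b : ℝ) : ℝ :=
  if b ≤ a then a else if 0 ≤ a then b else if -b ≤ a then b + a / 2 else b / 2

/-- The second coordinate of a PL map from the upper half-plane to the quadrant. -/
noncomputable def halfSnd (a b : ℝ) : ℝ :=
  if b ≤ a then b / 2 else if 0 ≤ a then b - a / 2 else if -b ≤ a then b else -a

/-- Apply a map of the plane to the coordinates `z`, `j`. -/
def planar (z j : ι) (F G : ℝ → ℝ → ℝ) (x : ι → ℝ) : ι → ℝ :=
  fun i => if i = z then F (x z) (x j) else if i = j then G (x z) (x j) else x i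

omit [Fintype ι] in
lemma planar_fst (z j : ι) (F G : ℝ → ℝ → ℝ) (x : ι → ℝ) : planar z j F G x z = F (x z) (x j) := by
  simp [planar]

omit [Fintype ι] in
lemma planar_snd {z j : ι} (h : z ≠ j) (F G : ℝ → ℝ → ℝ) (x : ι → ℝ) :
    planar z j F G x j = G (x z) (x j) := by
  simp [planar, h.symm]

omit [Fintype ι] in
lemma planar_of_ne {z j i : ι} (h : i ≠ z) (h' : i ≠ j) (F G : ℝ → ℝ → ℝ) (x : ι → ℝ) :
    planar z j F G x i = x i := by
  simp [planar, h, h']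

omit [Fintype ι] in
lemma IsPCone.isCPLOn_planar {X : Set (ι → ℝ)} (hX : IsPCone X) (z j : ι) {F G : ℝ → ℝ → ℝ}
    (c c' d d' : ℝ) (h : ∀ x ∈ X, F (x z) (x j) = c * x z + c' * x j ∧
      G (x z) (x j) = d * x z + d' * x j) : IsCPLOn (planar z j F G) X := by
  let p : ι → (ι → ℝ) →ₗ[ℝ] ℝ := fun i => LinearMap.proj i
  refine (hX.isCPLOn (LinearMap.pi fun i => if i = z then c • p z + c' • p j else
    if i = j then d • p z + d' • p j else p i)).congr fun x hx => ?_
  funext i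
  rw [LinearMap.pi_apply]
  unfold planar
  split_ifs
  · rw [(h x hx).1]; rfl
  · rw [(h x hx).2]; rfl
  · rfl

lemma IsCPLOn.of_split {E F : Type*} [AddCommGroup E] [Module ℝ E] [AddCommGroup F] [Module ℝ F]
    {f : E → F} {X : Set E} (l : E →ₗ[ℝ] ℝ) (h1 : IsCPLOn f (X ∩ {x | 0 ≤ l x}))
    (h2 : IsCPLOn f (X ∩ {x | l x ≤ 0})) : IsCPLOn f X := by
  have := h1.union h2
  rwa [← Set.inter_union_distrib_left, Set.inter_eq_left.2] at this
  exact fun x _ => le_total 0 (l x)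

-- The rays 2t = s, t = s, t = 2s cut the quadrant into four linear pieces. In the supremum norm,
-- the points (1,0), (1,1/2), (1,1), (1/2,1), (0,1) of the unit arc go to (1,0), (1,1), (0,1),
-- (-1,1), (-1,0) in the coordinates (`quadFst`, `quadSnd`), which parametrize the half-plane with
-- second coordinate nonnegative.
omit [Fintype ι] in
lemma isCPLOn_quad {X : Set (ι → ℝ)} (hX : IsPCone X) {z j : ι}
    (h : ∀ x ∈ X, 0 ≤ x z ∧ 0 ≤ x j) : IsCPLOn (planar z j quadSnd quadFst) X := by
  let p : ι → (ι → ℝ) →ₗ[ℝ] ℝ := fun i => LinearMap.proj i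
  refine IsCPLOn.of_split (p z - 2 • p j) ?_ (IsCPLOn.of_split (p z - p j) ?_
    (IsCPLOn.of_split (2 • p z - p j) ?_ ?_))
  · refine (hX.inter (isPCone_nonneg _)).isCPLOn_planar z j 0 2 1 0 ?_
    rintro x ⟨hx, h1⟩
    obtain ⟨h2, h3⟩ := h x hx
    simp only [p, Set.mem_ofPred_eq, LinearMap.sub_apply, LinearMap.smul_apply, LinearMap.proj_apply,
      nsmul_eq_mul, Nat.cast_ofNat] at h1
    unfold quadSnd quadFst
    constructor <;> split_ifs <;> linarith
  · refine ((hX.inter (isPCone_nonpos _)).inter (isPCone_nonneg _)).isCPLOn_planar z j 1 0 2 (-2) ?_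
    rintro x ⟨⟨hx, h1⟩, h4⟩
    obtain ⟨h2, h3⟩ := h x hx
    simp only [p, Set.mem_ofPred_eq, LinearMap.sub_apply, LinearMap.smul_apply, LinearMap.proj_apply,
      nsmul_eq_mul, Nat.cast_ofNat] at h1 h4
    unfold quadSnd quadFst
    constructor <;> split_ifs <;> linarith
  · refine (((hX.inter (isPCone_nonpos _)).inter (isPCone_nonpos _)).inter
      (isPCone_nonneg _)).isCPLOn_planar z j 0 1 2 (-2) ?_
    rintro x ⟨⟨⟨hx, h1⟩, h4⟩, h5⟩
    obtain ⟨h2, h3⟩ := h x hx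
    simp only [p, Set.mem_ofPred_eq, LinearMap.sub_apply, LinearMap.smul_apply, LinearMap.proj_apply,
      nsmul_eq_mul, Nat.cast_ofNat] at h1 h4 h5
    unfold quadSnd quadFst
    constructor <;> split_ifs <;> linarith
  · refine (((hX.inter (isPCone_nonpos _)).inter (isPCone_nonpos _)).inter
      (isPCone_nonpos _)).isCPLOn_planar z j 2 0 0 (-1) ?_
    rintro x ⟨⟨⟨hx, h1⟩, h4⟩, h5⟩
    obtain ⟨h2, h3⟩ := h x hx
    simp only [p, Set.mem_ofPred_eq, LinearMap.sub_apply, LinearMap.smul_apply, LinearMap.proj_apply,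
      nsmul_eq_mul, Nat.cast_ofNat] at h1 h4 h5
    unfold quadSnd quadFst
    constructor <;> split_ifs <;> linarith

omit [Fintype ι] in
lemma isCPLOn_half {X : Set (ι → ℝ)} (hX : IsPCone X) {z j : ι} (h : ∀ x ∈ X, 0 ≤ x z) :
    IsCPLOn (planar z j (fun b a => halfFst a b) fun b a => halfSnd a b) X := by
  let p : ι → (ι → ℝ) →ₗ[ℝ] ℝ := fun i => LinearMap.proj i
  refine IsCPLOn.of_split (p j - p z) ?_ (IsCPLOn.of_split (p j) ?_
    (IsCPLOn.of_split (p j + p z) ?_ ?_))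
  · refine (hX.inter (isPCone_nonneg _)).isCPLOn_planar z j 0 1 (1 / 2) 0 ?_
    rintro x ⟨hx, h1⟩
    have h2 := h x hx
    simp only [p, Set.mem_ofPred_eq, LinearMap.sub_apply, LinearMap.proj_apply] at h1
    unfold halfFst halfSnd
    constructor <;> split_ifs <;> linarith
  · refine ((hX.inter (isPCone_nonpos _)).inter (isPCone_nonneg _)).isCPLOn_planar z j
      1 0 1 (-1 / 2) ?_
    rintro x ⟨⟨hx, h1⟩, h4⟩
    have h2 := h x hx
    simp only [p, Set.mem_ofPred_eq, LinearMap.sub_apply, LinearMap.proj_apply] at h1 h4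
    unfold halfFst halfSnd
    constructor <;> split_ifs <;> linarith
  · refine (((hX.inter (isPCone_nonpos _)).inter (isPCone_nonpos _)).inter
      (isPCone_nonneg _)).isCPLOn_planar z j 1 (1 / 2) 1 0 ?_
    rintro x ⟨⟨⟨hx, h1⟩, h4⟩, h5⟩
    have h2 := h x hx
    simp only [p, Set.mem_ofPred_eq, LinearMap.sub_apply, LinearMap.add_apply,
      LinearMap.proj_apply] at h1 h4 h5
    unfold halfFst halfSnd
    constructor <;> split_ifs <;> linarith
  · refine (((hX.inter (isPCone_nonpos _)).inter (isPCone_nonpos _)).inter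
      (isPCone_nonpos _)).isCPLOn_planar z j (1 / 2) 0 0 (-1) ?_
    rintro x ⟨⟨⟨hx, h1⟩, h4⟩, h5⟩
    have h2 := h x hx
    simp only [p, Set.mem_ofPred_eq, LinearMap.sub_apply, LinearMap.add_apply,
      LinearMap.proj_apply] at h1 h4 h5
    unfold halfFst halfSnd
    constructor <;> split_ifs <;> linarith

lemma norm_planar {z j : ι} (hzj : z ≠ j) {F G : ℝ → ℝ → ℝ} {x : ι → ℝ}
    (h1 : max |F (x z) (x j)| |G (x z) (x j)| = max |x z| |x j|) :
    ‖planar z j F G x‖ = ‖x‖ := by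
  apply le_antisymm
  · refine (pi_norm_le_iff_of_nonneg (norm_nonneg _)).2 fun i => ?_
    have h2 : max |x z| |x j| ≤ ‖x‖ := max_le (norm_le_pi_norm x z) (norm_le_pi_norm x j)
    rw [← h1] at h2
    by_cases hi : i = z
    · subst hi; rw [planar_fst]; exact (le_max_left _ _).trans h2
    by_cases hi' : i = j
    · subst hi'; rw [planar_snd hzj]; exact (le_max_right _ _).trans h2
    · rw [planar_of_ne hi hi']; exact norm_le_pi_norm x i
  · refine (pi_norm_le_iff_of_nonneg (norm_nonneg _)).2 fun i => ?_
    have h2 : max |F (x z) (x j)| |G (x z) (x j)| ≤ ‖planar z j F G x‖ := by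
      refine max_le ?_ ?_
      · rw [← planar_fst z j F G]; exact norm_le_pi_norm (planar z j F G x) z
      · rw [← planar_snd hzj F G]; exact norm_le_pi_norm (planar z j F G x) j
    rw [h1] at h2
    by_cases hi : i = z
    · subst hi; exact (le_max_left _ _).trans h2
    by_cases hi' : i = j
    · subst hi'; exact (le_max_right _ _).trans h2
    · have := norm_le_pi_norm (planar z j F G x) i
      rwa [planar_of_ne hi hi'] at this

lemma quad_spec {s t : ℝ} (hs : 0 ≤ s) (ht : 0 ≤ t) :
    0 ≤ quadSnd s t ∧ halfFst (quadFst s t) (quadSnd s t) = s ∧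
      halfSnd (quadFst s t) (quadSnd s t) = t ∧
      max |quadSnd s t| |quadFst s t| = max |s| |t| := by
  have hmax : max |quadSnd s t| |quadFst s t| = max |s| |t| := by
    rw [abs_of_nonneg hs, abs_of_nonneg ht]
    unfold quadSnd quadFst
    split_ifs with h1 h2 h3 h3
    · rw [abs_of_nonneg (by linarith), abs_of_nonneg hs, max_eq_right h1, max_eq_left (by linarith)]
    · rw [abs_of_nonneg hs, abs_of_nonneg (by linarith), max_eq_left (by linarith), max_eq_left h2]
    · linarith
    · rw [abs_of_nonneg ht, abs_of_nonpos (by linarith), max_eq_left (by linarith),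
        max_eq_right (by linarith)]
    · rw [abs_of_nonneg (by linarith), abs_of_nonpos (by linarith), max_eq_right (by linarith),
        max_eq_right (by linarith)]
      ring
  refine ⟨?_, ?_, ?_, hmax⟩
  · unfold quadSnd; split_ifs <;> linarith
  · unfold halfFst quadFst quadSnd; split_ifs <;> linarith
  · unfold halfSnd quadFst quadSnd; split_ifs <;> linarith

lemma half_spec {a b : ℝ} (hb : 0 ≤ b) :
    0 ≤ halfFst a b ∧ 0 ≤ halfSnd a b ∧ quadFst (halfFst a b) (halfSnd a b) = a ∧
      quadSnd (halfFst a b) (halfSnd a b) = b := by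
  unfold halfFst halfSnd quadFst quadSnd
  refine ⟨?_, ?_, ?_, ?_⟩ <;> split_ifs <;> linarith

/-- A quarter-space is a ball. -/
lemma isBall_quarter {S : Finset ι} {z j : ι} (hz : z ∈ S) (hj : j ∉ S) :
    IsBall (insert j S) z (plusSet j (halfSpace S z)) (halfSpace S z ∪ plusSet j (wall S z)) := by
  have hzj : z ≠ j := by rintro rfl; exact hj hz
  have hQ : ∀ x : ι → ℝ, x ∈ plusSet j (halfSpace S z) ↔
      x ∈ coordSpace (insert j S) ∧ 0 ≤ x z ∧ 0 ≤ x j := by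
    intro x
    simp only [plusSet, halfSpace, coordSpace, Set.mem_ofPred_eq, Finset.mem_insert, not_or,
      drop_of_ne hzj]
    constructor
    · rintro ⟨h1, h2, h3⟩
      exact ⟨fun i hi => by rw [← h2 i hi.2, drop_of_ne hi.1], h3, h1⟩
    · rintro ⟨h1, h2, h3⟩
      refine ⟨h3, fun i hi => ?_, h2⟩
      by_cases hij : i = j
      · subst hij; exact drop_self _ _
      · rw [drop_of_ne hij]; exact h1 i ⟨hij, hi⟩
  have hQ' : ∀ x : ι → ℝ, x ∈ halfSpace S z ∪ plusSet j (wall S z) ↔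
      x ∈ coordSpace (insert j S) ∧ 0 ≤ x z ∧ 0 ≤ x j ∧ (x z = 0 ∨ x j = 0) := by
    intro x
    simp only [plusSet, halfSpace, wall, coordSpace, Set.mem_ofPred_eq, Finset.mem_insert, not_or,
      drop_of_ne hzj, Set.mem_union]
    constructor
    · rintro (⟨h1, h2⟩ | ⟨h1, h2, h3⟩)
      · exact ⟨fun i hi => h1 i hi.2, h2, (h1 j hj).ge, Or.inr (h1 j hj)⟩
      · exact ⟨fun i hi => by rw [← h2 i hi.2, drop_of_ne hi.1], h3.ge, h1, Or.inl h3⟩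
    · rintro ⟨h1, h2, h3, h4 | h4⟩
      · refine Or.inr ⟨h3, fun i hi => ?_, h4⟩
        by_cases hij : i = j
        · subst hij; exact drop_self _ _
        · rw [drop_of_ne hij]; exact h1 i ⟨hij, hi⟩
      · refine Or.inl ⟨fun i hi => ?_, h2⟩
        by_cases hij : i = j
        · subst hij; exact h4
        · exact h1 i ⟨hij, hi⟩
  have hcoord : ∀ (F G : ℝ → ℝ → ℝ) (x : ι → ℝ), x ∈ coordSpace (insert j S) →
      planar z j F G x ∈ coordSpace (insert j S) := by
    intro F G x hx i hi
    rw [Finset.mem_insert, not_or] at hi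
    have hiz : i ≠ z := by rintro rfl; exact hi.2 hz
    rw [planar_of_ne hiz hi.1]
    exact hx i (by simp [hi])
  have hplane : ∀ (F G F' G' : ℝ → ℝ → ℝ) (x : ι → ℝ),
      F' (F (x z) (x j)) (G (x z) (x j)) = x z → G' (F (x z) (x j)) (G (x z) (x j)) = x j →
      planar z j F' G' (planar z j F G x) = x := by
    intro F G F' G' x h1 h2
    funext i
    by_cases hi : i = z
    · subst hi; rw [planar_fst, planar_fst, planar_snd hzj, h1]
    by_cases hi' : i = j
    · subst hi'; rw [planar_snd hzj, planar_fst, planar_snd hzj, h2]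
    · rw [planar_of_ne hi hi', planar_of_ne hi hi']
  -- The half-plane coordinate required to be nonnegative is z, so `quadSnd` goes to z and `quadFst`
  -- to j.
  let e : CIso (plusSet j (halfSpace S z)) (halfSpace (insert j S) z) :=
    { f := planar z j quadSnd quadFst
      g := planar z j (fun b a => halfFst a b) fun b a => halfSnd a b
      cplf := isCPLOn_quad ((isPCone_halfSpace S z).plusSet j) fun x hx => ((hQ x).1 hx).2
      cplg := isCPLOn_half (isPCone_halfSpace _ z) fun x hx => hx.2
      mapsf := fun x hx => by
        obtain ⟨h1, h2, h3⟩ := (hQ x).1 hx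
        exact ⟨hcoord _ _ x h1, by rw [planar_fst]; exact (quad_spec h2 h3).1⟩
      mapsg := fun x hx => by
        have h := half_spec (a := x j) hx.2
        exact (hQ _).2 ⟨hcoord _ _ x hx.1, by rw [planar_fst]; exact h.1,
          by rw [planar_snd hzj]; exact h.2.1⟩
      left := fun x hx => by
        obtain ⟨h1, h2, h3⟩ := (hQ x).1 hx
        exact hplane _ _ _ _ x (quad_spec h2 h3).2.1 (quad_spec h2 h3).2.2.1
      right := fun x hx => by
        have h := half_spec (a := x j) hx.2
        exact hplane _ _ _ _ x h.2.2.2 h.2.2.1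
      norm := fun x hx => by
        obtain ⟨h1, h2, h3⟩ := (hQ x).1 hx
        exact norm_planar hzj (quad_spec h2 h3).2.2.2 }
  refine ⟨e, fun x hx => ?_, fun x hx => ⟨hx.1, hx.2.ge⟩, fun x hx => ?_, fun x hx => ?_⟩
  · obtain ⟨h1, h2, h3, -⟩ := (hQ' x).1 hx
    exact (hQ x).2 ⟨h1, h2, h3⟩
  · obtain ⟨h1, h2, h3, h4⟩ := (hQ' x).1 hx
    refine ⟨hcoord _ _ x h1, ?_⟩
    change planar z j quadSnd quadFst x z = 0
    rw [planar_fst]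
    rcases h4 with h4 | h4 <;> rw [h4] <;> unfold quadSnd <;> split_ifs <;> linarith
  · have h := half_spec (a := x j) hx.2.ge
    refine (hQ' _).2 ⟨hcoord (fun b a => halfFst a b) (fun b a => halfSnd a b) x hx.1, ?_⟩
    change 0 ≤ planar z j (fun b a => halfFst a b) (fun b a => halfSnd a b) x z ∧
      0 ≤ planar z j (fun b a => halfFst a b) (fun b a => halfSnd a b) x j ∧
      (planar z j (fun b a => halfFst a b) (fun b a => halfSnd a b) x z = 0 ∨
      planar z j (fun b a => halfFst a b) (fun b a => halfSnd a b) x j = 0)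
    rw [planar_fst, planar_snd hzj]
    refine ⟨h.1, h.2.1, ?_⟩
    have hx0 : x z = 0 := hx.2
    rw [hx0]
    unfold halfFst halfSnd
    by_cases ha : 0 ≤ x j
    · right; simp [ha]
    · left
      rw [if_neg ha, if_neg ha, if_neg (by linarith)]
      simp

end Quarter

end Models


open Function

/-! ### Unions of orthants and their decomposition by a hyperplane -/

section Sectors

variable {ι : Type*}

/-- The point `x` lies in the closed orthant of the vertex `ξ`. -/
def InOrthant (ξ : ι → Bool) (x : ι → ℝ) : Prop :=
  ∀ i, (ξ i = true → 0 ≤ x i) ∧ (ξ i = false → x i ≤ 0)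

/-- The union of the closed orthants of the points of `{ψ = 1}`, inside a coordinate subspace. -/
def sector (S : Finset ι) (ψ : (ι → Bool) → Bool) : Set (ι → ℝ) :=
  {x | x ∈ coordSpace S ∧ ∃ ξ, ψ ξ = true ∧ InOrthant ξ x}

/-- The common part of a sector and of the complementary sector. -/
def sectorBd (S : Finset ι) (ψ : (ι → Bool) → Bool) : Set (ι → ℝ) :=
  sector S ψ ∩ sector S (BoolFun.neg ψ)

/-- The function `ψ` depends only on the variables in `S`. -/
def DependsOnly (S : Finset ι) (ψ : (ι → Bool) → Bool) : Prop :=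
  ∀ ξ η, (∀ i ∈ S, ξ i = η i) → ψ ξ = ψ η

/-- Neither identically `0` nor identically `1`. -/
def Nonconst (ψ : (ι → Bool) → Bool) : Prop := (∃ ξ, ψ ξ = true) ∧ ∃ ξ, ψ ξ = false

lemma Nonconst.neg {ψ : (ι → Bool) → Bool} (h : Nonconst ψ) : Nonconst (BoolFun.neg ψ) := by
  obtain ⟨⟨ξ, h1⟩, η, h2⟩ := h
  exact ⟨⟨η, by simp [BoolFun.neg, h2]⟩, ξ, by simp [BoolFun.neg, h1]⟩

lemma DependsOnly.neg {S : Finset ι} {ψ : (ι → Bool) → Bool} (h : DependsOnly S ψ) :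
    DependsOnly S (BoolFun.neg ψ) := fun ξ η hξη => by
  simp only [BoolFun.neg]; rw [h ξ η hξη]

lemma sectorBd_neg (S : Finset ι) (ψ : (ι → Bool) → Bool) :
    sectorBd S (BoolFun.neg ψ) = sectorBd S ψ := by
  rw [sectorBd, BoolFun.neg_neg', Set.inter_comm]; rfl

lemma sector_mono {S : Finset ι} {ψ χ : (ι → Bool) → Bool} (h : ∀ ξ, ψ ξ = true → χ ξ = true) :
    sector S ψ ⊆ sector S χ := fun _ hx => ⟨hx.1, hx.2.imp fun ξ hξ => ⟨h ξ hξ.1, hξ.2⟩⟩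

lemma sector_union {S : Finset ι} {ψ χ ω : (ι → Bool) → Bool}
    (h : ∀ ξ, ω ξ = true ↔ ψ ξ = true ∨ χ ξ = true) : sector S ω = sector S ψ ∪ sector S χ := by
  ext x
  constructor
  · rintro ⟨h1, ξ, h2, h3⟩
    exact ((h ξ).1 h2).imp (fun h => ⟨h1, ξ, h, h3⟩) fun h => ⟨h1, ξ, h, h3⟩
  · rintro (⟨h1, ξ, h2, h3⟩ | ⟨h1, ξ, h2, h3⟩)
    · exact ⟨h1, ξ, (h ξ).2 (Or.inl h2), h3⟩
    · exact ⟨h1, ξ, (h ξ).2 (Or.inr h2), h3⟩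

lemma exists_inOrthant (x : ι → ℝ) : ∃ ξ, InOrthant ξ x := by
  classical
  refine ⟨fun i => decide (0 ≤ x i), fun i => ⟨fun h => by simpa using h, fun h => ?_⟩⟩
  simp only [decide_eq_false_iff_not, not_le] at h
  exact h.le

lemma sector_of_forall {S : Finset ι} {ψ : (ι → Bool) → Bool} (h : ∀ ξ, ψ ξ = true) :
    sector S ψ = coordSpace S := by
  ext x
  exact ⟨fun hx => hx.1, fun hx => ⟨hx, (exists_inOrthant x).imp fun ξ hξ => ⟨h ξ, hξ⟩⟩⟩

lemma sector_of_forall_false {S : Finset ι} {ψ : (ι → Bool) → Bool} (h : ∀ ξ, ψ ξ = false) :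
    sector S ψ = ∅ := by
  ext x
  simp [sector, h]

variable [Fintype ι]

lemma isPCone_sector (S : Finset ι) (ψ : (ι → Bool) → Bool) : IsPCone (sector S ψ) := by
  classical
  have : sector S ψ = coordSpace S ∩ ⋃ ξ ∈ Finset.univ.filter (fun ξ => ψ ξ = true),
      ⋂ i ∈ (Finset.univ : Finset ι), {x : ι → ℝ |
        0 ≤ ((if ξ i = true then 1 else -1 : ℝ) • LinearMap.proj (R := ℝ) (φ := fun _ : ι => ℝ) i) x} := by
    ext x
    simp only [sector, InOrthant, Set.mem_ofPred_eq, Set.mem_inter_iff, Set.mem_iUnion, Set.mem_iInter,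
      Finset.mem_filter, Finset.mem_univ, true_and, exists_prop, LinearMap.smul_apply,
      LinearMap.proj_apply, true_imp_iff]
    refine and_congr_right fun _ => exists_congr fun ξ => and_congr_right fun _ =>
      forall_congr' fun i => ?_
    cases ξ i <;> simp
  rw [this]
  exact (isPCone_coordSpace S).inter (IsPCone.biUnion _ fun ξ _ => IsPCone.biInter _ fun i _ =>
    isPCone_nonneg _)

lemma isPCone_sectorBd (S : Finset ι) (ψ : (ι → Bool) → Bool) : IsPCone (sectorBd S ψ) :=
  (isPCone_sector S ψ).inter (isPCone_sector S _)

variable [DecidableEq ι]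

/-- The product of `Z` with a half-line in the negative direction `j`. -/
def minusSet (j : ι) (Z : Set (ι → ℝ)) : Set (ι → ℝ) := {x | x j ≤ 0 ∧ drop j x ∈ Z}

omit [Fintype ι] in
lemma reflect_mem_plusSet {j : ι} {Z : Set (ι → ℝ)} {x : ι → ℝ} :
    reflect j x ∈ plusSet j Z ↔ x ∈ minusSet j Z := by
  simp [plusSet, minusSet, reflect_self, drop_reflect]

omit [Fintype ι] in
lemma reflect_mem_minusSet {j : ι} {Z : Set (ι → ℝ)} {x : ι → ℝ} :
    reflect j x ∈ minusSet j Z ↔ x ∈ plusSet j Z := by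
  simp [plusSet, minusSet, reflect_self, drop_reflect]

omit [Fintype ι] in
lemma isPCone_minusSet {Z : Set (ι → ℝ)} (hZ : IsPCone Z) (j : ι) : IsPCone (minusSet j Z) :=
  (isPCone_nonpos (LinearMap.proj (R := ℝ) (φ := fun _ : ι => ℝ) j)).inter (hZ.preimage (drop j))

/-- Reflection in the coordinate `j`. -/
def CIso.minusPlus (j : ι) {Z : Set (ι → ℝ)} (hZ : IsPCone Z) :
    CIso (minusSet j Z) (plusSet j Z) :=
  CIso.reflection j (isPCone_minusSet hZ j) (hZ.plusSet j) (fun _ hx => reflect_mem_plusSet.2 hx)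
    fun _ hx => reflect_mem_minusSet.2 hx

omit [Fintype ι] in
lemma drop_mem_coordSpace {S : Finset ι} {j : ι} (hj : j ∉ S) {x : ι → ℝ} :
    drop j x ∈ coordSpace S ↔ x ∈ coordSpace (insert j S) := by
  simp only [coordSpace, Set.mem_ofPred_eq, Finset.mem_insert, not_or]
  constructor
  · intro h i hi
    rw [← h i hi.2, drop_of_ne hi.1]
  · intro h i hi
    by_cases hij : i = j
    · subst hij; exact drop_self _ _
    · rw [drop_of_ne hij]; exact h i ⟨hij, hi⟩

omit [Fintype ι] in
lemma InOrthant.drop {ξ : ι → Bool} {x : ι → ℝ} (h : InOrthant ξ x) (j : ι) :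
    InOrthant ξ (drop j x) := by
  intro i
  by_cases hij : i = j
  · subst hij; simp [drop_self]
  · rw [drop_of_ne hij]; exact h i

omit [Fintype ι] in
lemma inOrthant_update {ξ : ι → Bool} {x : ι → ℝ} {j : ι} (h : InOrthant ξ (drop j x)) {b : Bool}
    (hb : (b = true → 0 ≤ x j) ∧ (b = false → x j ≤ 0)) : InOrthant (update ξ j b) x := by
  intro i
  by_cases hij : i = j
  · subst hij; simpa using hb
  · rw [update_of_ne hij]; simpa [drop_of_ne hij] using h i

omit [Fintype ι] in
/-- The decomposition of a sector by a coordinate hyperplane. -/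
lemma sector_insert {S : Finset ι} {j : ι} (hj : j ∉ S) (ψ : (ι → Bool) → Bool) :
    sector (insert j S) ψ = plusSet j (sector S (BoolFun.res j true ψ)) ∪
      minusSet j (sector S (BoolFun.res j false ψ)) := by
  ext x
  constructor
  · rintro ⟨h1, ξ, h2, h3⟩
    rw [← drop_mem_coordSpace hj] at h1
    have h4 : BoolFun.res j (ξ j) ψ ξ = true := by rwa [BoolFun.res, update_eq_self]
    cases h5 : ξ j
    · rw [h5] at h4
      exact Or.inr ⟨(h3 j).2 h5, h1, ξ, h4, h3.drop j⟩
    · rw [h5] at h4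
      exact Or.inl ⟨(h3 j).1 h5, h1, ξ, h4, h3.drop j⟩
  · rintro (⟨h0, h1, ξ, h2, h3⟩ | ⟨h0, h1, ξ, h2, h3⟩)
    · exact ⟨(drop_mem_coordSpace hj).1 h1, _, h2, inOrthant_update h3 (by simpa using h0)⟩
    · exact ⟨(drop_mem_coordSpace hj).1 h1, _, h2, inOrthant_update h3 (by simpa using h0)⟩

omit [Fintype ι] in
lemma DependsOnly.res {S : Finset ι} {j : ι} {ψ : (ι → Bool) → Bool}
    (h : DependsOnly (insert j S) ψ) (b : Bool) : DependsOnly S (BoolFun.res j b ψ) := by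
  intro ξ η hξη
  refine h _ _ fun i hi => ?_
  by_cases hij : i = j
  · subst hij; simp
  · rw [update_of_ne hij, update_of_ne hij]
    exact hξη i ((Finset.mem_insert.1 hi).resolve_left hij)

omit [Fintype ι] in
lemma DependsOnly.fa {S : Finset ι} {j : ι} {ψ : (ι → Bool) → Bool}
    (h : DependsOnly (insert j S) ψ) : DependsOnly S (BoolFun.fa j ψ) := by
  intro ξ η hξη
  have h1 := h.res false ξ η hξη
  have h2 := h.res true ξ η hξη
  simp only [BoolFun.res] at h1 h2
  simp only [BoolFun.fa, h1, h2]

/-- A point x common to both sectors lies in an orthant for each substitution. The two vertices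
agree where x is nonzero, and `exists_fa_of_hReg` finds a common vertex by changing only variables
in which x vanishes. -/
lemma sector_inter_res {S : Finset ι} {j : ι} (hj : j ∉ S) {ψ : (ι → Bool) → Bool}
    (h : BoolFun.HReg ψ) :
    sector S (BoolFun.res j true ψ) ∩ sector S (BoolFun.res j false ψ) =
      sector S (BoolFun.fa j ψ) := by
  classical
  apply subset_antisymm
  · rintro x ⟨⟨h1, η, h2, h3⟩, -, ξ, h4, h5⟩
    obtain ⟨ζ, h6, h7⟩ := BoolFun.exists_fa_of_hReg
      (Finset.univ.filter fun i => i ≠ j ∧ x i = 0) (by simp) h ξ η h4 h2 (by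
        intro i hi hij
        simp only [Finset.mem_filter, Finset.mem_univ, true_and, not_and] at hi
        have h8 := hi hij
        have h9 := h3 i
        have h10 := h5 i
        rcases lt_or_gt_of_ne h8 with hlt | hlt
        · cases hη : η i <;> cases hξ : ξ i <;> simp_all <;> linarith
        · cases hη : η i <;> cases hξ : ξ i <;> simp_all <;> linarith)
    refine ⟨h1, ζ, h6, fun i => ?_⟩
    by_cases hi : x i = 0
    · simp [hi]
    · have hij : i ≠ j := by rintro rfl; exact hi (h1 i hj)
      rw [h7 i (by simp [hi]) hij]
      exact h5 i
  · refine Set.subset_inter (sector_mono fun ξ hξ => ?_) (sector_mono fun ξ hξ => ?_)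
    · simp only [BoolFun.fa, Bool.and_eq_true] at hξ; exact hξ.2
    · simp only [BoolFun.fa, Bool.and_eq_true] at hξ; exact hξ.1

omit [Fintype ι] [DecidableEq ι] in
lemma apply_eq_zero_of_mem_sector {S : Finset ι} {j : ι} (hj : j ∉ S) {ψ : (ι → Bool) → Bool}
    {x : ι → ℝ} (hx : x ∈ sector S ψ) : x j = 0 := hx.1 j hj

/-- The statement that nonconstant hereditarily regular functions of the variables in `S` define
balls. -/
def SectorsAreBalls (S : Finset ι) (z : ι) : Prop :=
  ∀ ψ : (ι → Bool) → Bool, BoolFun.HReg ψ → DependsOnly S ψ → Nonconst ψ →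
    IsBall S z (sector S ψ) (sectorBd S ψ)

/-! ### Extending a chart to one side of a hyperplane -/

section Step

variable {S : Finset ι} {z j : ι}

omit [Fintype ι] in
lemma mem_of_mem_plusSet {Z : Set (ι → ℝ)} {x : ι → ℝ} (hx : x j = 0) (h : x ∈ plusSet j Z) :
    x ∈ Z := by
  have := h.2
  rwa [drop_eq_self hx] at this

/-- Exchanging the coordinates z and j turns this set into the half-space itself and preserves its
wall. -/
lemma isBall_plusSet_wall (hz : z ∈ S) (hj : j ∉ S) :
    IsBall S z (plusSet j (wall S z)) (wall S z) := by
  have hzj : z ≠ j := by rintro rfl; exact hj hz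
  have h := isBall_swap (S := S) (T := insert j (S.erase z)) (z := z) (j := j) (by
    intro i
    by_cases h1 : i = z
    · subst h1; simp [hj, hzj]
    by_cases h2 : i = j
    · subst h2; simp [hz]
    · rw [Equiv.swap_apply_of_ne_of_ne h1 h2]; simp [h1, h2])
  convert h using 1
  · ext x
    simp only [plusSet, wall, halfSpace, coordSpace, Set.mem_ofPred_eq, Finset.mem_insert,
      Finset.mem_erase, not_or, not_and, drop_of_ne hzj]
    constructor
    · rintro ⟨h1, h2, h3⟩
      refine ⟨fun i hi => ?_, h1⟩
      by_cases h4 : i = z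
      · rw [h4, h3]
      · rw [← h2 i (hi.2 h4), drop_of_ne hi.1]
    · rintro ⟨h1, h2⟩
      refine ⟨h2, fun i hi => ?_, h1 z ⟨hzj, fun h => (h rfl).elim⟩⟩
      by_cases h4 : i = j
      · subst h4; exact drop_self _ _
      · rw [drop_of_ne h4]; exact h1 i ⟨h4, fun _ => hi⟩
  · ext x
    simp only [wall, coordSpace, Set.mem_ofPred_eq, Finset.mem_insert, Finset.mem_erase, not_or,
      not_and]
    constructor
    · rintro ⟨h1, h2⟩
      refine ⟨fun i hi => ?_, h1 j hj⟩
      by_cases h4 : i = z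
      · rw [h4, h2]
      · exact h1 i (hi.2 h4)
    · rintro ⟨h1, h2⟩
      refine ⟨fun i hi => ?_, h1 z ⟨hzj, fun h => (h rfl).elim⟩⟩
      by_cases h4 : i = j
      · rw [h4, h2]
      · exact h1 i ⟨h4, fun _ => hi⟩

/-- If φ is nonconstant, a chart of its sector times a half-line gives a quarter-space, which opens
to a half-space. If φ is identically 1, the product is a half-space in the coordinate j and the
coordinates z and j are exchanged. -/
lemma isBall_plusSet_sector (hz : z ∈ S) (hj : j ∉ S) (hS : SectorsAreBalls S z)
    {φ : (ι → Bool) → Bool} (hφ : BoolFun.HReg φ) (hd : DependsOnly S φ) (hne : ∃ ξ, φ ξ = true) :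
    IsBall (insert j S) z (plusSet j (sector S φ)) (sector S φ ∪ plusSet j (sectorBd S φ)) := by
  by_cases hc : ∃ ξ, φ ξ = false
  · obtain ⟨e, he⟩ := hS φ hφ hd ⟨hne, hc⟩
    refine (isBall_quarter hz hj).of_iso (e.plus j (fun x hx => apply_eq_zero_of_mem_sector hj hx)
      fun x hx => hx.1 j hj) (CIso.Carries.union ?_ he.plus)
    exact CIso.Carries.of_eqOn e
      (subset_plusSet fun x hx => apply_eq_zero_of_mem_sector hj hx)
      (subset_plusSet fun x hx => hx.1 j hj) CIso.plus_f_eqOn CIso.plus_g_eqOn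
  · simp only [not_exists, Bool.not_eq_false] at hc
    have h := isBall_swap (S := insert j S) (T := insert j S) (z := z) (j := j) (by
      intro i
      by_cases h1 : i = z
      · subst h1; simp [hz]
      by_cases h2 : i = j
      · subst h2; simp [hz]
      · rw [Equiv.swap_apply_of_ne_of_ne h1 h2])
    have hbd : sectorBd S φ = ∅ := by
      rw [sectorBd, sector_of_forall_false (ψ := BoolFun.neg φ) (by simpa [BoolFun.neg] using hc),
        Set.inter_empty]
    rw [hbd, sector_of_forall hc]
    convert h using 1
    · ext x
      simp only [plusSet, halfSpace, Set.mem_ofPred_eq, drop_mem_coordSpace hj, and_comm]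
    · ext x
      simp only [plusSet, wall, Set.mem_ofPred_eq, Set.mem_union, Set.mem_empty_iff_false, and_false,
        or_false, ← drop_mem_coordSpace hj]
      constructor
      · intro h1
        exact ⟨by rwa [drop_eq_self (h1 j hj)], h1 j hj⟩
      · rintro ⟨h1, h2⟩
        rwa [drop_eq_self h2] at h1

/-- Together with the sector of α, this set makes up the boundary of one side. The sector of the
negation of α is the union of the sectors of β and of the negation of φ. Replacing the latter by
`plusSet j (sectorBd S φ)`, a ball with the same boundary, gives an isomorphic set, which is
therefore a ball. -/
lemma isBall_complement (hz : z ∈ S) (hj : j ∉ S) (hS : SectorsAreBalls S z)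
    {φ α β : (ι → Bool) → Bool} (hφ : BoolFun.HReg φ) (hd : DependsOnly S φ)
    (hα : BoolFun.HReg α) (hdα : DependsOnly S α) (hnα : Nonconst α)
    (hαφ : ∀ ξ, α ξ = true → φ ξ = true) (hβ : ∀ ξ, β ξ = (φ ξ && !α ξ)) :
    IsBall S z (sector S β ∪ plusSet j (sectorBd S φ)) (sectorBd S α) := by
  have hneg := hS _ hα.neg hdα.neg hnα.neg
  rw [sectorBd_neg] at hneg
  by_cases hc : ∃ ξ, φ ξ = false
  · have hnφ : Nonconst φ := ⟨hnα.1.imp fun ξ => hαφ ξ, hc⟩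
    have hβφ : sector S β ⊆ sector S φ := sector_mono fun ξ hξ => by
      rw [hβ, Bool.and_eq_true] at hξ; exact hξ.1
    have hplus : IsBall S z (plusSet j (sectorBd S φ)) (sectorBd S φ) := by
      obtain ⟨e, he⟩ := hS φ hφ hd hnφ
      have h0 : ∀ x ∈ sectorBd S φ, x j = 0 := fun x hx => apply_eq_zero_of_mem_sector hj hx.1
      have h1 : ∀ x ∈ wall S z, x j = 0 := fun x hx => hx.1 j hj
      let u := e.restrict he (isPCone_sectorBd S φ) (isPCone_wall S z)
      exact (isBall_plusSet_wall hz hj).of_iso (u.plus j h0 h1)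
        (CIso.Carries.of_eqOn u (subset_plusSet h0) (subset_plusSet h1)
          CIso.plus_f_eqOn CIso.plus_g_eqOn)
    have hnegφ := hS _ hφ.neg hd.neg hnφ.neg
    rw [sectorBd_neg] at hnegφ
    -- V exchanges the two balls and is the identity on their common boundary, so it glues to the
    -- identity of the sector of β.
    obtain ⟨V, hV1, hV2⟩ := hplus.extend hz hnegφ (CIso.refl (isPCone_sectorBd S φ))
    have hid1 : ∀ x ∈ sectorBd S φ, V.f x = x := hV1
    have hid2 : ∀ x ∈ sectorBd S φ, V.g x = x := hV2
    have hneg_union : sector S (BoolFun.neg α) = sector S β ∪ sector S (BoolFun.neg φ) := by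
      refine sector_union fun ξ => ?_
      have := hαφ ξ
      simp only [hβ, BoolFun.neg]
      cases h1 : α ξ <;> cases h2 : φ ξ <;> simp_all
    let W := (CIso.refl (isPCone_sector S β)).glue V
      (by
        rintro x ⟨h1, h2⟩
        exact (hid1 x (mem_of_mem_plusSet (apply_eq_zero_of_mem_sector hj h1) h2)).symm)
      (by
        rintro x ⟨h1, h2⟩
        exact (hid2 x ⟨hβφ h1, h2⟩).symm)
    have hsub : ∀ x ∈ sectorBd S α, x ∈ sector S β ∨ x ∈ sectorBd S φ := by
      rintro x ⟨h1, h2⟩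
      rw [hneg_union] at h2
      exact h2.imp id fun h => ⟨sector_mono hαφ h1, h⟩
    have hsub2 : sectorBd S φ ⊆ plusSet j (sectorBd S φ) :=
      subset_plusSet fun x hx => apply_eq_zero_of_mem_sector hj hx.1
    rw [hneg_union] at hneg
    refine hneg.of_iso W (CIso.Carries.of_eqOn (CIso.refl (isPCone_sectorBd S α)) ?_ ?_ ?_ ?_)
    · exact fun x hx => (hsub x hx).imp id fun h => hsub2 h
    · exact fun x hx => (hsub x hx).imp id fun h => h.2
    · intro x hx
      rcases hsub x hx with h | h
      · exact CIso.glue_f_left h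
      · exact (CIso.glue_f_right (hsub2 h)).trans (hid1 x h)
    · intro x hx
      rcases hsub x hx with h | h
      · exact CIso.glue_g_left h
      · exact (CIso.glue_g_right h.2).trans (hid2 x h)
  · simp only [not_exists, Bool.not_eq_false] at hc
    have hbd : sectorBd S φ = ∅ := by
      rw [sectorBd, sector_of_forall_false (ψ := BoolFun.neg φ) (by simpa [BoolFun.neg] using hc),
        Set.inter_empty]
    have hβ' : β = BoolFun.neg α := by funext ξ; rw [hβ, hc]; rfl
    have he : plusSet j (∅ : Set (ι → ℝ)) = ∅ := by ext; simp [plusSet]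
    rw [hbd, he, Set.union_empty, hβ']
    exact hneg

/-- An isomorphism of a sector with a half-space extends to one side of it. -/
lemma exists_extension_plusSet (hz : z ∈ S) (hj : j ∉ S) (hS : SectorsAreBalls S z)
    {φ α β : (ι → Bool) → Bool} (hφ : BoolFun.HReg φ) (hd : DependsOnly S φ)
    (hα : BoolFun.HReg α) (hdα : DependsOnly S α) (hnα : Nonconst α)
    (hαφ : ∀ ξ, α ξ = true → φ ξ = true) (hβ : ∀ ξ, β ξ = (φ ξ && !α ξ))
    (h : CIso (sector S α) (halfSpace S z)) (hh : h.Carries (sectorBd S α) (wall S z)) :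
    ∃ U : CIso (plusSet j (sector S φ)) (plusSet j (halfSpace S z)),
      Set.EqOn U.f h.f (sector S α) ∧ Set.EqOn U.g h.g (halfSpace S z) ∧
      U.Carries (sector S β ∪ plusSet j (sectorBd S φ)) (plusSet j (wall S z)) := by
  -- The given chart is extended from the boundary of the sector of α over the rest of the boundary
  -- of this side.
  obtain ⟨V, hV1, hV2⟩ := (isBall_complement hz hj hS hφ hd hα hdα hnα hαφ hβ).extend hz
    (isBall_plusSet_wall hz hj) (h.restrict hh (isPCone_sectorBd S α) (isPCone_wall S z))
  have hβφ : sector S β ⊆ sector S φ := sector_mono fun ξ hξ => by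
    rw [hβ, Bool.and_eq_true] at hξ; exact hξ.1
  have hβα : sector S β ⊆ sector S (BoolFun.neg α) := sector_mono fun ξ hξ => by
    rw [hβ, Bool.and_eq_true] at hξ; exact hξ.2
  have hφα : sector S (BoolFun.neg φ) ⊆ sector S (BoolFun.neg α) := sector_mono fun ξ hξ => by
    have := hαφ ξ
    simp only [BoolFun.neg] at hξ ⊢
    cases h1 : α ξ <;> simp_all
  have hdom : sector S φ ∪ plusSet j (sectorBd S φ) =
      sector S α ∪ (sector S β ∪ plusSet j (sectorBd S φ)) := by
    rw [← Set.union_assoc, ← sector_union]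
    intro ξ
    have := hαφ ξ
    simp only [hβ]
    cases h1 : α ξ <;> cases h2 : φ ξ <;> simp_all
  let W := h.glue V
    (by
      rintro x ⟨h1, h2⟩
      have : x ∈ sectorBd S α := by
        refine ⟨h1, h2.elim (fun h => hβα h) fun h => ?_⟩
        exact hφα (mem_of_mem_plusSet (apply_eq_zero_of_mem_sector hj h1) h).2
      exact (hV1 this).symm)
    (by
      rintro x ⟨h1, h2⟩
      exact (hV2 (mem_of_mem_plusSet (h1.1 j hj) h2)).symm)
  have hφne : ∃ ξ, φ ξ = true := hnα.1.imp fun ξ => hαφ ξ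
  have hball := isBall_plusSet_sector hz hj hS hφ hd hφne
  rw [hdom] at hball
  -- The glued map W is an isomorphism of the boundaries of two balls, this side and the
  -- quarter-space, and so it extends inwards.
  obtain ⟨U, hU1, hU2⟩ := hball.extend (Finset.mem_insert_of_mem hz) (isBall_quarter hz hj) W
  refine ⟨U, fun x hx => ?_, fun x hx => ?_, CIso.Carries.of_eqOn V ?_ ?_ ?_ ?_⟩
  · rw [hU1 (Or.inl hx)]; exact CIso.glue_f_left hx
  · rw [hU2 (Or.inl hx)]; exact CIso.glue_g_left hx
  · refine Set.union_subset (hβφ.trans (subset_plusSet fun x hx =>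
      apply_eq_zero_of_mem_sector hj hx)) (plusSet_mono fun x hx => hx.1)
  · exact plusSet_mono fun x hx => ⟨hx.1, hx.2.ge⟩
  · intro x hx
    rw [hU1 (Or.inr hx)]; exact CIso.glue_f_right hx
  · intro x hx
    rw [hU2 (Or.inr hx)]; exact CIso.glue_g_right hx

end Step

end Sectors


open Function

/-! ### Induction on the variables -/

section SectorInduction

variable {ι : Type*} [Fintype ι] [DecidableEq ι] {S : Finset ι} {z j : ι}

omit [Fintype ι] in
/-- The decomposition of the boundary of a sector by a coordinate hyperplane. -/
lemma sectorBd_insert (hj : j ∉ S) (ψ : (ι → Bool) → Bool) :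
    sectorBd (insert j S) ψ =
      ((sector S (BoolFun.res j true ψ) ∩ sector S (BoolFun.neg (BoolFun.res j false ψ))) ∪
        plusSet j (sectorBd S (BoolFun.res j true ψ))) ∪
      ((sector S (BoolFun.res j false ψ) ∩ sector S (BoolFun.neg (BoolFun.res j true ψ))) ∪
        minusSet j (sectorBd S (BoolFun.res j false ψ))) := by
  rw [sectorBd, sector_insert hj, sector_insert hj]
  change (plusSet j (sector S (BoolFun.res j true ψ)) ∪ minusSet j (sector S (BoolFun.res j false ψ)))
    ∩ (plusSet j (sector S (BoolFun.neg (BoolFun.res j true ψ))) ∪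
      minusSet j (sector S (BoolFun.neg (BoolFun.res j false ψ)))) = _
  ext x
  constructor
  · rintro ⟨⟨h1, h2⟩ | ⟨h1, h2⟩, ⟨h3, h4⟩ | ⟨h3, h4⟩⟩
    · exact Or.inl (Or.inr ⟨h1, h2, h4⟩)
    · have h0 := drop_eq_self (le_antisymm h3 h1)
      rw [h0] at h2 h4
      exact Or.inl (Or.inl ⟨h2, h4⟩)
    · have h0 := drop_eq_self (le_antisymm h1 h3)
      rw [h0] at h2 h4
      exact Or.inr (Or.inl ⟨h2, h4⟩)
    · exact Or.inr (Or.inr ⟨h1, h2, h4⟩)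
  · rintro ((⟨h1, h2⟩ | ⟨h1, h2, h3⟩) | (⟨h1, h2⟩ | ⟨h1, h2, h3⟩))
    · have h0 := apply_eq_zero_of_mem_sector hj h1
      have h3 := drop_eq_self h0
      exact ⟨Or.inl ⟨h0.ge, by rwa [h3]⟩, Or.inr ⟨h0.le, by rwa [h3]⟩⟩
    · exact ⟨Or.inl ⟨h1, h2⟩, Or.inl ⟨h1, h3⟩⟩
    · have h0 := apply_eq_zero_of_mem_sector hj h1
      have h3 := drop_eq_self h0
      exact ⟨Or.inr ⟨h0.le, by rwa [h3]⟩, Or.inl ⟨h0.ge, by rwa [h3]⟩⟩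
    · exact ⟨Or.inr ⟨h1, h2⟩, Or.inr ⟨h1, h3⟩⟩

omit [Fintype ι] [DecidableEq ι] in
lemma sector_inter_neg_subset {φ θ β : (ι → Bool) → Bool} (hβ : ∀ ξ, β ξ = (φ ξ && !θ ξ)) :
    sector S φ ∩ sector S (BoolFun.neg θ) ⊆ sector S β ∪ sectorBd S θ := by
  rintro x ⟨⟨h1, ξ, h2, h3⟩, h4⟩
  cases h5 : θ ξ
  · exact Or.inl ⟨h1, ξ, by rw [hβ, h2, h5]; rfl, h3⟩
  · exact Or.inr ⟨⟨h1, ξ, h5, h3⟩, h4⟩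

omit [Fintype ι] in
lemma minusSet_empty (j : ι) : minusSet j (∅ : Set (ι → ℝ)) = ∅ := by ext; simp [minusSet]

omit [Fintype ι] in
lemma plusSet_empty (j : ι) : plusSet j (∅ : Set (ι → ℝ)) = ∅ := by ext; simp [plusSet]

omit [Fintype ι] in
lemma subset_minusSet {Z : Set (ι → ℝ)} (hZ : ∀ x ∈ Z, x j = 0) : Z ⊆ minusSet j Z :=
  fun x hx => ⟨(hZ x hx).le, by rwa [drop_eq_self (hZ x hx)]⟩

omit [Fintype ι] in
lemma halfSpace_insert (hz : z ∈ S) (hj : j ∉ S) :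
    halfSpace (insert j S) z = plusSet j (halfSpace S z) ∪ minusSet j (halfSpace S z) := by
  have hzj : z ≠ j := by rintro rfl; exact hj hz
  ext x
  simp only [halfSpace, plusSet, minusSet, Set.mem_ofPred_eq, Set.mem_union, drop_mem_coordSpace hj,
    drop_of_ne hzj]
  have := le_total 0 (x j)
  tauto

omit [Fintype ι] in
lemma wall_insert (hz : z ∈ S) (hj : j ∉ S) :
    wall (insert j S) z = plusSet j (wall S z) ∪ minusSet j (wall S z) := by
  have hzj : z ≠ j := by rintro rfl; exact hj hz
  ext x
  simp only [wall, plusSet, minusSet, Set.mem_ofPred_eq, Set.mem_union, drop_mem_coordSpace hj,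
    drop_of_ne hzj]
  have := le_total 0 (x j)
  tauto

/-- The mirror image of an isomorphism. -/
def CIso.mirror {X Y : Set (ι → ℝ)} (j : ι) (hX : IsPCone X) (hY : IsPCone Y)
    (U : CIso (plusSet j X) (plusSet j Y)) : CIso (minusSet j X) (minusSet j Y) :=
  ((CIso.minusPlus j hX).trans U).trans (CIso.minusPlus j hY).symm

lemma CIso.mirror_f {X Y : Set (ι → ℝ)} (hX : IsPCone X) (hY : IsPCone Y)
    (U : CIso (plusSet j X) (plusSet j Y)) (x : ι → ℝ) :
    (CIso.mirror j hX hY U).f x = reflect j (U.f (reflect j x)) := rfl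

lemma CIso.mirror_g {X Y : Set (ι → ℝ)} (hX : IsPCone X) (hY : IsPCone Y)
    (U : CIso (plusSet j X) (plusSet j Y)) (x : ι → ℝ) :
    (CIso.mirror j hX hY U).g x = reflect j (U.g (reflect j x)) := rfl

/-- The two sides meet in the sector of `fa j ψ`. A chart of it onto a half-space extends to both
sides, by reflection for the negative one, and the extensions agree on the common part. The rest of
the boundary of each side goes to its half of the wall. -/
lemma isBall_of_fa_nonconst (hz : z ∈ S) (hj : j ∉ S) (hS : SectorsAreBalls S z)
    {ψ : (ι → Bool) → Bool} (hψ : BoolFun.HReg ψ) (hd : DependsOnly (insert j S) ψ)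
    (hα : Nonconst (BoolFun.fa j ψ)) :
    IsBall (insert j S) z (sector (insert j S) ψ) (sectorBd (insert j S) ψ) := by
  obtain ⟨h, hh⟩ := hS _ (hψ.fa j) hd.fa hα
  have hαφ : ∀ ξ, BoolFun.fa j ψ ξ = true → BoolFun.res j true ψ ξ = true := fun ξ hξ => by
    simp only [BoolFun.fa, Bool.and_eq_true] at hξ; exact hξ.2
  have hαθ : ∀ ξ, BoolFun.fa j ψ ξ = true → BoolFun.res j false ψ ξ = true := fun ξ hξ => by
    simp only [BoolFun.fa, Bool.and_eq_true] at hξ; exact hξ.1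
  obtain ⟨U, hU1, hU2, hU3⟩ := exists_extension_plusSet hz hj hS (hψ.res j true) (hd.res true)
    (hψ.fa j) hd.fa hα hαφ (β := fun ξ => BoolFun.res j true ψ ξ && !BoolFun.fa j ψ ξ)
    (fun _ => rfl) h hh
  obtain ⟨V, hV1, hV2, hV3⟩ := exists_extension_plusSet hz hj hS (hψ.res j false) (hd.res false)
    (hψ.fa j) hd.fa hα hαθ (β := fun ξ => BoolFun.res j false ψ ξ && !BoolFun.fa j ψ ξ)
    (fun _ => rfl) h hh
  have hp := isPCone_sector S (BoolFun.res j false ψ)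
  have hq := isPCone_halfSpace S z
  have hover : plusSet j (sector S (BoolFun.res j true ψ)) ∩
      minusSet j (sector S (BoolFun.res j false ψ)) ⊆ sector S (BoolFun.fa j ψ) := by
    rintro x ⟨⟨h1, h2⟩, h3, h4⟩
    have h0 := drop_eq_self (le_antisymm h3 h1)
    rw [h0] at h2 h4
    rw [← sector_inter_res hj hψ]
    exact ⟨h2, h4⟩
  have hover' : plusSet j (halfSpace S z) ∩ minusSet j (halfSpace S z) ⊆ halfSpace S z := by
    rintro x ⟨⟨h1, h2⟩, h3, h4⟩
    rwa [drop_eq_self (le_antisymm h3 h1)] at h2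
  -- Both extensions restrict to the same chart on the hyperplane x_j = 0, which the reflection
  -- fixes pointwise.
  let e := U.glue (CIso.mirror j hp hq V)
    (by
      intro x hx
      have h1 := hover hx
      rw [CIso.mirror_f, reflect_eq_self (apply_eq_zero_of_mem_sector hj h1), hU1 h1, hV1 h1,
        reflect_eq_self ((h.mapsf h1).1 j hj)])
    (by
      intro x hx
      have h1 := hover' hx
      rw [CIso.mirror_g, reflect_eq_self (h1.1 j hj), hU2 h1, hV2 h1,
        reflect_eq_self (apply_eq_zero_of_mem_sector hj (h.mapsg h1))])
  have hfl : Set.EqOn e.f U.f _ := CIso.glue_f_left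
  have hgl : Set.EqOn e.g U.g _ := CIso.glue_g_left
  have hfr : Set.EqOn e.f (CIso.mirror j hp hq V).f _ := CIso.glue_f_right
  have hgr : Set.EqOn e.g (CIso.mirror j hp hq V).g _ := CIso.glue_g_right
  have he : e.Carries
      ((sector S (fun ξ => BoolFun.res j true ψ ξ && !BoolFun.fa j ψ ξ) ∪
        plusSet j (sectorBd S (BoolFun.res j true ψ))) ∪
      (sector S (fun ξ => BoolFun.res j false ψ ξ && !BoolFun.fa j ψ ξ) ∪
        minusSet j (sectorBd S (BoolFun.res j false ψ))))
      (plusSet j (wall S z) ∪ minusSet j (wall S z)) := by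
    have hβ0 : ∀ x ∈ sector S (fun ξ => BoolFun.res j false ψ ξ && !BoolFun.fa j ψ ξ), x j = 0 :=
      fun x hx => apply_eq_zero_of_mem_sector hj hx
    have hmir : (CIso.mirror j hp hq V).Carries
        (sector S (fun ξ => BoolFun.res j false ψ ξ && !BoolFun.fa j ψ ξ) ∪
          minusSet j (sectorBd S (BoolFun.res j false ψ))) (minusSet j (wall S z)) := by
      refine ⟨?_, fun x hx => ⟨hx.1, hx.2.1, hx.2.2.ge⟩, fun x hx => ?_, fun x hx => ?_⟩
      · refine Set.union_subset ((sector_mono fun ξ hξ => ?_).trans (subset_minusSet fun x hx =>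
          apply_eq_zero_of_mem_sector hj hx)) fun x hx => ⟨hx.1, hx.2.1⟩
        rw [Bool.and_eq_true] at hξ; exact hξ.1
      · rw [CIso.mirror_f, reflect_mem_minusSet]
        refine hV3.mapsf (hx.imp (fun h1 => ?_) fun h1 => reflect_mem_plusSet.2 h1)
        rwa [reflect_eq_self (hβ0 x h1)]
      · rw [CIso.mirror_g]
        rcases hV3.mapsg (reflect_mem_plusSet.2 hx) with h1 | h1
        · rw [reflect_eq_self (hβ0 _ h1)]; exact Or.inl h1
        · exact Or.inr (reflect_mem_minusSet.2 h1)
    refine CIso.Carries.union ?_ ?_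
    · refine ⟨hU3.subf.trans Set.subset_union_left, hU3.subg.trans Set.subset_union_left,
        fun x hx => ?_, fun x hx => ?_⟩
      · rw [hfl (hU3.subf hx)]; exact hU3.mapsf hx
      · rw [hgl (hU3.subg hx)]; exact hU3.mapsg hx
    · refine ⟨hmir.subf.trans Set.subset_union_right, hmir.subg.trans Set.subset_union_right,
        fun x hx => ?_, fun x hx => ?_⟩
      · rw [hfr (hmir.subf hx)]; exact hmir.mapsf hx
      · rw [hgr (hmir.subg hx)]; exact hmir.mapsg hx
  have hbd : sectorBd (insert j S) ψ =
      ((sector S (fun ξ => BoolFun.res j true ψ ξ && !BoolFun.fa j ψ ξ) ∪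
        plusSet j (sectorBd S (BoolFun.res j true ψ))) ∪
      (sector S (fun ξ => BoolFun.res j false ψ ξ && !BoolFun.fa j ψ ξ) ∪
        minusSet j (sectorBd S (BoolFun.res j false ψ)))) := by
    rw [sectorBd_insert hj]
    have h1 := sector_inter_neg_subset (S := S) (φ := BoolFun.res j true ψ)
      (θ := BoolFun.res j false ψ)
      (β := fun ξ => BoolFun.res j true ψ ξ && !BoolFun.fa j ψ ξ) (fun ξ => by
        simp only [BoolFun.res, BoolFun.fa]
        cases ψ (update ξ j true) <;> cases ψ (update ξ j false) <;> rfl)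
    have h2 := sector_inter_neg_subset (S := S) (φ := BoolFun.res j false ψ)
      (θ := BoolFun.res j true ψ)
      (β := fun ξ => BoolFun.res j false ψ ξ && !BoolFun.fa j ψ ξ) (fun ξ => by
        simp only [BoolFun.res, BoolFun.fa]
        cases ψ (update ξ j true) <;> cases ψ (update ξ j false) <;> rfl)
    have hs1 : sectorBd S (BoolFun.res j true ψ) ⊆ plusSet j (sectorBd S (BoolFun.res j true ψ)) :=
      subset_plusSet fun x hx => apply_eq_zero_of_mem_sector hj hx.1
    have hs2 : sectorBd S (BoolFun.res j false ψ) ⊆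
        minusSet j (sectorBd S (BoolFun.res j false ψ)) :=
      subset_minusSet fun x hx => apply_eq_zero_of_mem_sector hj hx.1
    apply subset_antisymm
    · rintro x ((hx | hx) | (hx | hx))
      · exact (h1 hx).elim (fun h => Or.inl (Or.inl h)) fun h => Or.inr (Or.inr (hs2 h))
      · exact Or.inl (Or.inr hx)
      · exact (h2 hx).elim (fun h => Or.inr (Or.inl h)) fun h => Or.inl (Or.inr (hs1 h))
      · exact Or.inr (Or.inr hx)
    · refine Set.union_subset_union (Set.union_subset_union ?_ le_rfl)
        (Set.union_subset_union ?_ le_rfl) <;>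
      refine Set.subset_inter (sector_mono fun ξ hξ => ?_) (sector_mono fun ξ hξ => ?_) <;>
      revert hξ <;> simp only [BoolFun.res, BoolFun.fa, BoolFun.neg] <;>
      cases ψ (update ξ j true) <;> cases ψ (update ξ j false) <;> simp
  rw [hbd, sector_insert hj, IsBall, halfSpace_insert hz hj, wall_insert hz hj]
  exact ⟨e, he⟩

/-- Points of ψ on both sides of j would yield a point of `fa j ψ`. So one of the two substitutions
vanishes identically, and the sector is a single product with a half-line. -/
lemma isBall_of_fa_eq_false (hz : z ∈ S) (hj : j ∉ S) (hS : SectorsAreBalls S z)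
    {ψ : (ι → Bool) → Bool} (hψ : BoolFun.HReg ψ) (hd : DependsOnly (insert j S) ψ)
    (hne : ∃ ξ, ψ ξ = true) (hα : ∀ ξ, BoolFun.fa j ψ ξ = false) :
    IsBall (insert j S) z (sector (insert j S) ψ) (sectorBd (insert j S) ψ) := by
  have hneg : ∀ χ : (ι → Bool) → Bool, (∀ ξ, χ ξ = false) →
      sector S (BoolFun.neg χ) = coordSpace S := fun χ h =>
    sector_of_forall fun ξ => by simp [BoolFun.neg, h]
  have hbd : ∀ χ : (ι → Bool) → Bool, (∀ ξ, χ ξ = false) → sectorBd S χ = ∅ := fun χ h => by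
    rw [sectorBd, sector_of_forall_false h, Set.empty_inter]
  have hsub : ∀ χ, sector S χ ∩ coordSpace S = sector S χ := fun χ =>
    Set.inter_eq_left.2 fun x hx => hx.1
  have hres : ∃ ξ b, BoolFun.res j b ψ ξ = true := by
    obtain ⟨ξ, hξ⟩ := hne
    exact ⟨ξ, ξ j, by rwa [BoolFun.res, update_eq_self]⟩
  by_cases hφ : ∃ ξ, BoolFun.res j true ψ ξ = true
  · have hθ : ∀ ξ, BoolFun.res j false ψ ξ = false := by
      intro ξ
      by_contra h
      obtain ⟨η, hη⟩ := hφ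
      -- All variables other than j are allowed to vary, so any two points on opposite sides
      -- qualify.
      obtain ⟨ζ, h1, -⟩ := BoolFun.exists_fa_of_hReg (Finset.univ.erase j) (by simp) hψ ξ η
        (by simpa using h) hη (by intro i hi hij; simp [hij] at hi)
      rw [hα] at h1
      exact Bool.false_ne_true h1
    have := isBall_plusSet_sector hz hj hS (hψ.res j true) (hd.res true) hφ
    rw [sector_insert hj, sectorBd_insert hj, hneg _ hθ, hbd _ hθ, sector_of_forall_false hθ,
      minusSet_empty, Set.empty_inter, hsub]
    simpa using this
  · simp only [not_exists, Bool.not_eq_true] at hφ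
    have hθ : ∃ ξ, BoolFun.res j false ψ ξ = true := by
      obtain ⟨ξ, b, h⟩ := hres
      cases b
      · exact ⟨ξ, h⟩
      · simp [hφ] at h
    have := isBall_plusSet_sector hz hj hS (hψ.res j false) (hd.res false) hθ
    rw [sector_insert hj, sectorBd_insert hj, hneg _ hφ, hbd _ hφ, sector_of_forall_false hφ,
      plusSet_empty, Set.empty_inter, hsub, Set.empty_union, Set.empty_union, Set.empty_union]
    refine this.of_iso (CIso.minusPlus j (isPCone_sector S _)) ?_
    have h0 : ∀ x ∈ sector S (BoolFun.res j false ψ), x j = 0 := fun x hx =>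
      apply_eq_zero_of_mem_sector hj hx
    refine CIso.Carries.union ⟨subset_minusSet h0, subset_plusSet h0, fun x hx => ?_, fun x hx => ?_⟩
      ⟨fun x hx => ⟨hx.1, hx.2.1⟩, fun x hx => ⟨hx.1, hx.2.1⟩,
        fun x hx => reflect_mem_plusSet.2 hx, fun x hx => reflect_mem_minusSet.2 hx⟩
    · change reflect j x ∈ _
      rwa [reflect_eq_self (h0 x hx)]
    · change reflect j x ∈ _
      rwa [reflect_eq_self (h0 x hx)]

/-- A point where ψ is 0 makes `fa j ψ` vanish there. So for nonconstant ψ this function is either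
nonconstant or identically 0, and these are the two cases. -/
lemma SectorsAreBalls.insert (hz : z ∈ S) (hj : j ∉ S) (hS : SectorsAreBalls S z) :
    SectorsAreBalls (insert j S) z := by
  intro ψ hψ hd hn
  by_cases hα : ∃ ξ, BoolFun.fa j ψ ξ = true
  · refine isBall_of_fa_nonconst hz hj hS hψ hd ⟨hα, ?_⟩
    obtain ⟨ξ, hξ⟩ := hn.2
    refine ⟨ξ, ?_⟩
    have : BoolFun.res j (ξ j) ψ ξ = false := by rwa [BoolFun.res, update_eq_self]
    simp only [BoolFun.res] at this
    simp only [BoolFun.fa]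
    cases h : ξ j <;> rw [h] at this <;> simp [this]
  · simp only [not_exists, Bool.not_eq_true] at hα
    exact isBall_of_fa_eq_false hz hj hS hψ hd hn.1 hα

lemma sectorsAreBalls_singleton (z : ι) : SectorsAreBalls {z} z := by
  intro ψ _ hd hn
  have hval : ∀ ξ, ψ ξ = ψ fun _ => ξ z := fun ξ => hd _ _ (by simp)
  have hor : ∀ (x : ι → ℝ) (b : Bool), x ∈ coordSpace {z} → (InOrthant (fun _ => b) x ↔
      ((b = true → 0 ≤ x z) ∧ (b = false → x z ≤ 0))) := by
    intro x b hx
    refine ⟨fun h => h z, fun h i => ?_⟩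
    by_cases hi : i = z
    · subst hi; exact h
    · simp [hx i (by simpa using hi)]
  have hsec : ∀ (χ : (ι → Bool) → Bool) (x : ι → ℝ), (∀ ξ, χ ξ = χ fun _ => ξ z) →
      (x ∈ sector {z} χ ↔ x ∈ coordSpace {z} ∧ ∃ b, χ (fun _ => b) = true ∧
        ((b = true → 0 ≤ x z) ∧ (b = false → x z ≤ 0))) := by
    intro χ x hχ
    refine and_congr_right fun hx => ⟨?_, ?_⟩
    · rintro ⟨ξ, h1, h2⟩
      exact ⟨ξ z, hχ ξ ▸ h1, h2 z⟩
    · rintro ⟨b, h1, h2⟩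
      exact ⟨_, h1, (hor x b hx).2 h2⟩
  have hvn : ∀ ξ, BoolFun.neg ψ ξ = BoolFun.neg ψ fun _ => ξ z := fun ξ => by
    simp only [BoolFun.neg]; rw [hval]
  obtain ⟨⟨ξ, h1⟩, η, h2⟩ := hn
  rw [hval] at h1 h2
  have hbd : sectorBd {z} ψ = wall {z} z := by
    ext x
    rw [sectorBd, Set.mem_inter_iff, hsec ψ x hval, hsec _ x hvn]
    simp only [wall, Set.mem_ofPred_eq, BoolFun.neg]
    rw [le_antisymm_iff]
    cases h3 : ξ z <;> cases h4 : η z <;> rw [h3] at h1 <;> rw [h4] at h2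
    · simp [h1] at h2
    · simp only [Bool.exists_bool, h1, h2]; simp; tauto
    · simp only [Bool.exists_bool, h1, h2]; simp; tauto
    · simp [h1] at h2
  rw [hbd]
  cases h3 : ξ z <;> cases h4 : η z <;> rw [h3] at h1 <;> rw [h4] at h2 <;> try simp_all
  · have hs : sector {z} ψ = {x | reflect z x ∈ halfSpace {z} z} := by
      ext x
      rw [hsec ψ x hval]
      simp only [halfSpace, coordSpace, Set.mem_ofPred_eq, reflect_self, h1, h2,
        Finset.mem_singleton]
      refine and_congr (forall_congr' fun i => forall_congr' fun hi => ?_) (by simp)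
      rw [reflect_of_ne hi]
    refine ⟨CIso.reflection z (isPCone_sector _ _) (isPCone_halfSpace _ _) (fun x hx => ?_)
      (fun x hx => ?_), ?_⟩
    · rwa [hs] at hx
    · rw [hs, Set.mem_ofPred_eq, reflect_reflect]; exact hx
    · refine ⟨?_, fun x hx => ⟨hx.1, hx.2.ge⟩, fun x hx => ?_, fun x hx => ?_⟩
      · rw [← hbd]; exact Set.inter_subset_left
      · change reflect z x ∈ _
        rwa [reflect_eq_self hx.2]
      · change reflect z x ∈ _
        rwa [reflect_eq_self hx.2]
  · have hs : sector {z} ψ = halfSpace {z} z := by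
      ext x
      rw [hsec ψ x hval]
      simp [halfSpace, h1, h2]
    rw [hs]
    exact isBall_halfSpace _ _

/-- Sectors of nonconstant hereditarily regular functions are balls. -/
theorem isBall_sector (z : ι) {ψ : (ι → Bool) → Bool} (hψ : BoolFun.HReg ψ) (hn : Nonconst ψ) :
    IsBall Finset.univ z (sector Finset.univ ψ) (sectorBd Finset.univ ψ) := by
  have h : ∀ T : Finset ι, SectorsAreBalls (insert z T) z := by
    intro T
    induction T using Finset.induction_on with
    | empty => exact sectorsAreBalls_singleton z
    | insert j T _ ih =>
      rw [Finset.insert_comm]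
      by_cases hj : j ∈ insert z T
      · rwa [Finset.insert_eq_of_mem hj]
      · exact ih.insert (Finset.mem_insert_self _ _) hj
  have h1 := h Finset.univ
  rw [Finset.insert_eq_of_mem (Finset.mem_univ z)] at h1
  exact h1 ψ hψ (fun ξ η h => congrArg ψ (funext fun i => h i (Finset.mem_univ i))) hn

end SectorInduction


open Filter Topology Function

/-! ### Bounded polyhedra are polytopes -/

section Polytopes

variable {E F : Type*} [NormedAddCommGroup E] [NormedSpace ℝ E] [AddCommGroup F] [Module ℝ F]

lemma convex_hPoly (A : Finset (E →ᵃ[ℝ] ℝ)) : Convex ℝ (hPoly A) := by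
  have : hPoly A = ⋂ l ∈ A, l ⁻¹' Set.Ici 0 := by ext; simp [hPoly]
  rw [this]
  exact convex_iInter₂ fun l _ => (convex_Ici 0).affine_preimage l

lemma isClosed_hPoly [FiniteDimensional ℝ E] (A : Finset (E →ᵃ[ℝ] ℝ)) : IsClosed (hPoly A) := by
  have : hPoly A = ⋂ l ∈ A, l ⁻¹' Set.Ici 0 := by ext; simp [hPoly]
  rw [this]
  exact isClosed_biInter fun l _ => isClosed_Ici.preimage l.continuous_of_finiteDimensional

/-- A polyhedron has finitely many extreme points: each is determined by its active constraints. -/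
lemma finite_extremePoints_hPoly (A : Finset (E →ᵃ[ℝ] ℝ)) : ((hPoly A).extremePoints ℝ).Finite := by
  classical
  refine Set.Finite.of_injOn (f := fun x => A.filter fun l => l x = 0) (t := (A.powerset : Set _))
    (fun x _ => Finset.mem_coe.2 (Finset.mem_powerset.2 (Finset.filter_subset _ _))) ?_
    (Finset.finite_toSet _)
  intro x hx y hy hxy
  have hact : ∀ l ∈ A, l x = 0 → l y = 0 := fun l hl h => by
    have := Finset.ext_iff.1 hxy l
    simp only [Finset.mem_filter, hl, true_and] at this
    exact this.1 h
  -- If x and y have the same active constraints, one can move from x a little both towards and away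
  -- from y. Extremality of x then forces x = y.
  have hev : ∀ w : E, (w = y - x ∨ w = -(y - x)) → ∀ᶠ t in 𝓝[>] (0 : ℝ), x + t • w ∈ hPoly A := by
    intro w hw
    simp only [hPoly, Set.mem_ofPred_eq]
    rw [Filter.eventually_all_finset]
    intro l hl
    have hval : ∀ t : ℝ, l (x + t • w) = l x + t * l.linear w := fun t => by
      rw [add_comm, ← vadd_eq_add, AffineMap.map_vadd, vadd_eq_add, map_smul, smul_eq_mul, add_comm]
    simp only [hval]
    rcases (hx.1 l hl).eq_or_lt with h | h
    · have h0 : l.linear (y - x) = 0 := by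
        rw [← vsub_eq_sub, AffineMap.linearMap_vsub, hact l hl h.symm, ← h]; simp
      have h1 : l.linear w = 0 := by rcases hw with rfl | rfl <;> simp only [map_neg, h0, neg_zero]
      simp [← h, h1]
    · have hc : Tendsto (fun t : ℝ => l x + t * l.linear w) (𝓝 0) (𝓝 (l x + 0 * l.linear w)) :=
        Continuous.tendsto (by fun_prop) 0
      rw [zero_mul, add_zero] at hc
      exact (hc.mono_left nhdsWithin_le_nhds).eventually (eventually_ge_nhds h)
  obtain ⟨t, ⟨h1, h2⟩, ht⟩ := (((hev _ (Or.inl rfl)).and (hev _ (Or.inr rfl))).and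
    self_mem_nhdsWithin).exists
  have ht0 : (0 : ℝ) < t := ht
  have hseg : x ∈ openSegment ℝ (x + t • (y - x)) (x + t • -(y - x)) :=
    ⟨1 / 2, 1 / 2, by norm_num, by norm_num, by norm_num, by module⟩
  have h3 : x + t • (y - x) = x := hx.2 h1 h2 hseg
  have h4 : t • (y - x) = 0 := by simpa using h3
  exact (sub_eq_zero.1 ((smul_eq_zero.1 h4).resolve_left ht0.ne')).symm

/-- A bounded polyhedron is a polytope. -/
lemma exists_eq_convexHull_of_isBounded [FiniteDimensional ℝ E] {A : Finset (E →ᵃ[ℝ] ℝ)}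
    (h : Bornology.IsBounded (hPoly A)) : ∃ t : Finset E, hPoly A = convexHull ℝ (t : Set E) := by
  have hfin := finite_extremePoints_hPoly A
  have hc : IsCompact (hPoly A) :=
    have := FiniteDimensional.proper ℝ E
    Metric.isCompact_of_isClosed_isBounded (isClosed_hPoly A) h
  refine ⟨hfin.toFinset, ?_⟩
  rw [Set.Finite.coe_toFinset, ← (hfin.isClosed_convexHull ℝ).closure_eq,
    closure_convexHull_extremePoints hc (convex_hPoly A)]

end Polytopes

/-! ### From cones back to cubes -/

section Truncation

variable {n : ℕ} {F : Type*} [AddCommGroup F] [Module ℝ F]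

lemma mem_stdCube_iff_norm {x : Fin n → ℝ} : x ∈ stdCube n ↔ ‖x‖ ≤ 1 := by
  rw [pi_norm_le_iff_of_nonneg zero_le_one]
  simp only [stdCube, Set.mem_ofPred_eq, Set.mem_Icc, Real.norm_eq_abs, abs_le]

lemma exists_hCone_inter_stdCube (A : Finset ((Fin n → ℝ) →ₗ[ℝ] ℝ)) :
    ∃ t : Finset (Fin n → ℝ), hCone A ∩ stdCube n = convexHull ℝ (t : Set (Fin n → ℝ)) := by
  classical
  let B : Finset ((Fin n → ℝ) →ᵃ[ℝ] ℝ) := A.image LinearMap.toAffineMap ∪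
    (Finset.univ.image (fun i : Fin n => AffineMap.const ℝ (Fin n → ℝ) (1 : ℝ) +
      (LinearMap.proj (R := ℝ) (φ := fun _ : Fin n => ℝ) i).toAffineMap) ∪
    Finset.univ.image (fun i : Fin n => AffineMap.const ℝ (Fin n → ℝ) (1 : ℝ) -
      (LinearMap.proj (R := ℝ) (φ := fun _ : Fin n => ℝ) i).toAffineMap))
  have hB : hCone A ∩ stdCube n = hPoly B := by
    ext x
    simp only [hCone, stdCube, hPoly, B, Set.mem_inter_iff, Set.mem_ofPred_eq, Finset.mem_union,
      Finset.mem_image, Finset.mem_univ, true_and, or_imp, forall_and, forall_exists_index,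
      and_imp, forall_apply_eq_imp_iff₂, forall_apply_eq_imp_iff, Set.mem_Icc]
    refine and_congr Iff.rfl (and_congr (forall_congr' fun i => ?_) (forall_congr' fun i => ?_))
    · change _ ↔ 0 ≤ 1 + x i
      constructor <;> intro h <;> linarith
    · change _ ↔ 0 ≤ 1 - x i
      constructor <;> intro h <;> linarith
  rw [hB]
  refine exists_eq_convexHull_of_isBounded ?_
  rw [← hB]
  refine (Metric.isBounded_closedBall (x := (0 : Fin n → ℝ)) (r := 1)).subset fun x hx => ?_
  rw [mem_closedBall_zero_iff]
  exact mem_stdCube_iff_norm.1 hx.2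

lemma IsCPLOn.isPLOn_inter_stdCube {f : (Fin n → ℝ) → F} {X : Set (Fin n → ℝ)}
    (h : IsCPLOn f X) : IsPLOn f (X ∩ stdCube n) := by
  classical
  obtain ⟨S, hS, rfl, hf⟩ := h
  choose t ht using exists_hCone_inter_stdCube (n := n)
  refine ⟨hS.toFinset.image t, ?_, fun s hs => ?_⟩
  · rw [Finset.set_biUnion_finset_image]
    simp only [Set.Finite.mem_toFinset, ← ht, Set.iUnion_inter]
  · obtain ⟨A, hA, rfl⟩ := Finset.mem_image.1 hs
    obtain ⟨g, hg⟩ := hf A (hS.mem_toFinset.1 hA)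
    refine ⟨g.toAffineMap, fun x hx => hg ?_⟩
    rw [← ht] at hx
    exact hx.1

lemma IsPLOn.affine_comp {E G : Type*} [AddCommGroup E] [Module ℝ E] [AddCommGroup G] [Module ℝ G]
    {f : E → F} {X : Set E} (h : IsPLOn f X) (b : F →ᵃ[ℝ] G) : IsPLOn (b ∘ f) X := by
  obtain ⟨S, hX, hf⟩ := h
  refine ⟨S, hX, fun s hs => ?_⟩
  obtain ⟨g, hg⟩ := hf s hs
  exact ⟨b.comp g, fun x hx => by simp [hg hx]⟩

lemma IsPLOn.comp_affineEquiv {E G : Type*} [AddCommGroup E] [Module ℝ E] [AddCommGroup G]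
    [Module ℝ G] {f : E → F} {X : Set E} (h : IsPLOn f X) (b : G ≃ᵃ[ℝ] E) :
    IsPLOn (f ∘ b) (b ⁻¹' X) := by
  classical
  obtain ⟨S, rfl, hf⟩ := h
  have hs : ∀ s : Finset E, convexHull ℝ ((s.image b.symm : Finset G) : Set G) =
      b ⁻¹' convexHull ℝ (s : Set E) := fun s => by
    rw [Finset.coe_image]
    have := (b.symm : E →ᵃ[ℝ] G).image_convexHull (s : Set E)
    simp only [AffineEquiv.coe_toAffineMap] at this
    rw [← this]
    exact b.toEquiv.symm.image_eq_preimage_symm _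
  refine ⟨S.image fun s => s.image b.symm, ?_, fun s' hs' => ?_⟩
  · rw [Finset.set_biUnion_finset_image]
    simp only [hs, Set.preimage_iUnion]
  · obtain ⟨s, h1, rfl⟩ := Finset.mem_image.1 hs'
    obtain ⟨g, hg⟩ := hf s h1
    refine ⟨g.comp (b : G →ᵃ[ℝ] E), fun x hx => ?_⟩
    rw [hs] at hx
    simp [hg hx]

lemma PLHomeomorphic.comp_affineEquiv {E G : Type*} [AddCommGroup E] [Module ℝ E] [AddCommGroup G]
    [Module ℝ G] {X : Set E} {Y : Set F} (h : PLHomeomorphic X Y) (b : G ≃ᵃ[ℝ] E) :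
    PLHomeomorphic (b ⁻¹' X) Y := by
  obtain ⟨f, g, hf, hg, h1, h2, h3⟩ := h
  refine ⟨f ∘ b, b.symm ∘ g, hf.comp_affineEquiv b, hg.affine_comp (b.symm : E →ᵃ[ℝ] G),
    fun x hx => h1 hx, fun y hy => ?_, fun x hx => ?_, fun y hy => ?_⟩
  · simpa using h2 hy
  · simp only [comp_apply]
    rw [h3.1 hx, AffineEquiv.symm_apply_apply]
  · simp only [comp_apply, AffineEquiv.apply_symm_apply]
    exact h3.2 hy

/-- Norm-preserving conical isomorphisms restrict to the unit ball of the supremum norm. -/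
lemma CIso.plHomeomorphic {X Y : Set (Fin n → ℝ)} (e : CIso X Y) :
    PLHomeomorphic (X ∩ stdCube n) (Y ∩ stdCube n) := by
  refine ⟨e.f, e.g, e.cplf.isPLOn_inter_stdCube, e.cplg.isPLOn_inter_stdCube,
    fun x hx => ⟨e.mapsf hx.1, ?_⟩, fun x hx => ⟨e.mapsg hx.1, ?_⟩,
    fun x hx => e.left hx.1, fun x hx => e.right hx.1⟩
  · rw [mem_stdCube_iff_norm, e.norm x hx.1]; exact mem_stdCube_iff_norm.1 hx.2
  · rw [mem_stdCube_iff_norm, show ‖e.g x‖ = ‖x‖ from e.symm.norm x hx.1]; exact mem_stdCube_iff_norm.1 hx.2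

lemma sector_inter_stdCube (ψ : (Fin n → Bool) → Bool) :
    sector Finset.univ ψ ∩ stdCube n = cubeUnion ψ := by
  have key : ∀ (b : Bool) (a : ℝ), a ∈ (if b = true then Set.Icc (0 : ℝ) 1 else Set.Icc (-1 : ℝ) 0) ↔
      ((b = true → 0 ≤ a) ∧ (b = false → a ≤ 0)) ∧ -1 ≤ a ∧ a ≤ 1 := by
    intro b a
    cases b
    · simp only [Bool.false_eq_true, if_false, Set.mem_Icc, false_imp_iff, true_and, true_imp_iff]
      constructor
      · rintro ⟨h1, h2⟩; exact ⟨h2, h1, h2.trans zero_le_one⟩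
      · rintro ⟨h1, h2, -⟩; exact ⟨h2, h1⟩
    · simp only [if_true, Set.mem_Icc, true_imp_iff, Bool.true_eq_false, false_imp_iff, and_true]
      constructor
      · rintro ⟨h1, h2⟩; exact ⟨h1, by linarith, h2⟩
      · rintro ⟨h1, -, h2⟩; exact ⟨h1, h2⟩
  ext x
  simp only [cubeUnion, unitSubcube, sector, coordSpace, InOrthant, stdCube, Set.mem_inter_iff,
    Set.mem_ofPred_eq, Set.mem_iUnion, exists_prop, key, forall_and, Set.mem_Icc, Finset.mem_univ,
    not_true, false_imp_iff, implies_true, true_and]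
  constructor
  · rintro ⟨⟨ξ, h1, h2⟩, h3⟩; exact ⟨ξ, h1, h2, h3⟩
  · rintro ⟨ξ, h1, h2, h3⟩; exact ⟨⟨ξ, h1, h2⟩, h3⟩

/-- The affine automorphism taking the interval `[-1,1]` of values of the coordinate `z`
to `[0,1]`. -/
noncomputable def shrinkCoord (z : Fin n) : (Fin n → ℝ) ≃ᵃ[ℝ] (Fin n → ℝ) :=
  AffineEquiv.mk'
    (fun x => (LinearEquiv.piCongrRight fun i => LinearEquiv.smulOfNeZero ℝ ℝ
      (if i = z then (1 / 2 : ℝ) else 1) (by split_ifs <;> norm_num)) x +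
        Pi.single z (1 / 2 : ℝ))
    (LinearEquiv.piCongrRight fun i => LinearEquiv.smulOfNeZero ℝ ℝ
      (if i = z then (1 / 2 : ℝ) else 1) (by split_ifs <;> norm_num)) 0 (by intro x; simp)

lemma shrinkCoord_apply (z i : Fin n) (x : Fin n → ℝ) : shrinkCoord z x i =
    (if i = z then (1 / 2 : ℝ) else 1) * x i + (Pi.single z (1 / 2 : ℝ) : Fin n → ℝ) i := rfl

lemma shrinkCoord_self (z : Fin n) (x : Fin n → ℝ) : shrinkCoord z x z = x z / 2 + 1 / 2 := by
  rw [shrinkCoord_apply, if_pos rfl, Pi.single_eq_same]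
  ring

lemma shrinkCoord_of_ne {z i : Fin n} (h : i ≠ z) (x : Fin n → ℝ) : shrinkCoord z x i = x i := by
  rw [shrinkCoord_apply, if_neg h, Pi.single_eq_of_ne h, one_mul, add_zero]

lemma shrinkCoord_preimage (z : Fin n) :
    shrinkCoord z ⁻¹' (halfSpace Finset.univ z ∩ stdCube n) = stdCube n := by
  ext x
  simp only [halfSpace, coordSpace, stdCube, Set.mem_preimage, Set.mem_inter_iff,
    Set.mem_ofPred_eq, Finset.mem_univ, not_true, false_imp_iff, implies_true, true_and,
    Set.mem_Icc, shrinkCoord_self]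
  constructor
  · rintro ⟨h1, h2⟩ i
    by_cases hi : i = z
    · subst hi
      have := h2 i
      rw [shrinkCoord_self] at this
      constructor <;> linarith
    · have := h2 i
      rwa [shrinkCoord_of_ne hi] at this
  · intro h
    have hz := h z
    refine ⟨by linarith, fun i => ?_⟩
    by_cases hi : i = z
    · subst hi
      rw [shrinkCoord_self]
      constructor <;> linarith
    · rw [shrinkCoord_of_ne hi]; exact h i

/-- For nonconstant ψ the chart onto a half-space is cut by the unit ball of the supremum norm, and
the half cube is then rescaled in one coordinate. The constant 1 gives the whole cube; this covers n
= 0, since a nonconstant function needs a coordinate z. -/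
theorem isClosedPLBall_of_hReg {ψ : (Fin n → Bool) → Bool} (hψ : ∃ ξ, ψ ξ = true)
    (h : BoolFun.HReg ψ) : IsClosedPLBall n (cubeUnion ψ) := by
  change PLHomeomorphic (stdCube n) (cubeUnion ψ)
  rw [← sector_inter_stdCube]
  by_cases hc : ∃ ξ, ψ ξ = false
  · obtain ⟨ξ, hξ⟩ := hψ
    obtain ⟨η, hη⟩ := hc
    have hne : ξ ≠ η := by rintro rfl; rw [hξ] at hη; exact Bool.false_ne_true hη.symm
    obtain ⟨z, -⟩ := Function.ne_iff.1 hne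
    obtain ⟨e, -⟩ := isBall_sector z h ⟨⟨ξ, hξ⟩, η, hη⟩
    have := e.symm.plHomeomorphic.comp_affineEquiv (shrinkCoord z)
    rwa [shrinkCoord_preimage] at this
  · simp only [not_exists, Bool.not_eq_false] at hc
    have hs : sector Finset.univ ψ = Set.univ := by
      rw [sector_of_forall hc]
      ext x
      simp [coordSpace]
    have := (CIso.refl (isPCone_univ (E := Fin n → ℝ))).plHomeomorphic
    rw [hs]
    rwa [Set.univ_inter] at this ⊢

end Truncation

theorem theorem5p4 (n : ℕ) (ψ : (Fin n → Bool) → Bool) (hψ : ∃ ξ, ψ ξ = true) :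
    BoolFun.IsRegular ψ ↔ IsClosedPLBall n (cubeUnion ψ) :=
  ⟨fun h => isClosedPLBall_of_hReg hψ ((BoolFun.isRegular_iff_hReg ψ).1 h),
    isRegular_of_isClosedPLBall⟩
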